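/- Let $d\ge 1$ be an integer, $\nu(x)=1-x^2$, and let $d\nu_d=Z_d^{-1}\,\nu^{\frac d2-1}\,dx$ with $Z_d=\sqrt\pi\,\Gamma(\tfrac d2)/\Gamma(\tfrac{d+1}2)$, a probability measure on $(-1,1)$. For real-valued $f$ write $\|f\|_p=\big(\int_{-1}^1|f|^p\,d\nu_d\big)^{1/p}$ and $\langle f_1,f_2\rangle=\int_{-1}^1 f_1f_2\,d\nu_d$. Let $\mathrm H^1([-1,1],d\nu_d)$ be the space of all $f\in\mathrm L^2(d\nu_d)$ that have a weak derivative $f'$ on $(-1,1)$ with $\int_{-1}^1|f'|^2\,\nu\,d\nu_d<\infty$. Let $\mathcal L h=(1-x^2)\,h''-d\,x\,h'$ be the self-adjoint ultraspherical operator on $\mathrm L^2(d\nu_d)$, whose domain consists of the $h\in\mathrm H^1([-1,1],d\nu_d)$ such that $h'$ is weakly differentiable on $(-1,1)$, $\mathcal L h\in\mathrm L^2(d\nu_d)$ and $\nu^{d/2}h'\to0$ at $\pm1$ (for the continuous representative of $h'$). Put $2^*=\frac{2d}{d-2}$ if $d\ge3$ and $2^*=\infty$ if $d=1,2$. 1.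 For all $f\in\mathrm H^1([-1,1],d\nu_d)$ and all $h$ in the domain of $\mathcal L$, \[-\langle f,\mathcal L h\rangle=\int_{-1}^1 f'\,h'\,\nu\,d\nu_d;\] in particular $-\langle f,\mathcal L f\rangle=\int_{-1}^1|f'|^2\,\nu\,d\nu_d$ for $f$ in the domain of $\mathcal L$. 2. For every real $p\in[1,2^*]$ (so $p<\infty$ if $d=1,2$) with $p\ne2$, every $f\in\mathrm H^1([-1,1],d\nu_d)$ belongs to $\mathrm L^p(d\nu_d)$ and satisfies \[\int_{-1}^1|f'|^2\,\nu\,d\nu_d\ \ge\ d\;\frac{\|f\|_p^2-\|f\|_2^2}{p-2}.\] 3. (Case $p=2$.) For every $f\in\mathrm H^1([-1,1],d\nu_d)$ the function $|f|^2\log\big(|f|^2/\|f\|_2^2\big)$ is $d\nu_d$-integrable (with the convention that it is $0$ where $f=0$) and \[\int_{-1}^1|f'|^2\,\nu\,d\nu_d\ \ge\ \frac d2\int_{-1}^1|f|^2\,\log\Big(\frac{|f|^2}{\|f\|_2^2}\Big)\,d\nu_d.\] -/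

import Mathlib

open MeasureTheory Set Filter Topology
open scoped ContDiff

noncomputable section

namespace Ultraspherical

/-- The weight `ν(x) = 1 - x²`. -/
def nu (x : ℝ) : ℝ := 1 - x ^ 2

/-- The normalization constant `Z_d = √π Γ(d/2) / Γ((d+1)/2)`. -/
def Z (d : ℕ) : ℝ :=
  Real.sqrt Real.pi * Real.Gamma ((d : ℝ) / 2) / Real.Gamma (((d : ℝ) + 1) / 2)

/-- The probability measure `dν_d = Z_d⁻¹ ν^{d/2-1} dx` on `(-1,1)`. -/
def nuMeasure (d : ℕ) : Measure ℝ :=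
  (volume.restrict (Ioo (-1) 1)).withDensity
    (fun x => ENNReal.ofReal ((Z d)⁻¹ * nu x ^ ((d : ℝ) / 2 - 1)))

/-- The scalar product of `L²((-1,1), dν_d)`. -/
def scal (d : ℕ) (f₁ f₂ : ℝ → ℝ) : ℝ := ∫ x, f₁ x * f₂ x ∂(nuMeasure d)

/-- The norm `‖f‖_p = (∫ |f|^p dν_d)^{1/p}`. -/
def normLp (d : ℕ) (p : ℝ) (f : ℝ → ℝ) : ℝ :=
  (∫ x, |f x| ^ p ∂(nuMeasure d)) ^ (1 / p)

/-- `g` is a weak derivative of `f` on `(-1,1)`. -/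
structure HasWeakDeriv (f g : ℝ → ℝ) : Prop where
  locInt : LocallyIntegrableOn f (Ioo (-1) 1) volume
  locInt_deriv : LocallyIntegrableOn g (Ioo (-1) 1) volume
  integral_eq : ∀ φ : ℝ → ℝ, ContDiff ℝ ∞ φ → HasCompactSupport φ → tsupport φ ⊆ Ioo (-1) 1 →
    ∫ x in Ioo (-1 : ℝ) 1, f x * deriv φ x = -∫ x in Ioo (-1 : ℝ) 1, g x * φ x

/-- `f` belongs to `H¹([-1,1], dν_d)`, with weak derivative `f'`: the functions in `L²(dν_d)`
whose energy `∫ |f'|² ν dν_d` is finite, i.e. the form domain of the ultraspherical operator. -/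
structure MemH1 (d : ℕ) (f f' : ℝ → ℝ) : Prop where
  memLp : MemLp f 2 (nuMeasure d)
  weakDeriv : HasWeakDeriv f f'
  energy : Integrable (fun x => |f' x| ^ 2 * nu x) (nuMeasure d)

/-- The ultraspherical expression `(1-x²) f'' - d x f'`, from the first two derivatives of `f`. -/
def ultraOp (d : ℕ) (f' f'' : ℝ → ℝ) (x : ℝ) : ℝ :=
  (1 - x ^ 2) * f'' x - (d : ℝ) * x * f' x

/-- `f`, with weak derivatives `f'` and `f''`, is in the domain of the self-adjoint ultraspherical
operator on `L²(dν_d)`: `f` and the ultraspherical expression of `f` are in the right spaces, and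
the flux `ν^{d/2} f'` vanishes at both endpoints. As `f'` is only determined up to null sets, the
limits are essential limits. (The flux condition is automatic if `d ≥ 2`; for `d = 1` it is the
Neumann condition.) -/
structure MemDomain (d : ℕ) (f f' f'' : ℝ → ℝ) : Prop where
  memH1 : MemH1 d f f'
  weakDeriv₂ : HasWeakDeriv f' f''
  memLp_op : MemLp (ultraOp d f' f'') 2 (nuMeasure d)
  flux_left : Tendsto (fun x => nu x ^ ((d : ℝ) / 2) * f' x) (𝓝[>] (-1) ⊓ ae volume) (𝓝 0)
  flux_right : Tendsto (fun x => nu x ^ ((d : ℝ) / 2) * f' x) (𝓝[<] 1 ⊓ ae volume) (𝓝 0)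

end Ultraspherical

end

/-! The inequality for `p ≠ 2` comes from a rigidity argument. On a symmetric interval `[-r, r]`
with `r < 1` the weight is regular, and with the weight normalized to mass one the Neumann problem
has the same constant `d` there. A positive critical point of energy minus `d / (p - 2) * (‖f‖_p² -
‖f‖_2²)` solves `ν f'' - d x f' = e(f)`. Multiplying by a suitable combination of `f` and its
derivatives (a carré du champ computation after a power change of unknown) gives a flux `Φ` that
vanishes at `±r` and whose derivative is minus a sum of squares. The quadratic form is nonnegative
exactly under the discriminant condition of `discriminant_nonneg`, which is where the critical
exponent enters, so `f` is constant (`rigidity`), and constants give equality.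

Critical points are obtained by minimization. A penalty `δ ∫ (f^(p+4) + f^(-4))` makes the
functional coercive and keeps minimizers away from zero; in one dimension the energy controls a
Hölder norm, so the direct method works even at the critical exponent (`exists_minimizer`). The same
penalty turns the equality case of the rigidity condition into a strict inequality (`nonlin_lt`).
The minimizer is thus constant and its value is nonnegative (`penalized_nonneg`). Letting `δ → 0`,
then replacing `f` by `|f| + 1/(n+1)`, and finally letting `r → 1` gives the inequality on `H¹`;
when `p > 2` the uniform bounds on `[-r, r]` also give the integrability of `|f|^p`.

The logarithmic inequality is the limit `p → 2` from above, made quantitative by convexity instead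
of differentiation under the integral (`MemH1.log_sobolev`).

The integration by parts formula uses that `ν^(d/2) h'` has derivative `ν^(d/2-1) ℒh`. Since this
flux tends to zero at the endpoints and `ℒh` is in `L²`, it is `O(ν^(d/4))`. A nonzero boundary
limit of `f ν^(d/2) h'` would then force `|f|² ν^(d/2-1)` to dominate a multiple of `1/(1-x)`,
against `f ∈ L²`. -/

noncomputable section

namespace Ultraspherical

/-! ### Primitives of integrable functions on compact intervals -/

/-- `f` is a primitive of the integrable function `g` on `[a, b]`. -/
structure IsPrimitiveOn (f g : ℝ → ℝ) (a b : ℝ) : Prop where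
  integrable : IntervalIntegrable g volume a b
  eq : ∀ x ∈ Icc a b, f x = f a + ∫ y in a..x, g y

namespace IsPrimitiveOn

variable {f g u v : ℝ → ℝ} {a b : ℝ}

lemma absolutelyContinuous (h : IsPrimitiveOn f g a b) (hab : a ≤ b) :
    AbsolutelyContinuousOnInterval f a b := by
  have h1 := h.integrable.absolutelyContinuousOnInterval_intervalIntegral
    (c := a) (by simp)
  have h2 : AbsolutelyContinuousOnInterval (fun _ : ℝ => f a) a b :=
    (LipschitzWith.const (f a)).lipschitzOnWith.absolutelyContinuousOnInterval
  have h3 := h2.add h1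
  refine h3.congr' ?_
  rw [EventuallyEq, eventually_inf_principal]
  refine Eventually.of_forall fun E hE => Finset.sum_congr rfl fun i hi => ?_
  have := hE.1 i hi
  rw [uIcc_of_le hab] at this
  rw [h.eq _ this.1, h.eq _ this.2]
  rfl

lemma continuousOn (h : IsPrimitiveOn f g a b) (hab : a ≤ b) : ContinuousOn f (Icc a b) := by
  have := (h.absolutelyContinuous hab).continuousOn
  rwa [uIcc_of_le hab] at this

lemma ae_hasDerivAt (h : IsPrimitiveOn f g a b) (hab : a ≤ b) :
    ∀ᵐ x, x ∈ Ioo a b → HasDerivAt f (g x) x := by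
  filter_upwards [h.integrable.ae_hasDerivAt_integral] with x hx hxm
  rw [uIcc_of_le hab] at hx
  have h1 := (hx (Ioo_subset_Icc_self hxm) a (by simp [hab])).const_add (f a)
  refine h1.congr_of_eventuallyEq ?_
  filter_upwards [Icc_mem_nhds hxm.1 hxm.2] with y hy
  exact h.eq y hy

lemma ae_deriv_eq (h : IsPrimitiveOn f g a b) (hab : a ≤ b) :
    ∀ᵐ x, x ∈ uIoc a b → deriv f x = g x := by
  rw [uIoc_of_le hab]
  have hb : ∀ᵐ x : ℝ, x ≠ b := by simp [ae_iff]
  filter_upwards [h.ae_hasDerivAt hab, hb] with x hx hxb hxm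
  exact (hx ⟨hxm.1, lt_of_le_of_ne hxm.2 hxb⟩).deriv

lemma of_absolutelyContinuous (h : AbsolutelyContinuousOnInterval f a b) (hab : a ≤ b) :
    IsPrimitiveOn f (deriv f) a b where
  integrable := h.intervalIntegrable_deriv
  eq x hx := by
    have h1 : AbsolutelyContinuousOnInterval f a x := by
      refine h.mono ?_
      rw [uIcc_of_le hx.1, uIcc_of_le hab]
      exact Icc_subset_Icc_right hx.2
    rw [h1.integral_deriv_eq_sub]
    ring

lemma integral_mul_eq (hf : IsPrimitiveOn f g a b) (hu : IsPrimitiveOn u v a b) (hab : a ≤ b) :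
    ∫ x in a..b, f x * v x = f b * u b - f a * u a - ∫ x in a..b, g x * u x := by
  have h := (hf.absolutelyContinuous hab).integral_mul_deriv_eq_deriv_mul
    (hu.absolutelyContinuous hab)
  have h1 : ∫ x in a..b, f x * deriv u x = ∫ x in a..b, f x * v x := by
    refine intervalIntegral.integral_congr_ae ?_
    filter_upwards [hu.ae_deriv_eq hab] with x hx hxm
    rw [hx hxm]
  have h2 : ∫ x in a..b, deriv f x * u x = ∫ x in a..b, g x * u x := by
    refine intervalIntegral.integral_congr_ae ?_
    filter_upwards [hf.ae_deriv_eq hab] with x hx hxm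
    rw [hx hxm]
  rw [← h1, ← h2, h]

lemma sub_eq (h : IsPrimitiveOn f g a b) {x y : ℝ} (hx : x ∈ Icc a b) (hy : y ∈ Icc a b) :
    f y - f x = ∫ t in x..y, g t := by
  have hab : a ≤ b := hx.1.trans hx.2
  have key : ∀ z ∈ Icc a b, IntervalIntegrable g volume a z := fun z hz => by
    refine h.integrable.mono_set ?_
    rw [uIcc_of_le hz.1, uIcc_of_le hab]
    exact Icc_subset_Icc_right hz.2
  rw [h.eq x hx, h.eq y hy, ← intervalIntegral.integral_interval_sub_left (key y hy) (key x hx)]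
  ring

lemma mono (h : IsPrimitiveOn f g a b) {a' b' : ℝ} (ha : a ≤ a') (hab : a' ≤ b') (hb : b' ≤ b) :
    IsPrimitiveOn f g a' b' where
  integrable := by
    refine h.integrable.mono_set ?_
    rw [uIcc_of_le hab, uIcc_of_le (ha.trans (hab.trans hb))]
    exact Icc_subset_Icc ha hb
  eq x hx := by
    have := h.sub_eq (x := a') (y := x) ⟨ha, hab.trans hb⟩ ⟨ha.trans hx.1, hx.2.trans hb⟩
    linarith

/-- The absolute value is 1-Lipschitz, so the slopes of `|f| + η` are dominated by those of `f`. For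
`η > 0` this supplies a positive competitor with no more energy. -/
lemma abs_add (h : IsPrimitiveOn f g a b) (hab : a ≤ b) (η : ℝ) :
    ∃ k, Measurable k ∧ IsPrimitiveOn (fun x => |f x| + η) k a b ∧
      ∀ᵐ x, x ∈ Ioo a b → |k x| ≤ |g x| := by
  have hac : AbsolutelyContinuousOnInterval (fun x => |f x| + η) a b := by
    refine squeeze_zero (fun E => Finset.sum_nonneg fun i _ => dist_nonneg) (fun E => ?_)
      (h.absolutelyContinuous hab)
    refine Finset.sum_le_sum fun i _ => ?_
    simp only [Real.dist_eq]
    rw [add_sub_add_right_eq_sub]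
    exact abs_abs_sub_abs_le_abs_sub _ _
  refine ⟨_, measurable_deriv _, of_absolutelyContinuous hac hab, ?_⟩
  filter_upwards [h.ae_hasDerivAt hab] with x hx hxm
  have h1 := hx hxm
  by_cases hd : DifferentiableAt ℝ (fun x => |f x| + η) x
  · have h2 := hd.hasDerivAt
    rw [hasDerivAt_iff_tendsto_slope] at h1 h2
    refine le_of_tendsto_of_tendsto h2.abs h1.abs (Eventually.of_forall fun y => ?_)
    simp only [slope_def_field, abs_div]
    gcongr ?_ / _
    rw [add_sub_add_right_eq_sub]
    exact abs_abs_sub_abs_le_abs_sub _ _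
  -- At points of non-differentiability `deriv` is zero by convention, so the bound is trivial.
  · rw [deriv_zero_of_not_differentiableAt hd]
    simp

end IsPrimitiveOn

/-! ### Weak derivatives: the du Bois-Reymond lemma -/

lemma exists_subset_Icc_of_isCompact {K : Set ℝ} (hK : IsCompact K) (hsub : K ⊆ Ioo (-1) 1) :
    ∃ s : ℝ, 0 < s ∧ s < 1 ∧ K ⊆ Icc (-s) s := by
  rcases K.eq_empty_or_nonempty with rfl | hne
  · exact ⟨1 / 2, by norm_num, by norm_num, empty_subset _⟩
  obtain ⟨x, hx, hmax⟩ := hK.exists_isMaxOn hne continuous_abs.continuousOn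
  have hx1 : |x| < 1 := abs_lt.2 (hsub hx)
  refine ⟨(|x| + 1) / 2, by positivity, by linarith, fun y hy => ?_⟩
  have : |y| ≤ |x| := hmax hy
  exact abs_le.1 (by linarith)

lemma setIntegral_Ioo_eq_intervalIntegral {u : ℝ → ℝ} {s : ℝ} (hs : 0 < s) (hs1 : s < 1)
    (hu : ∀ x, x ∉ Icc (-s) s → u x = 0) :
    ∫ x in Ioo (-1 : ℝ) 1, u x = ∫ x in (-s)..s, u x := by
  rw [intervalIntegral.integral_of_le (by linarith), ← integral_Icc_eq_integral_Ioc]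
  exact setIntegral_eq_of_subset_of_forall_sdiff_eq_zero measurableSet_Ioo
    (Icc_subset_Ioo (by linarith) hs1) fun x hx => hu x hx.2

/-- A smooth function with compact support in `(-1, 1)` and vanishing integral is the derivative of
such a function. -/
lemma exists_deriv_eq_of_integral_eq_zero {ψ : ℝ → ℝ} (hψ : ContDiff ℝ ∞ ψ)
    (hc : HasCompactSupport ψ) (hsub : tsupport ψ ⊆ Ioo (-1) 1)
    (h0 : ∫ x in Ioo (-1 : ℝ) 1, ψ x = 0) :
    ∃ φ : ℝ → ℝ, ContDiff ℝ ∞ φ ∧ HasCompactSupport φ ∧ tsupport φ ⊆ Ioo (-1) 1 ∧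
      deriv φ = ψ := by
  obtain ⟨s, hs0, hs1, hs⟩ := exists_subset_Icc_of_isCompact hc hsub
  have hzero : ∀ x, x ∉ Icc (-s) s → ψ x = 0 := fun x hx =>
    image_eq_zero_of_notMem_tsupport fun h => hx (hs h)
  have hcont : Continuous ψ := hψ.continuous
  have hint : ∀ a b, IntervalIntegrable ψ volume a b := hcont.intervalIntegrable
  set φ : ℝ → ℝ := fun x => ∫ y in (-s)..x, ψ y with hφ
  have hd : ∀ x, HasDerivAt φ (ψ x) x := fun x =>
    intervalIntegral.integral_hasDerivAt_right (hint _ _)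
      hcont.stronglyMeasurable.stronglyMeasurableAtFilter hcont.continuousAt
  have hderiv : deriv φ = ψ := funext fun x => (hd x).deriv
  have htot : ∫ y in (-s)..s, ψ y = 0 := by
    rw [← setIntegral_Ioo_eq_intervalIntegral hs0 hs1 hzero, h0]
  have hφ0 : ∀ x, x ∉ Icc (-s) s → φ x = 0 := by
    intro x hx
    rcases lt_or_ge x (-s) with hxs | hxs
    · refine (intervalIntegral.integral_congr_ae (g := fun _ => 0) ?_).trans (by simp)
      have hne : ∀ᵐ y : ℝ, y ≠ -s := by simp [ae_iff]
      filter_upwards [hne] with y hyne hy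
      rw [uIoc_of_ge hxs.le] at hy
      exact hzero y fun h => hyne (le_antisymm hy.2 h.1)
    · have hxs' : s < x := by
        by_contra! h
        exact hx ⟨hxs, h⟩
      have h1 : ∫ y in s..x, ψ y = 0 := by
        refine (intervalIntegral.integral_congr_ae (g := fun _ => 0) ?_).trans (by simp)
        refine Eventually.of_forall fun y hy => ?_
        rw [uIoc_of_le hxs'.le] at hy
        exact hzero y fun h => (not_lt.2 h.2) hy.1
      -- To the right of the support the primitive equals the total integral, which vanishes.
      simp only [hφ]
      rw [← intervalIntegral.integral_add_adjacent_intervals (hint (-s) s) (hint s x), htot, h1,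
        add_zero]
  have hts : tsupport φ ⊆ Icc (-s) s := by
    refine closure_minimal (fun x hx => ?_) isClosed_Icc
    by_contra h
    exact hx (hφ0 x h)
  refine ⟨φ, ?_, isCompact_Icc.of_isClosed_subset (isClosed_tsupport _) hts,
    hts.trans (Icc_subset_Ioo (by linarith) hs1), hderiv⟩
  rw [contDiff_infty_iff_deriv]
  exact ⟨fun x => (hd x).differentiableAt, by rwa [hderiv]⟩

lemma isPrimitiveOn_intervalIntegral {g : ℝ → ℝ}
    (hg : LocallyIntegrableOn g (Ioo (-1) 1) volume) (C : ℝ) {a b : ℝ} (ha : -1 < a)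
    (hab : a ≤ b) (hb : b < 1) :
    IsPrimitiveOn (fun x => C + ∫ y in (0 : ℝ)..x, g y) g a b := by
  have hi : ∀ x y, x ∈ Ioo (-1 : ℝ) 1 → y ∈ Ioo (-1 : ℝ) 1 →
      IntervalIntegrable g volume x y := fun x y hx hy => by
    rw [intervalIntegrable_iff']
    exact hg.integrableOn_compact_subset
      (fun z hz => ⟨(lt_min hx.1 hy.1).trans_le hz.1, hz.2.trans_lt (max_lt hx.2 hy.2)⟩)
      isCompact_uIcc
  refine ⟨hi a b ⟨ha, hab.trans_lt hb⟩ ⟨ha.trans_le hab, hb⟩, fun x hx => ?_⟩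
  have hxm : x ∈ Ioo (-1 : ℝ) 1 := ⟨ha.trans_le hx.1, hx.2.trans_lt hb⟩
  have ham : a ∈ Ioo (-1 : ℝ) 1 := ⟨ha, hab.trans_lt hb⟩
  rw [← intervalIntegral.integral_add_adjacent_intervals (hi 0 a (by simp) ham) (hi a x ham hxm)]
  ring

/-- A function with a weak derivative agrees almost everywhere with a primitive of it. -/
theorem HasWeakDeriv.exists_isPrimitiveOn {f g : ℝ → ℝ} (h : HasWeakDeriv f g) :
    ∃ F : ℝ → ℝ, (∀ᵐ x, x ∈ Ioo (-1 : ℝ) 1 → F x = f x) ∧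
      ∀ a b : ℝ, -1 < a → a ≤ b → b < 1 → IsPrimitiveOn F g a b := by
  -- `G` also has weak derivative `g`, so `f - G` has weak derivative zero and has to be shown
  -- constant almost everywhere.
  set G : ℝ → ℝ := fun x => 0 + ∫ y in (0 : ℝ)..x, g y with hG
  have hGp : ∀ a b : ℝ, -1 < a → a ≤ b → b < 1 → IsPrimitiveOn G g a b := fun a b ha hab hb =>
    isPrimitiveOn_intervalIntegral h.locInt_deriv 0 ha hab hb
  have hGc : ContinuousOn G (Ioo (-1) 1) := by
    intro x hx
    obtain ⟨a, ha, hax⟩ := exists_between hx.1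
    obtain ⟨b, hxb, hb⟩ := exists_between hx.2
    exact (((hGp a b ha (hax.trans hxb).le hb).continuousOn (hax.trans hxb).le).continuousAt
      (Icc_mem_nhds hax hxb)).continuousWithinAt
  have hGl : LocallyIntegrableOn G (Ioo (-1) 1) volume :=
    hGc.locallyIntegrableOn measurableSet_Ioo
  have hint : ∀ {u φ : ℝ → ℝ}, LocallyIntegrableOn u (Ioo (-1) 1) volume → Continuous φ →
      HasCompactSupport φ → tsupport φ ⊆ Ioo (-1) 1 →
      IntegrableOn (fun x => u x * φ x) (Ioo (-1) 1) volume := by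
    intro u φ hu hφ hφc hφs
    have h1 : IntegrableOn (fun x => u x * φ x) (tsupport φ) volume :=
      (hu.integrableOn_compact_subset hφs hφc).mul_continuousOn hφ.continuousOn hφc
    have h2 : Function.support (fun x => u x * φ x) ⊆ tsupport φ := fun x hx =>
      subset_tsupport _ (right_ne_zero_of_mul hx)
    exact ((integrableOn_iff_integrable_of_support_subset h2).1 h1).integrableOn
  have hGw : ∀ φ : ℝ → ℝ, ContDiff ℝ ∞ φ → HasCompactSupport φ → tsupport φ ⊆ Ioo (-1) 1 →
      ∫ x in Ioo (-1 : ℝ) 1, G x * deriv φ x = -∫ x in Ioo (-1 : ℝ) 1, g x * φ x := by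
    intro φ hφ hφc hφs
    obtain ⟨s, hs0, hs1, hs⟩ := exists_subset_Icc_of_isCompact hφc hφs
    -- The margin between `s` and `s'` makes `φ` vanish at `±s'`, which removes the boundary terms.
    obtain ⟨s', hss', hs'1⟩ := exists_between hs1
    have hz : ∀ x, x ∉ Icc (-s) s → φ x = 0 := fun x hx =>
      image_eq_zero_of_notMem_tsupport fun h => hx (hs h)
    have hz' : ∀ x, x ∉ Icc (-s) s → deriv φ x = 0 := fun x hx =>
      image_eq_zero_of_notMem_tsupport fun h => hx (hs (tsupport_deriv_subset h))
    have hsub : ∀ x, x ∉ Icc (-s') s' → x ∉ Icc (-s) s := fun x hx hx' =>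
      hx ⟨by linarith [hx'.1], by linarith [hx'.2]⟩
    have hs'0 : 0 < s' := hs0.trans hss'
    rw [setIntegral_Ioo_eq_intervalIntegral hs'0 hs'1
        (fun x hx => by rw [hz' x (hsub x hx), mul_zero]),
      setIntegral_Ioo_eq_intervalIntegral hs'0 hs'1
        (fun x hx => by rw [hz x (hsub x hx), mul_zero])]
    have hle : -s' ≤ s' := by linarith
    have hφp : IsPrimitiveOn φ (deriv φ) (-s') s' :=
      IsPrimitiveOn.of_absolutelyContinuous
        ((hφ.of_le (by simp)).contDiffOn.absolutelyContinuousOnInterval) hle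
    rw [(hGp (-s') s' (by linarith) hle hs'1).integral_mul_eq hφp hle,
      hz s' (fun h => by linarith [h.2]), hz (-s') (fun h => by linarith [h.1])]
    ring
  have hzero : ∀ φ : ℝ → ℝ, ContDiff ℝ ∞ φ → HasCompactSupport φ → tsupport φ ⊆ Ioo (-1) 1 →
      ∫ x in Ioo (-1 : ℝ) 1, (f x - G x) * deriv φ x = 0 := by
    intro φ hφ hφc hφs
    have hdc : Continuous (deriv φ) := hφ.continuous_deriv (by simp)
    have hds := (tsupport_deriv_subset (f := φ)).trans hφs
    simp only [sub_mul]
    rw [integral_sub (hint h.locInt hdc hφc.deriv hds) (hint hGl hdc hφc.deriv hds),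
      h.integral_eq φ hφ hφc hφs, hGw φ hφ hφc hφs, sub_self]
  -- A fixed test function of integral one; pairing it with `f - G` identifies the constant `C`.
  let β : ContDiffBump (0 : ℝ) := ⟨1 / 4, 1 / 2, by norm_num, by norm_num⟩
  set ψ₀ : ℝ → ℝ := β.normed volume with hψ₀
  have hψ₀d : ContDiff ℝ ∞ ψ₀ := β.contDiff_normed
  have hψ₀c : HasCompactSupport ψ₀ := β.hasCompactSupport_normed
  have hψ₀s : tsupport ψ₀ ⊆ Ioo (-1) 1 := by
    rw [hψ₀, β.tsupport_normed_eq, Real.closedBall_eq_Icc]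
    exact Icc_subset_Ioo (by norm_num [β]) (by norm_num [β])
  have hsupp : ∀ {φ : ℝ → ℝ}, tsupport φ ⊆ Ioo (-1) 1 → Function.support φ ⊆ Ioo (-1) 1 :=
    fun hφ => (subset_tsupport _).trans hφ
  have hψ₀i : ∫ x in Ioo (-1 : ℝ) 1, ψ₀ x = 1 := by
    rw [setIntegral_eq_integral_of_forall_compl_eq_zero]
    · exact β.integral_normed
    · intro x hx
      by_contra h
      exact hx (hsupp hψ₀s h)
  set C : ℝ := ∫ x in Ioo (-1 : ℝ) 1, (f x - G x) * ψ₀ x with hC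
  have hfG : LocallyIntegrableOn (fun x => f x - G x) (Ioo (-1) 1) volume := h.locInt.sub hGl
  have hae : ∀ᵐ x, x ∈ Ioo (-1 : ℝ) 1 → f x - G x - C = 0 := by
    refine isOpen_Ioo.ae_eq_zero_of_integral_contDiff_smul_eq_zero (μ := volume)
      (f := fun x => f x - G x - C)
      (hfG.sub ((locallyIntegrable_const C).locallyIntegrableOn _)) fun ψ hψ hψc hψs => ?_
    set m : ℝ := ∫ x in Ioo (-1 : ℝ) 1, ψ x with hm
    have hone : LocallyIntegrableOn (fun _ : ℝ => (1 : ℝ)) (Ioo (-1) 1) volume :=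
      (locallyIntegrable_const 1).locallyIntegrableOn _
    have hψi : IntegrableOn ψ (Ioo (-1) 1) volume := by
      simpa using hint hone hψ.continuous hψc hψs
    have hψ₀i' : IntegrableOn ψ₀ (Ioo (-1) 1) volume := by
      simpa using hint hone hψ₀d.continuous hψ₀c hψ₀s
    have hts : tsupport (fun x => ψ x - m * ψ₀ x) ⊆ Ioo (-1) 1 := by
      refine (tsupport_sub ψ (fun x => m * ψ₀ x)).trans (union_subset hψs ?_)
      exact (tsupport_mul_subset_right (f := fun _ => m)).trans hψ₀s
    -- Subtracting `m ψ₀` gives the test function zero mean, hence makes it the derivative of a test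
    -- function, which `f - G` annihilates.
    obtain ⟨φ, hφ, hφc, hφs, hφd⟩ := exists_deriv_eq_of_integral_eq_zero
      (ψ := fun x => ψ x - m * ψ₀ x) (hψ.sub (contDiff_const.mul hψ₀d))
      (hψc.sub (hψ₀c.mul_left (f := fun _ => m))) hts (by
        rw [integral_sub hψi (hψ₀i'.const_mul m), integral_const_mul, hψ₀i, ← hm]
        ring)
    have h1 := hzero φ hφ hφc hφs
    rw [hφd] at h1
    have h2 : ∀ x, (f x - G x) * (ψ x - m * ψ₀ x) =
        (f x - G x) * ψ x - m * ((f x - G x) * ψ₀ x) := fun x => by ring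
    simp only [h2] at h1
    rw [integral_sub (hint hfG hψ.continuous hψc hψs)
      ((hint hfG hψ₀d.continuous hψ₀c hψ₀s).const_mul m), integral_const_mul, ← hC] at h1
    rw [← setIntegral_eq_integral_of_forall_compl_eq_zero (s := Ioo (-1 : ℝ) 1)]
    · have h3 : ∀ x, ψ x • (f x - G x - C) = (f x - G x) * ψ x - C * ψ x := fun x => by
        rw [smul_eq_mul]; ring
      simp only [h3]
      rw [integral_sub (hint hfG hψ.continuous hψc hψs) (hψi.const_mul C), integral_const_mul,
        ← hm]
      linarith
    · intro x hx
      have : ψ x = 0 := by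
        by_contra h
        exact hx (hsupp hψs h)
      rw [this, zero_smul]
  refine ⟨fun x => C + ∫ y in (0 : ℝ)..x, g y, ?_, fun a b ha hab hb =>
    isPrimitiveOn_intervalIntegral h.locInt_deriv C ha hab hb⟩
  filter_upwards [hae] with x hx hxm
  have := hx hxm
  simp only [hG] at this
  linarith

/-! ### The weight `ν` and rigidity of positive Neumann solutions -/

lemma nu_pos {x : ℝ} (hx : x ∈ Ioo (-1 : ℝ) 1) : 0 < nu x := by
  unfold nu
  nlinarith [hx.1, hx.2]

lemma hasDerivAt_nu (x : ℝ) : HasDerivAt nu (-2 * x) x := by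
  exact ((hasDerivAt_pow 2 x).const_sub 1).congr_deriv (by norm_num)

lemma hasDerivAt_nu_rpow {x : ℝ} (hx : x ∈ Ioo (-1 : ℝ) 1) (s : ℝ) :
    HasDerivAt (fun x => nu x ^ s) (-2 * x * s * nu x ^ (s - 1)) x :=
  (hasDerivAt_nu x).rpow_const (Or.inl (nu_pos hx).ne')

lemma nu_rpow_eq_mul {x : ℝ} (hx : x ∈ Ioo (-1 : ℝ) 1) (s : ℝ) :
    nu x ^ s = nu x ^ (s - 1) * nu x := by
  rw [← Real.rpow_add_one (nu_pos hx).ne', sub_add_cancel]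

lemma continuous_nu : Continuous nu := by
  unfold nu
  fun_prop

lemma continuousOn_nu_rpow (s : ℝ) : ContinuousOn (fun x => nu x ^ s) (Ioo (-1) 1) :=
  continuous_nu.continuousOn.rpow_const fun _ hx => Or.inl (nu_pos hx).ne'

/-- The discriminant condition behind the restriction `p ≤ 2 d / (d - 2)` on the exponent. -/
lemma discriminant_nonneg {d : ℕ} {p : ℝ} (hp1 : 1 ≤ p)
    (hp : 3 ≤ d → p ≤ 2 * (d : ℝ) / ((d : ℝ) - 2)) :
    0 ≤ (p - 1) * d * ((d + 2) - (p - 1) * (d - 2)) := by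
  refine mul_nonneg (mul_nonneg (by linarith) (by positivity)) ?_
  rcases le_or_gt 3 d with h | h
  · have hd : (3 : ℝ) ≤ d := by exact_mod_cast h
    have := hp h
    rw [le_div_iff₀ (by linarith)] at this
    linarith
  · have hd : (d : ℝ) ≤ 2 := by
      have : d ≤ 2 := by omega
      exact_mod_cast this
    have : (0 : ℝ) ≤ d := by positivity
    nlinarith

/-- Rigidity: on a symmetric interval, the positive solutions with Neumann boundary conditions of
`ν f'' - d x f' = e(f)` are constant if `(p - 1) e(y) / y - e'(y) < d`. -/
theorem rigidity {d : ℕ} {p : ℝ} (hp1 : 1 ≤ p)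
    (hp : 3 ≤ d → p ≤ 2 * (d : ℝ) / ((d : ℝ) - 2)) {e e₁ : ℝ → ℝ}
    (he : ∀ y, 0 < y → HasDerivAt e (e₁ y) y)
    (hlt : ∀ y, 0 < y → (p - 1) * e y / y - e₁ y < d)
    {r : ℝ} (hr0 : 0 < r) (hr1 : r < 1) {f k k' : ℝ → ℝ}
    (hpos : ∀ x ∈ Icc (-r) r, 0 < f x) (hfc : ContinuousOn f (Icc (-r) r))
    (hkc : ContinuousOn k (Icc (-r) r))
    (hf : ∀ x ∈ Ioo (-r) r, HasDerivAt f (k x) x)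
    (hk : ∀ x ∈ Ioo (-r) r, HasDerivAt k (k' x) x)
    (heq : ∀ x ∈ Ioo (-r) r, nu x * k' x - d * x * k x = e (f x))
    (hl : k (-r) = 0) (hr : k r = 0) :
    ∀ x ∈ Ioo (-r) r, k x = 0 := by
  have hsub : Icc (-r) r ⊆ Ioo (-1) 1 := Icc_subset_Ioo (by linarith) hr1
  -- The terms in `x k³` cancel only for this `c`, and matching the terms in `k² k'` then gives `m`.
  -- Matching those in `k⁴` gives `n - m² = c (3 - 2t) - (t - 1 - m)²`, which is largest at `t = 1 +
  -- m - c`, the value chosen.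
  set t : ℝ := (d + 3 - p) / (d + 2) with ht
  set c : ℝ := (p - 1) * d / (d + 2) with hc
  set m : ℝ := (d - 1) * (p - 1) / (d + 2) with hm
  set n : ℝ := c * t + (p - 2 + t) * (1 - t) with hn
  have hd2 : (0 : ℝ) < d + 2 := by positivity
  have hmn : 0 ≤ n - m ^ 2 := by
    have : n - m ^ 2 = (p - 1) * d * ((d + 2) - (p - 1) * (d - 2)) / (d + 2) ^ 2 := by
      rw [hn, hc, hm, ht]
      field_simp
      ring
    rw [this]
    exact div_nonneg (discriminant_nonneg hp1 hp) (by positivity)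
  -- By the equation, `Φ = ν^(d/2+1) (c f^(2t-3) k³ - f^(2t-2) k k')` in the interior. Writing `e (f
  -- x)` instead of `k'` makes `Φ` continuous up to `±r` and differentiable without a second
  -- derivative of `k`.
  set Φ : ℝ → ℝ := fun x =>
    -(d * x * nu x ^ ((d : ℝ) / 2) * f x ^ (2 * t - 2) * k x ^ 2)
      + c * (nu x * nu x ^ ((d : ℝ) / 2) * f x ^ (2 * t - 3) * k x ^ 3)
      - e (f x) * f x ^ (2 * t - 2) * nu x ^ ((d : ℝ) / 2) * k x with hΦ
  have hfp : ∀ s : ℝ, ContinuousOn (fun x => f x ^ s) (Icc (-r) r) := fun s =>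
    hfc.rpow_const fun x hx => Or.inl (hpos x hx).ne'
  have hnuc : ContinuousOn (fun x => nu x ^ ((d : ℝ) / 2)) (Icc (-r) r) :=
    (continuousOn_nu_rpow _).mono hsub
  have hec : ContinuousOn (fun x => e (f x)) (Icc (-r) r) := by
    have h1 : ContinuousOn e (Ioi 0) := fun y hy => (he y hy).continuousAt.continuousWithinAt
    exact h1.comp hfc fun x hx => hpos x hx
  have hΦc : ContinuousOn Φ (Icc (-r) r) := by
    have h1 := hfp (2 * t - 2)
    have h2 := hfp (2 * t - 3)
    have h3 := continuous_nu.continuousOn (s := Icc (-r) r)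
    exact (((((continuousOn_const.mul continuousOn_id).mul hnuc).mul h1).mul (hkc.pow 2)).neg.add
      ((((h3.mul hnuc).mul h2).mul (hkc.pow 3)).const_smul c)).sub
      (((hec.mul h1).mul hnuc).mul hkc)
  -- The dissipation: the square is that of `(f^t)''`, up to a factor, corrected by a multiple of
  -- `f^(t-2) k²`; the last term carries the spectral gap assumption `hlt`.
  set D : ℝ → ℝ := fun x => nu x ^ ((d : ℝ) / 2 - 1) * f x ^ (2 * t - 4) *
    (nu x ^ 2 * ((f x * k' x + (t - 1 - m) * k x ^ 2) ^ 2 + (n - m ^ 2) * k x ^ 4)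
      + nu x * f x ^ 2 * (d - ((p - 1) * e (f x) / f x - e₁ (f x))) * k x ^ 2) with hD
  have hΦd : ∀ x ∈ Ioo (-r) r, HasDerivAt Φ (-D x) x := by
    intro x hx
    have hxI := Ioo_subset_Icc_self hx
    have hx1 := hsub hxI
    have hν := nu_pos hx1
    have hy := hpos x hxI
    have h1 := hf x hx
    have h2 := hk x hx
    have hV := hasDerivAt_nu_rpow hx1 ((d : ℝ) / 2)
    have hf2 := h1.rpow_const (p := 2 * t - 2) (Or.inl hy.ne')
    have hf3 := h1.rpow_const (p := 2 * t - 3) (Or.inl hy.ne')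
    have hee := (he (f x) hy).comp x h1
    have hk2 := h2.pow 2
    have hk3 := h2.pow 3
    have hA := ((((hasDerivAt_id x).const_mul (d : ℝ)).mul hV).mul hf2).mul hk2
    have hB := ((((hasDerivAt_nu x).mul hV).mul hf3).mul hk3).const_mul c
    have hC := ((hee.mul hf2).mul hV).mul h2
    have hall := (hA.neg.add hB).sub hC
    refine HasDerivAt.congr_deriv (f := Φ) hall ?_
    simp only [hD, Pi.mul_apply, Pi.pow_apply, Function.comp_apply, id_eq]
    have e1 : f x ^ (2 * t - 2) = f x ^ (2 * t - 4) * f x ^ 2 := by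
      rw [← Real.rpow_natCast, ← Real.rpow_add hy]
      congr 1
      push_cast
      ring
    have e2 : f x ^ (2 * t - 3) = f x ^ (2 * t - 4) * f x := by
      rw [← Real.rpow_add_one hy.ne']
      congr 1
      ring
    have e3 : f x ^ (2 * t - 2 - 1) = f x ^ (2 * t - 4) * f x := by
      rw [← Real.rpow_add_one hy.ne']
      congr 1
      ring
    have e4 : f x ^ (2 * t - 3 - 1) = f x ^ (2 * t - 4) := by
      congr 1
      ring
    have e5 := heq x hx
    have e6 := nu_rpow_eq_mul hx1 ((d : ℝ) / 2)
    rw [e1, e2, e3, e4, e6, ← e5]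
    -- With all powers reduced to common factors, the claim is a polynomial identity once the
    -- division by `f x` is cleared.
    generalize f x ^ (2 * t - 4) = R
    generalize nu x ^ ((d : ℝ) / 2 - 1) = V
    generalize e₁ (f x) = E
    have e7 : f x ^ 2 * (d - ((p - 1) * (nu x * k' x - d * x * k x) / f x - E)) =
        d * f x ^ 2 + E * f x ^ 2 - (p - 1) * (nu x * k' x - d * x * k x) * f x := by
      field_simp
      ring
    have e8 : nu x * f x ^ 2 * (d - ((p - 1) * (nu x * k' x - d * x * k x) / f x - E)) =
        nu x * (d * f x ^ 2 + E * f x ^ 2 - (p - 1) * (nu x * k' x - d * x * k x) * f x) := by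
      rw [mul_assoc, e7]
    rw [e8]
    have e9 : n = c * t + (p - 2 + t) * (1 - t) := hn
    have e10 : c = p - 1 - 2 * (p - 1) / (d + 2) := by
      rw [hc]
      field_simp
      ring
    have e11 : m = p - 1 - 3 * (p - 1) / (d + 2) := by
      rw [hm]
      field_simp
      ring
    have e12 : t = 1 - (p - 1) / (d + 2) := by
      rw [ht]
      field_simp
      ring
    have e13 : (p - 1) = (p - 1) / (d + 2) * (d + 2) := by
      field_simp
    -- In terms of `q = (p - 1) / (d + 2)` the constants `t`, `c`, `m`, `n` and `p` are polynomials
    -- in `q` and `d`.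
    generalize (p - 1) / ((d : ℝ) + 2) = q at *
    have e14 : 2 * (p - 1) / ((d : ℝ) + 2) = 2 * q := by
      rw [e13]; field_simp
    have e15 : 3 * (p - 1) / ((d : ℝ) + 2) = 3 * q := by
      rw [e13]; field_simp
    rw [e14] at e10
    rw [e15] at e11
    have e16 : p = 1 + q * (d + 2) := by linarith
    rw [e9, e10, e11, e12, e16]
    simp only [Nat.cast_ofNat]
    ring
  have hD0 : ∀ x ∈ Ioo (-r) r, 0 ≤ nu x ^ ((d : ℝ) / 2 - 1) * f x ^ (2 * t - 4) *
      (nu x ^ 2 * ((f x * k' x + (t - 1 - m) * k x ^ 2) ^ 2 + (n - m ^ 2) * k x ^ 4)) := by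
    intro x hx
    have hxI := Ioo_subset_Icc_self hx
    have hν := nu_pos (hsub hxI)
    have hy := hpos x hxI
    positivity
  have hD1 : ∀ x ∈ Ioo (-r) r, 0 ≤ D x ∧ (D x = 0 → k x = 0) := by
    intro x hx
    have hxI := Ioo_subset_Icc_self hx
    have hν := nu_pos (hsub hxI)
    have hy := hpos x hxI
    have hgap : 0 < d - ((p - 1) * e (f x) / f x - e₁ (f x)) := by linarith [hlt (f x) hy]
    have h1 : D x = nu x ^ ((d : ℝ) / 2 - 1) * f x ^ (2 * t - 4) *
        (nu x ^ 2 * ((f x * k' x + (t - 1 - m) * k x ^ 2) ^ 2 + (n - m ^ 2) * k x ^ 4)) +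
        nu x ^ ((d : ℝ) / 2 - 1) * f x ^ (2 * t - 4) *
        (nu x * f x ^ 2 * (d - ((p - 1) * e (f x) / f x - e₁ (f x)))) * k x ^ 2 := by
      simp only [hD]
      ring
    have h2 : 0 < nu x ^ ((d : ℝ) / 2 - 1) * f x ^ (2 * t - 4) *
        (nu x * f x ^ 2 * (d - ((p - 1) * e (f x) / f x - e₁ (f x)))) := by positivity
    have h3 := hD0 x hx
    refine ⟨by rw [h1]; positivity, fun h => ?_⟩
    have h4 : k x ^ 2 = 0 := by
      by_contra hne
      have : 0 < k x ^ 2 := lt_of_le_of_ne (sq_nonneg _) (Ne.symm hne)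
      have := mul_pos h2 this
      linarith
    exact pow_eq_zero_iff two_ne_zero |>.1 h4
  -- A monotone function with equal values at both ends is constant, so the dissipation vanishes,
  -- and strictness of the gap gives `k = 0`.
  have hanti : AntitoneOn Φ (Icc (-r) r) := by
    refine antitoneOn_of_deriv_nonpos (convex_Icc _ _) hΦc ?_ ?_
    · rw [interior_Icc]
      exact fun x hx => (hΦd x hx).differentiableAt.differentiableWithinAt
    · rw [interior_Icc]
      intro x hx
      rw [(hΦd x hx).deriv]
      linarith [(hD1 x hx).1]
  have hΦl : Φ (-r) = 0 := by simp [hΦ, hl]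
  have hΦr : Φ r = 0 := by simp [hΦ, hr]
  have hrr : -r ≤ r := by linarith
  have hΦ0 : ∀ x ∈ Icc (-r) r, Φ x = 0 := fun x hx => by
    have h1 := hanti (left_mem_Icc.2 hrr) hx hx.1
    have h2 := hanti hx (right_mem_Icc.2 hrr) hx.2
    linarith
  intro x hx
  refine (hD1 x hx).2 ?_
  have h1 : HasDerivAt Φ 0 x := by
    refine (hasDerivAt_const x (0 : ℝ)).congr_of_eventuallyEq ?_
    filter_upwards [Icc_mem_nhds hx.1 hx.2] with y hy
    exact hΦ0 y hy
  have := (hΦd x hx).unique h1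
  linarith

/-! ### The direct method in the unknowns `c` and `γ` -/

/-- The function `c + ∫_l^x b γ`. -/
def prim (b : ℝ → ℝ) (l c : ℝ) (γ : ℝ → ℝ) (x : ℝ) : ℝ := c + ∫ y in l..x, b y * γ y

section Primitives

variable {b : ℝ → ℝ} {l r : ℝ}

lemma memLp_indicator (hb : ContinuousOn b (Icc l r)) (x y : ℝ) :
    MemLp ((Ioc x y).indicator b) 2 (volume.restrict (Ioc l r)) := by
  obtain ⟨B, hB⟩ := isCompact_Icc.exists_bound_of_continuousOn hb
  have hmeas : AEStronglyMeasurable b (volume.restrict (Ioc l r)) :=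
    (hb.mono Ioc_subset_Icc_self).aestronglyMeasurable measurableSet_Ioc
  refine MemLp.of_bound (hmeas.indicator measurableSet_Ioc) B ?_
  filter_upwards [ae_restrict_mem measurableSet_Ioc] with z hz
  by_cases h : z ∈ Ioc x y
  · rw [indicator_of_mem h]
    exact hB z (Ioc_subset_Icc_self hz)
  · rw [indicator_of_notMem h, norm_zero]
    exact (norm_nonneg _).trans (hB z (Ioc_subset_Icc_self hz))

lemma inner_indicator (hb : ContinuousOn b (Icc l r)) {x y : ℝ} (hx : l ≤ x) (hxy : x ≤ y)
    (hy : y ≤ r) (γ : Lp ℝ 2 (volume.restrict (Ioc l r))) :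
    inner ℝ ((memLp_indicator hb x y).toLp _) γ = ∫ z in x..y, b z * γ z := by
  rw [L2.inner_def, intervalIntegral.integral_of_le hxy]
  have h1 : ∀ᵐ z ∂(volume.restrict (Ioc l r)),
      inner ℝ ((memLp_indicator hb x y).toLp _ z) (γ z) =
        (Ioc x y).indicator (fun z => b z * γ z) z := by
    filter_upwards [(memLp_indicator hb x y).coeFn_toLp] with z hz
    rw [hz]
    by_cases h : z ∈ Ioc x y
    · simp [h, mul_comm]
    · simp [h]
  rw [integral_congr_ae h1, integral_indicator measurableSet_Ioc,
    Measure.restrict_restrict measurableSet_Ioc,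
    inter_eq_left.2 (Ioc_subset_Ioc hx hy)]

lemma intervalIntegrable_mul (hlr : l ≤ r) (hb : ContinuousOn b (Icc l r))
    (γ : Lp ℝ 2 (volume.restrict (Ioc l r))) :
    IntervalIntegrable (fun z => b z * γ z) volume l r := by
  rw [intervalIntegrable_iff_integrableOn_Ioc_of_le hlr]
  have h1 : Integrable γ (volume.restrict (Ioc l r)) := (Lp.memLp γ).integrable (by norm_num)
  obtain ⟨B, hB⟩ := isCompact_Icc.exists_bound_of_continuousOn hb
  refine h1.bdd_mul (c := B)
    ((hb.mono Ioc_subset_Icc_self).aestronglyMeasurable measurableSet_Ioc) ?_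
  filter_upwards [ae_restrict_mem measurableSet_Ioc] with z hz
  exact hB z (Ioc_subset_Icc_self hz)

lemma isPrimitiveOn_prim (hlr : l ≤ r) (hb : ContinuousOn b (Icc l r)) (c : ℝ)
    (γ : Lp ℝ 2 (volume.restrict (Ioc l r))) :
    IsPrimitiveOn (prim b l c γ) (fun z => b z * γ z) l r where
  integrable := intervalIntegrable_mul hlr hb γ
  eq x _ := by simp [prim]

/-- Point evaluation is a continuous affine functional of `γ`, so weak convergence in `L²` implies
pointwise convergence of the primitives. With `b = a^(-1/2)` the energy `∫ a |f'|²` is the Hilbert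
norm `‖γ‖²`. -/
lemma prim_eq_inner (hb : ContinuousOn b (Icc l r)) (c : ℝ)
    (γ : Lp ℝ 2 (volume.restrict (Ioc l r))) {x : ℝ} (hx : x ∈ Icc l r) :
    prim b l c γ x = c + inner ℝ ((memLp_indicator hb l x).toLp _) γ := by
  rw [inner_indicator hb le_rfl hx.1 hx.2, prim]

lemma prim_add_smul (hb : ContinuousOn b (Icc l r)) (c c₁ τ : ℝ)
    (γ η : Lp ℝ 2 (volume.restrict (Ioc l r))) {x : ℝ} (hx : x ∈ Icc l r) :
    prim b l (c + τ * c₁) ↑↑(γ + τ • η) x = prim b l c γ x + τ * prim b l c₁ η x := by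
  rw [prim_eq_inner hb _ _ hx, prim_eq_inner hb _ _ hx, prim_eq_inner hb _ _ hx, inner_add_right,
    inner_smul_right]
  ring

/-- Cauchy–Schwarz against the indicator of `(x, y]`: finite energy forces Hölder continuity of
exponent 1/2. -/
lemma abs_prim_sub_le (hlr : l ≤ r) (hb : ContinuousOn b (Icc l r)) {B : ℝ} (hB0 : 0 ≤ B)
    (hB : ∀ x ∈ Icc l r, |b x| ≤ B) (c : ℝ) (γ : Lp ℝ 2 (volume.restrict (Ioc l r))) {x y : ℝ}
    (hx : x ∈ Icc l r) (hy : y ∈ Icc l r) :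
    |prim b l c γ y - prim b l c γ x| ≤ B * ‖γ‖ * √|y - x| := by
  wlog hxy : x ≤ y generalizing x y
  · have := this hy hx (not_le.1 hxy).le
    rwa [abs_sub_comm, abs_sub_comm y x]
  rw [(isPrimitiveOn_prim hlr hb c γ).sub_eq hx hy, ← inner_indicator hb hx.1 hxy hy.2]
  refine (abs_real_inner_le_norm _ _).trans ?_
  rw [mul_right_comm]
  gcongr
  have h1 : ‖(memLp_indicator hb x y).toLp _‖ ^ 2 ≤ B ^ 2 * (y - x) := by
    rw [← real_inner_self_eq_norm_sq, inner_indicator hb hx.1 hxy hy.2,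
      intervalIntegral.integral_of_le hxy]
    have h2 : ∫ z in Ioc x y, b z * (memLp_indicator hb x y).toLp _ z ≤
        ∫ z in Ioc x y, B ^ 2 := by
      have hsub : Ioc x y ⊆ Ioc l r := Ioc_subset_Ioc hx.1 hy.2
      refine setIntegral_mono_on_ae ?_ (integrableOn_const (by simp)) measurableSet_Ioc ?_
      · exact ((intervalIntegrable_iff_integrableOn_Ioc_of_le hlr).1
          (intervalIntegrable_mul hlr hb _)).mono_set hsub
      · have h3 := (ae_restrict_iff' measurableSet_Ioc).1
          (memLp_indicator hb x y).coeFn_toLp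
        filter_upwards [h3] with z hz hzm
        rw [hz (hsub hzm), indicator_of_mem hzm, ← pow_two]
        exact sq_le_sq' (by linarith [(abs_le.1 (hB z (Ioc_subset_Icc_self (hsub hzm)))).1])
          (abs_le.1 (hB z (Ioc_subset_Icc_self (hsub hzm)))).2
    refine h2.trans (le_of_eq ?_)
    simp [hxy, mul_comm]
  rw [abs_of_nonneg (sub_nonneg.2 hxy)]
  refine le_of_sq_le_sq ?_ (by positivity) |> fun h => h
  rw [mul_pow, Real.sq_sqrt (sub_nonneg.2 hxy)]
  exact h1

/-- The direct method for functionals `‖γ‖² + N(c + ∫ b γ)` on positive functions. -/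
theorem exists_minimizer (hlr : l ≤ r) (hb : ContinuousOn b (Icc l r)) {N : (ℝ → ℝ) → ℝ}
    (hcoer : ∀ K, ∃ ε > 0, ∃ M, ∀ c (γ : Lp ℝ 2 (volume.restrict (Ioc l r))),
      (∀ x ∈ Icc l r, 0 < prim b l c γ x) → ‖γ‖ ^ 2 + N (prim b l c γ) ≤ K →
        ‖γ‖ ≤ M ∧ ∀ x ∈ Icc l r, ε ≤ prim b l c γ x ∧ prim b l c γ x ≤ M)
    (hbdd : ∃ B, ∀ c (γ : Lp ℝ 2 (volume.restrict (Ioc l r))),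
      (∀ x ∈ Icc l r, 0 < prim b l c γ x) → B ≤ ‖γ‖ ^ 2 + N (prim b l c γ))
    (hcont : ∀ (f : ℕ → ℝ → ℝ) (g : ℝ → ℝ) (ε M : ℝ), 0 < ε →
      (∀ n, ContinuousOn (f n) (Icc l r)) →
      (∀ n, ∀ x ∈ Icc l r, ε ≤ f n x ∧ f n x ≤ M) →
      (∀ x ∈ Icc l r, Tendsto (fun n => f n x) atTop (𝓝 (g x))) →
      Tendsto (fun n => N (f n)) atTop (𝓝 (N g)))
    (hne : ∃ c, ∃ γ : Lp ℝ 2 (volume.restrict (Ioc l r)), ∀ x ∈ Icc l r, 0 < prim b l c γ x) :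
    ∃ c, ∃ γ : Lp ℝ 2 (volume.restrict (Ioc l r)), (∀ x ∈ Icc l r, 0 < prim b l c γ x) ∧
      ∀ c' (γ' : Lp ℝ 2 (volume.restrict (Ioc l r))), (∀ x ∈ Icc l r, 0 < prim b l c' γ' x) →
        ‖γ‖ ^ 2 + N (prim b l c γ) ≤ ‖γ'‖ ^ 2 + N (prim b l c' γ') := by
  set H := Lp ℝ 2 (volume.restrict (Ioc l r))
  set S : Set ℝ := {z | ∃ c, ∃ γ : H, (∀ x ∈ Icc l r, 0 < prim b l c γ x) ∧
    z = ‖γ‖ ^ 2 + N (prim b l c γ)} with hS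
  obtain ⟨B, hB⟩ := hbdd
  have hSne : S.Nonempty := by
    obtain ⟨c, γ, h⟩ := hne
    exact ⟨_, c, γ, h, rfl⟩
  have hSb : BddBelow S := ⟨B, by rintro _ ⟨c, γ, h, rfl⟩; exact hB c γ h⟩
  obtain ⟨z, -, hzt, hzS⟩ := exists_seq_tendsto_sInf hSne hSb
  choose c γ hpos hz using hzS
  obtain ⟨K, hK⟩ := hzt.bddAbove_range
  obtain ⟨ε, hε, M, hM⟩ := hcoer K
  have hbd : ∀ n, ‖γ n‖ ≤ M ∧ ∀ x ∈ Icc l r, ε ≤ prim b l (c n) (γ n) x ∧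
      prim b l (c n) (γ n) x ≤ M := fun n => by
    refine hM (c n) (γ n) (hpos n) ?_
    rw [← hz n]
    exact hK ⟨n, rfl⟩
  have hcl : ∀ n, prim b l (c n) (γ n) l = c n := fun n => by simp [prim]
  have hlm : l ∈ Icc l r := left_mem_Icc.2 hlr
  -- The constant `c n` is the value at `l`, hence lies in `[ε, M]`.
  obtain ⟨c₀, -, φ₁, hφ₁, hc₀⟩ := (isCompact_Icc (a := ε) (b := M)).isSeqCompact
    (x := c) (fun n => by
      have := (hbd n).2 l hlm
      rwa [hcl n] at this)
  -- This gives separability of `L²`, on which sequential compactness of balls for the weak-*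
  -- topology rests.
  have : Fact ((2 : ENNReal) ≠ ⊤) := ⟨by simp⟩
  have hball := WeakDual.isSeqCompact_closedBall ℝ H 0 M
  obtain ⟨ψ, -, φ₂, hφ₂, hψ⟩ := hball
    (x := fun n => StrongDual.toWeakDual (InnerProductSpace.toDual ℝ H (γ (φ₁ n)))) (fun n => by
      have h1 : ‖InnerProductSpace.toDual ℝ H (γ (φ₁ n))‖ ≤ M := by
        rw [LinearIsometryEquiv.norm_map]
        exact (hbd _).1
      simpa using h1)
  set γ₀ : H := (InnerProductSpace.toDual ℝ H).symm (WeakDual.toStrongDual ψ) with hγ₀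
  have hweak : ∀ v : H, Tendsto (fun n => inner ℝ (γ (φ₁ (φ₂ n))) v) atTop
      (𝓝 (inner ℝ γ₀ v)) := by
    intro v
    have h1 := ((WeakDual.eval_continuous v).tendsto ψ).comp hψ
    have h2 : inner ℝ γ₀ v = ψ v := by
      rw [hγ₀, InnerProductSpace.toDual_symm_apply]
      rfl
    rw [h2]
    exact h1
  have hcc : Tendsto (fun n => c (φ₁ (φ₂ n))) atTop (𝓝 c₀) := hc₀.comp hφ₂.tendsto_atTop
  have hptw : ∀ x ∈ Icc l r, Tendsto (fun n => prim b l (c (φ₁ (φ₂ n))) (γ (φ₁ (φ₂ n))) x) atTop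
      (𝓝 (prim b l c₀ γ₀ x)) := by
    intro x hx
    simp only [prim_eq_inner hb _ _ hx]
    refine hcc.add ?_
    have := hweak ((memLp_indicator hb l x).toLp _)
    have hcomm : ∀ u v : H, inner ℝ u v = inner ℝ v u := fun u v => real_inner_comm v u
    rw [hcomm]
    exact this.congr fun n => hcomm _ _
  have hpos₀ : ∀ x ∈ Icc l r, 0 < prim b l c₀ γ₀ x := fun x hx =>
    hε.trans_le (ge_of_tendsto (hptw x hx) (Eventually.of_forall fun n => ((hbd _).2 x hx).1))
  have hN := hcont (fun n => prim b l (c (φ₁ (φ₂ n))) (γ (φ₁ (φ₂ n)))) _ ε M hε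
    (fun n => (isPrimitiveOn_prim hlr hb _ _).continuousOn hlr) (fun n => (hbd _).2) hptw
  have hzt' : Tendsto (fun n => z (φ₁ (φ₂ n))) atTop (𝓝 (sInf S)) :=
    hzt.comp (hφ₁.tendsto_atTop.comp hφ₂.tendsto_atTop)
  -- The total value converges along the minimizing sequence and `N` is continuous, so the norms
  -- converge as well.
  have hsq : Tendsto (fun n => ‖γ (φ₁ (φ₂ n))‖ ^ 2) atTop
      (𝓝 (sInf S - N (prim b l c₀ γ₀))) := by
    refine (hzt'.sub hN).congr fun n => ?_
    rw [hz]
    ring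
  refine ⟨c₀, γ₀, hpos₀, fun c' γ' h' => ?_⟩
  -- Weak lower semicontinuity of the norm, from `⟨γₙ, γ₀⟩ ≤ (‖γₙ‖² + ‖γ₀‖²) / 2`.
  have h1 : ‖γ₀‖ ^ 2 ≤ ((sInf S - N (prim b l c₀ γ₀)) + ‖γ₀‖ ^ 2) / 2 := by
    have h2 := hweak γ₀
    rw [real_inner_self_eq_norm_sq] at h2
    refine le_of_tendsto_of_tendsto h2 ((hsq.add_const (‖γ₀‖ ^ 2)).div_const 2)
      (Eventually.of_forall fun n => ?_)
    have h3 := real_inner_le_norm (γ (φ₁ (φ₂ n))) γ₀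
    have h4 := two_mul_le_add_sq ‖γ (φ₁ (φ₂ n))‖ ‖γ₀‖
    simp only
    linarith
  have h2 : sInf S ≤ ‖γ'‖ ^ 2 + N (prim b l c' γ') := csInf_le hSb ⟨c', γ', h', rfl⟩
  linarith

end Primitives

/-! ### Weighted power integrals: continuity, derivatives and bounds -/

/-- The weighted power integral `∫_l^r w f^s`. -/
def powInt (w : ℝ → ℝ) (l r s : ℝ) (f : ℝ → ℝ) : ℝ := ∫ x in l..r, w x * f x ^ s

lemma rpow_le_rpow_add_rpow {ε M y : ℝ} (hε : 0 < ε) (h1 : ε ≤ y) (h2 : y ≤ M) (s : ℝ) :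
    y ^ s ≤ ε ^ s + M ^ s := by
  have hy := hε.trans_le h1
  rcases le_total 0 s with hs | hs
  · have := Real.rpow_le_rpow hy.le h2 hs
    have := Real.rpow_nonneg hε.le s
    linarith
  · have := Real.rpow_le_rpow_of_nonpos hε h1 hs
    have := Real.rpow_nonneg (hy.le.trans h2) s
    linarith

section PowInt

variable {w : ℝ → ℝ} {l r : ℝ}

lemma intervalIntegrable_mul_rpow (hlr : l ≤ r) (hw : ContinuousOn w (Icc l r)) {f : ℝ → ℝ}
    (hf : ContinuousOn f (Icc l r)) (hpos : ∀ x ∈ Icc l r, 0 < f x) (s : ℝ) :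
    IntervalIntegrable (fun x => w x * f x ^ s) volume l r := by
  refine ContinuousOn.intervalIntegrable ?_
  rw [uIcc_of_le hlr]
  exact hw.mul (hf.rpow_const fun x hx => Or.inl (hpos x hx).ne')

lemma powInt_nonneg (hlr : l ≤ r) (hw0 : ∀ x ∈ Icc l r, 0 ≤ w x) {f : ℝ → ℝ}
    (hpos : ∀ x ∈ Icc l r, 0 < f x) (s : ℝ) : 0 ≤ powInt w l r s f :=
  intervalIntegral.integral_nonneg hlr fun x hx =>
    mul_nonneg (hw0 x hx) (Real.rpow_nonneg (hpos x hx).le s)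

lemma powInt_pos (hlr : l < r) (hw : ContinuousOn w (Icc l r)) (hw0 : ∀ x ∈ Icc l r, 0 < w x)
    {f : ℝ → ℝ} (hf : ContinuousOn f (Icc l r)) (hpos : ∀ x ∈ Icc l r, 0 < f x) (s : ℝ) :
    0 < powInt w l r s f :=
  intervalIntegral.intervalIntegral_pos_of_pos_on (intervalIntegrable_mul_rpow hlr.le hw hf hpos s)
    (fun x hx => mul_pos (hw0 x (Ioo_subset_Icc_self hx))
      (Real.rpow_pos_of_pos (hpos x (Ioo_subset_Icc_self hx)) s)) hlr

lemma powInt_const (hw1 : ∫ x in l..r, w x = 1) (s c : ℝ) :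
    powInt w l r s (fun _ => c) = c ^ s := by
  simp [powInt, hw1]

lemma powInt_congr (hlr : l ≤ r) {f g : ℝ → ℝ} (h : ∀ x ∈ Icc l r, f x = g x) (s : ℝ) :
    powInt w l r s f = powInt w l r s g := by
  refine intervalIntegral.integral_congr fun x hx => ?_
  rw [uIcc_of_le hlr] at hx
  simp only [h x hx]

lemma tendsto_powInt (hlr : l ≤ r) (hw : ContinuousOn w (Icc l r)) {f : ℕ → ℝ → ℝ}
    {g : ℝ → ℝ} {ε M : ℝ} (hε : 0 < ε) (hfc : ∀ n, ContinuousOn (f n) (Icc l r))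
    (hb : ∀ n, ∀ x ∈ Icc l r, ε ≤ f n x ∧ f n x ≤ M)
    (hlim : ∀ x ∈ Icc l r, Tendsto (fun n => f n x) atTop (𝓝 (g x))) (s : ℝ) :
    Tendsto (fun n => powInt w l r s (f n)) atTop (𝓝 (powInt w l r s g)) := by
  refine intervalIntegral.tendsto_integral_filter_of_dominated_convergence
    (fun x => |w x| * (ε ^ s + M ^ s)) ?_ ?_ ?_ ?_
  · refine Eventually.of_forall fun n => ?_
    rw [uIoc_of_le hlr]
    refine (ContinuousOn.mono ?_ Ioc_subset_Icc_self).aestronglyMeasurable measurableSet_Ioc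
    exact hw.mul ((hfc n).rpow_const fun x hx => Or.inl (hε.trans_le (hb n x hx).1).ne')
  · refine Eventually.of_forall fun n => Eventually.of_forall fun x hx => ?_
    rw [uIoc_of_le hlr] at hx
    have h := hb n x (Ioc_subset_Icc_self hx)
    rw [norm_mul, Real.norm_eq_abs, Real.norm_eq_abs,
      abs_of_nonneg (Real.rpow_nonneg (hε.le.trans h.1) s)]
    gcongr
    exact rpow_le_rpow_add_rpow hε h.1 h.2 s
  · refine ContinuousOn.intervalIntegrable ?_
    rw [uIcc_of_le hlr]
    exact hw.abs.mul continuousOn_const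
  · refine Eventually.of_forall fun x hx => ?_
    rw [uIoc_of_le hlr] at hx
    have hxI := Ioc_subset_Icc_self hx
    have hg : ε ≤ g x := ge_of_tendsto (hlim x hxI) (Eventually.of_forall fun n => (hb n x hxI).1)
    exact ((hlim x hxI).rpow_const (Or.inl (hε.trans_le hg).ne')).const_mul _

lemma hasDerivAt_powInt (hlr : l ≤ r) (hw : ContinuousOn w (Icc l r)) {f φ : ℝ → ℝ} {ε : ℝ}
    (hε : 0 < ε) (hf : ContinuousOn f (Icc l r)) (hφ : ContinuousOn φ (Icc l r))
    (hfε : ∀ x ∈ Icc l r, ε ≤ f x) (s : ℝ) :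
    HasDerivAt (fun τ => powInt w l r s (fun x => f x + τ * φ x))
      (∫ x in l..r, w x * (s * f x ^ (s - 1)) * φ x) 0 := by
  obtain ⟨A, hA⟩ := isCompact_Icc.exists_bound_of_continuousOn hφ
  obtain ⟨M, hM⟩ := isCompact_Icc.exists_bound_of_continuousOn hf
  -- For `|τ| < ρ` the perturbation is at most `ε / 2`, so `f + τ φ` stays in `[ε / 2, M + ε / 2]`
  -- and every real power is controlled.
  set ρ : ℝ := ε / (2 * (|A| + 1)) with hρ
  have hA1 : 0 < |A| + 1 := by positivity
  have hρ0 : 0 < ρ := by positivity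
  have hbd : ∀ τ ∈ Metric.ball (0 : ℝ) ρ, ∀ x ∈ Icc l r,
      ε / 2 ≤ f x + τ * φ x ∧ f x + τ * φ x ≤ M + ε / 2 := by
    intro τ hτ x hx
    have h1 : |τ| < ρ := by simpa using hτ
    have h2 : |τ * φ x| ≤ ε / 2 := by
      rw [abs_mul]
      have h3 : |φ x| ≤ |A| + 1 := by
        have := hA x hx
        rw [Real.norm_eq_abs] at this
        linarith [le_abs_self A]
      calc |τ| * |φ x| ≤ ρ * (|A| + 1) := by gcongr
        _ = ε / 2 := by rw [hρ]; field_simp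
    have h4 := abs_le.1 h2
    have h5 := hfε x hx
    have h6 := hM x hx
    rw [Real.norm_eq_abs] at h6
    have h7 := (abs_le.1 h6).2
    constructor <;> linarith [h4.1, h4.2]
  have hε2 : 0 < ε / 2 := by positivity
  have key := intervalIntegral.hasDerivAt_integral_of_dominated_loc_of_deriv_le
    (μ := volume) (a := l) (b := r) (F := fun τ x => w x * (f x + τ * φ x) ^ s)
    (F' := fun τ x => w x * (s * (f x + τ * φ x) ^ (s - 1)) * φ x) (x₀ := (0 : ℝ))
    (s := Metric.ball 0 ρ)
    (bound := fun x => |w x| * (|s| * ((ε / 2) ^ (s - 1) + (M + ε / 2) ^ (s - 1))) * |φ x|)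
    (Metric.ball_mem_nhds _ hρ0) ?_ ?_ ?_ ?_ ?_ ?_
  · have := key.2
    simp only [zero_mul, add_zero] at this
    exact this
  · filter_upwards [Metric.ball_mem_nhds (0 : ℝ) hρ0] with τ hτ
    rw [uIoc_of_le hlr]
    refine (ContinuousOn.mono ?_ Ioc_subset_Icc_self).aestronglyMeasurable measurableSet_Ioc
    refine hw.mul ((hf.add (continuousOn_const.mul hφ)).rpow_const fun x hx => Or.inl ?_)
    exact (hε2.trans_le (hbd τ hτ x hx).1).ne'
  · simp only [zero_mul, add_zero]
    exact intervalIntegrable_mul_rpow hlr hw hf (fun x hx => hε.trans_le (hfε x hx)) s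
  · simp only [zero_mul, add_zero]
    rw [uIoc_of_le hlr]
    refine (ContinuousOn.mono ?_ Ioc_subset_Icc_self).aestronglyMeasurable measurableSet_Ioc
    exact (hw.mul (continuousOn_const.mul
      (hf.rpow_const fun x hx => Or.inl (hε.trans_le (hfε x hx)).ne'))).mul hφ
  · refine Eventually.of_forall fun x hx τ hτ => ?_
    rw [uIoc_of_le hlr] at hx
    have h := hbd τ hτ x (Ioc_subset_Icc_self hx)
    simp only [norm_mul, Real.norm_eq_abs]
    rw [abs_of_nonneg (Real.rpow_nonneg (hε2.le.trans h.1) _)]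
    gcongr
    exact rpow_le_rpow_add_rpow hε2 h.1 h.2 _
  · refine ContinuousOn.intervalIntegrable ?_
    rw [uIcc_of_le hlr]
    exact (hw.abs.mul continuousOn_const).mul hφ.abs
  · refine Eventually.of_forall fun x hx τ hτ => ?_
    rw [uIoc_of_le hlr] at hx
    have h := hbd τ hτ x (Ioc_subset_Icc_self hx)
    have h1 : HasDerivAt (fun τ => f x + τ * φ x) (φ x) τ :=
      ((hasDerivAt_mul_const (φ x)).const_add (f x))
    refine ((h1.rpow_const (p := s) (Or.inl (hε2.trans_le h.1).ne')).const_mul (w x)).congr_deriv ?_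
    ring

/-- Lower powers grow at most like the square root of the penalty, hence can be absorbed by it. The
exponents satisfy `2 / s ≤ 2` and `2 / N ≤ 1 / 2`. -/
lemma powInt_rpow_le (hlr : l ≤ r) (hw : ContinuousOn w (Icc l r))
    (hw0 : ∀ x ∈ Icc l r, 0 ≤ w x) (hw1 : ∫ x in l..r, w x = 1) {f : ℝ → ℝ}
    (hf : ContinuousOn f (Icc l r)) (hpos : ∀ x ∈ Icc l r, 0 < f x) {s N : ℝ} (hs : 1 ≤ s)
    (hsN : s ≤ N) (hN : 4 ≤ N) :
    powInt w l r s f ^ (2 / s) ≤ 4 * √(1 + powInt w l r N f) := by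
  set S := powInt w l r N f with hS
  have hS0 : 0 ≤ S := powInt_nonneg hlr hw0 hpos N
  -- The level at which `f^s` is split: below it `f^s ≤ K^s`, above it `f^s ≤ f^N K^(s-N)`; the
  -- choice `K^N = 1 + S` makes both contributions at most `K^s`.
  set K : ℝ := (1 + S) ^ (1 / N) with hK
  have hK0 : 0 < K := Real.rpow_pos_of_pos (by linarith) _
  have hKN : K ^ N = 1 + S := by
    rw [hK, ← Real.rpow_mul (by linarith), one_div_mul_cancel (by linarith), Real.rpow_one]
  have h1 : powInt w l r s f ≤ K ^ s + S * K ^ (s - N) := by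
    have h2 : ∫ x in l..r, (w x * K ^ s + w x * f x ^ N * K ^ (s - N)) =
        K ^ s + S * K ^ (s - N) := by
      rw [intervalIntegral.integral_add, intervalIntegral.integral_mul_const,
        intervalIntegral.integral_mul_const, hw1, one_mul, hS, powInt]
      · refine ContinuousOn.intervalIntegrable ?_
        rw [uIcc_of_le hlr]
        exact hw.mul continuousOn_const
      · exact (intervalIntegrable_mul_rpow hlr hw hf hpos N).mul_const _
    rw [← h2]
    refine intervalIntegral.integral_mono_on hlr (intervalIntegrable_mul_rpow hlr hw hf hpos s)
      ?_ fun x hx => ?_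
    · refine IntervalIntegrable.add ?_ ((intervalIntegrable_mul_rpow hlr hw hf hpos N).mul_const _)
      refine ContinuousOn.intervalIntegrable ?_
      rw [uIcc_of_le hlr]
      exact hw.mul continuousOn_const
    · rw [mul_assoc, ← mul_add]
      refine mul_le_mul_of_nonneg_left ?_ (hw0 x hx)
      have hy := hpos x hx
      rcases le_total (f x) K with h | h
      · have := Real.rpow_le_rpow hy.le h (by linarith : 0 ≤ s)
        have : 0 ≤ f x ^ N * K ^ (s - N) := by positivity
        linarith
      · have h3 := Real.rpow_le_rpow_of_nonpos hK0 h (by linarith : s - N ≤ 0)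
        have h4 : f x ^ s = f x ^ N * f x ^ (s - N) := by
          rw [← Real.rpow_add hy]
          congr 1
          ring
        rw [h4]
        have h5 : f x ^ N * f x ^ (s - N) ≤ f x ^ N * K ^ (s - N) := by gcongr
        have : 0 ≤ K ^ s := by positivity
        linarith
  have h2 : powInt w l r s f ≤ 2 * K ^ s := by
    refine h1.trans ?_
    have h3 : K ^ (s - N) = K ^ s / (1 + S) := by rw [Real.rpow_sub hK0, hKN]
    have h4 : S / (1 + S) ≤ 1 := (div_le_one (by linarith)).2 (by linarith)
    rw [h3]
    calc K ^ s + S * (K ^ s / (1 + S)) = K ^ s * (1 + S / (1 + S)) := by ring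
      _ ≤ K ^ s * (1 + 1) := by gcongr
      _ = 2 * K ^ s := by ring
  have h0 := powInt_nonneg hlr hw0 hpos s
  calc powInt w l r s f ^ (2 / s) ≤ (2 * K ^ s) ^ (2 / s) := by gcongr
    _ = 2 ^ (2 / s) * (1 + S) ^ (2 / N) := by
      rw [Real.mul_rpow (by norm_num) (by positivity), ← Real.rpow_mul hK0.le,
        mul_div_cancel₀ _ (by linarith : s ≠ 0), hK, ← Real.rpow_mul (by linarith)]
      congr 2
      ring
    _ ≤ 2 ^ (2 : ℝ) * (1 + S) ^ (1 / 2 : ℝ) := by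
      refine mul_le_mul (Real.rpow_le_rpow_of_exponent_le (by norm_num) ?_)
        (Real.rpow_le_rpow_of_exponent_le (by linarith) ?_) (by positivity) (by positivity)
      · rw [div_le_iff₀ (by linarith)]
        linarith
      · rw [div_le_div_iff₀ (by linarith) (by norm_num)]
        linarith
    _ = 4 * √(1 + S) := by
      rw [Real.sqrt_eq_rpow]
      norm_num

/-- The oscillation bound gives `f ≥ f x - A` everywhere, so a large value at one point makes the
whole integral large. -/
lemma le_of_powInt_le (hlr : l ≤ r) (hw : ContinuousOn w (Icc l r))
    (hw0 : ∀ x ∈ Icc l r, 0 ≤ w x) (hw1 : ∫ x in l..r, w x = 1) {f : ℝ → ℝ}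
    (hf : ContinuousOn f (Icc l r)) (hpos : ∀ x ∈ Icc l r, 0 < f x) {N A S : ℝ} (hN : 1 ≤ N)
    (hosc : ∀ x ∈ Icc l r, ∀ y ∈ Icc l r, |f y - f x| ≤ A) (hS : powInt w l r N f ≤ S) :
    ∀ x ∈ Icc l r, f x ≤ A + 1 + S := by
  intro x hx
  have hS0 : 0 ≤ S := (powInt_nonneg hlr hw0 hpos N).trans hS
  rcases le_or_gt (f x - A) 1 with h | h
  · linarith
  · have h1 : (f x - A) ^ N ≤ powInt w l r N f := by
      rw [← powInt_const (w := w) hw1 N (f x - A)]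
      refine intervalIntegral.integral_mono_on hlr
        (intervalIntegrable_mul_rpow hlr hw continuousOn_const (fun _ _ => by linarith) N)
        (intervalIntegrable_mul_rpow hlr hw hf hpos N) fun y hy => ?_
      have h2 := hosc x hx y hy
      have h3 := (abs_le.1 h2).1
      have := hw0 y hy
      gcongr
      · linarith
    have h4 : f x - A ≤ (f x - A) ^ N := Real.self_le_rpow_of_one_le h.le hN
    linarith

/-- A function that is Hölder of exponent 1/2 and small at `x` is of size `f x` on an interval of
length `(f x)²`. There `f^(-4)` contributes at least a multiple of `(f x)^(-2)`, so the integral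
bounds `f x` from below. -/
lemma exists_le_of_powInt_le (hlr : l < r) (hw : ContinuousOn w (Icc l r)) {w₀ : ℝ}
    (hw₀ : 0 < w₀) (hw0 : ∀ x ∈ Icc l r, w₀ ≤ w x) (A K : ℝ) :
    ∃ ε > 0, ∀ f : ℝ → ℝ, ContinuousOn f (Icc l r) → (∀ x ∈ Icc l r, 0 < f x) →
      (∀ x ∈ Icc l r, ∀ y ∈ Icc l r, |f y - f x| ≤ A * √|y - x|) →
      powInt w l r (-4) f ≤ K → ∀ x ∈ Icc l r, ε ≤ f x := by
  set A' : ℝ := |A| + 1 with hA'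
  have hA'0 : 0 < A' := by positivity
  -- The first bound lets an interval of length `(f x)²` fit on one side of `x`; the second
  -- contradicts the bound on the integral.
  set q : ℝ := min ((r - l) / 2) (w₀ / (A' ^ 4 * (|K| + 1))) with hq
  have hq0 : 0 < q := lt_min (by linarith) (by positivity)
  refine ⟨√q, Real.sqrt_pos.2 hq0, fun f hf hpos hosc hK x hx => ?_⟩
  by_contra! hlt
  have hs0 := hpos x hx
  have hsq : f x ^ 2 < q := (Real.lt_sqrt hs0.le).1 hlt
  have hsq1 : f x ^ 2 < (r - l) / 2 := hsq.trans_le (min_le_left _ _)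
  have hsq2 : f x ^ 2 < w₀ / (A' ^ 4 * (|K| + 1)) := hsq.trans_le (min_le_right _ _)
  obtain ⟨u, v, hlu, hvr, huv, hnear⟩ : ∃ u v : ℝ, l ≤ u ∧ v ≤ r ∧ v - u = f x ^ 2 ∧
      ∀ y ∈ Icc u v, |y - x| ≤ f x ^ 2 := by
    rcases le_total x ((l + r) / 2) with h | h
    · refine ⟨x, x + f x ^ 2, hx.1, by linarith, by ring, fun y hy => ?_⟩
      rw [abs_le]
      constructor <;> nlinarith [hy.1, hy.2]
    · refine ⟨x - f x ^ 2, x, by linarith, hx.2, by ring, fun y hy => ?_⟩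
      rw [abs_le]
      constructor <;> nlinarith [hy.1, hy.2]
  have hs2 : 0 < f x ^ 2 := by positivity
  have huv' : u ≤ v := by linarith
  have hsub : Icc u v ⊆ Icc l r := Icc_subset_Icc hlu hvr
  have hle : ∀ y ∈ Icc u v, f y ≤ A' * f x := by
    intro y hy
    have h1 := hosc x hx y (hsub hy)
    have h2 : √|y - x| ≤ f x := Real.sqrt_le_iff.2 ⟨hs0.le, hnear y hy⟩
    have h3 := (abs_le.1 h1).2
    have h4 : A * √|y - x| ≤ |A| * f x :=
      mul_le_mul (le_abs_self A) h2 (Real.sqrt_nonneg _) (abs_nonneg A)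
    rw [hA', add_mul, one_mul]
    linarith
  have hint := intervalIntegrable_mul_rpow hlr.le hw hf hpos (-4)
  have h1 : f x ^ 2 * (w₀ * (A' * f x) ^ (-4 : ℝ)) ≤ powInt w l r (-4) f := by
    calc f x ^ 2 * (w₀ * (A' * f x) ^ (-4 : ℝ)) = ∫ _ in u..v, w₀ * (A' * f x) ^ (-4 : ℝ) := by
          rw [intervalIntegral.integral_const, huv, smul_eq_mul]
      _ ≤ ∫ y in u..v, w y * f y ^ (-4 : ℝ) := by
          refine intervalIntegral.integral_mono_on huv' intervalIntegrable_const ?_ fun y hy => ?_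
          · refine hint.mono_set ?_
            rwa [uIcc_of_le huv', uIcc_of_le hlr.le]
          · have h2 := Real.rpow_le_rpow_of_nonpos (hpos y (hsub hy)) (hle y hy)
              (by norm_num : (-4 : ℝ) ≤ 0)
            have h3 := hw0 y (hsub hy)
            exact mul_le_mul h3 h2 (by positivity) (hw₀.le.trans h3)
      _ ≤ powInt w l r (-4) f := by
          refine intervalIntegral.integral_mono_interval hlu huv' hvr ?_ hint
          filter_upwards [ae_restrict_mem measurableSet_Ioc] with y hy
          have hyI := Ioc_subset_Icc_self hy
          exact mul_nonneg (hw₀.le.trans (hw0 y hyI)) (Real.rpow_nonneg (hpos y hyI).le _)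
  have h2 : (A' * f x) ^ (-4 : ℝ) = ((A' * f x) ^ 4)⁻¹ := by
    rw [Real.rpow_neg (by positivity)]
    norm_cast
  have h3 : f x ^ 2 * (w₀ * (A' * f x) ^ (-4 : ℝ)) = w₀ / (A' ^ 4 * f x ^ 2) := by
    rw [h2]
    field_simp
  rw [h3] at h1
  have h4 : w₀ / (A' ^ 4 * f x ^ 2) ≤ |K| := h1.trans (hK.trans (le_abs_self K))
  rw [div_le_iff₀ (by positivity)] at h4
  rw [lt_div_iff₀ (by positivity)] at hsq2
  have h5 : 0 < f x ^ 2 * A' ^ 4 := by positivity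
  nlinarith

end PowInt

/-! ### The penalized functional and its minimizers -/

/-- The lower order part of the penalized functional. -/
def penalized (w : ℝ → ℝ) (l r d p δ : ℝ) (f : ℝ → ℝ) : ℝ :=
  -(d / (p - 2) * (powInt w l r p f ^ (2 / p) - powInt w l r 2 f))
    + δ * (powInt w l r (p + 4) f + powInt w l r (-4) f)

/-- The nonlinearity of the Euler-Lagrange equation of the penalized functional. -/
def nonlin (d p δ Λ y : ℝ) : ℝ :=
  -(d / (p - 2) * (Λ * y ^ (p - 1) - y)) + δ / 2 * ((p + 4) * y ^ (p + 3) - 4 * y ^ (-5 : ℝ))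

lemma IsPrimitiveOn.hasDerivAt {f g : ℝ → ℝ} {a b x : ℝ} (h : IsPrimitiveOn f g a b)
    (hg : ContinuousOn g (Icc a b)) (hx : x ∈ Ioo a b) : HasDerivAt f (g x) x := by
  have hI : IntervalIntegrable g volume a x := by
    refine h.integrable.mono_set ?_
    rw [uIcc_of_le hx.1.le, uIcc_of_le (hx.1.trans hx.2).le]
    exact Icc_subset_Icc_right hx.2.le
  have h1 := (intervalIntegral.integral_hasDerivAt_right hI
    ((hg.mono Ioo_subset_Icc_self).stronglyMeasurableAtFilter isOpen_Ioo x hx)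
    (hg.continuousAt (Icc_mem_nhds hx.1 hx.2))).const_add (f a)
  refine h1.congr_of_eventuallyEq ?_
  filter_upwards [Icc_mem_nhds hx.1 hx.2] with y hy
  exact h.eq y hy

lemma hasDerivAt_nonlin {d p δ Λ y : ℝ} (hy : 0 < y) :
    HasDerivAt (nonlin d p δ Λ)
      (-(d / (p - 2) * (Λ * ((p - 1) * y ^ (p - 2)) - 1)) +
        δ / 2 * ((p + 4) * ((p + 3) * y ^ (p + 2)) + 20 * y ^ (-6 : ℝ))) y := by
  have h1 := ((Real.hasDerivAt_rpow_const (p := p - 1) (Or.inl hy.ne')).const_mul Λ).sub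
    (hasDerivAt_id y)
  have h2 := ((Real.hasDerivAt_rpow_const (p := p + 3) (Or.inl hy.ne')).const_mul (p + 4)).sub
    ((Real.hasDerivAt_rpow_const (p := (-5 : ℝ)) (Or.inl hy.ne')).const_mul 4)
  refine ((h1.const_mul (d / (p - 2))).neg.add (h2.const_mul (δ / 2))).congr_deriv ?_
  rw [show p - 1 - 1 = p - 2 by ring, show p + 3 - 1 = p + 2 by ring,
    show (-5 : ℝ) - 1 = -6 by ring]
  ring

/-- The interpolation terms alone give exactly `d`, whatever the nonlocal coefficient `Λ` is; each
penalty term contributes a negative amount proportional to `δ`, and this is the strict gap that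
`rigidity` needs. -/
lemma nonlin_lt {d p δ Λ y : ℝ} (hp : 1 ≤ p) (hp2 : p ≠ 2) (hδ : 0 < δ) (hy : 0 < y) :
    (p - 1) * nonlin d p δ Λ y / y - (-(d / (p - 2) * (Λ * ((p - 1) * y ^ (p - 2)) - 1)) +
        δ / 2 * ((p + 4) * ((p + 3) * y ^ (p + 2)) + 20 * y ^ (-6 : ℝ))) < d := by
  have e1 : y ^ (p - 1) = y ^ (p - 2) * y := by
    rw [← Real.rpow_add_one hy.ne']
    congr 1
    ring
  have e2 : y ^ (p + 3) = y ^ (p + 2) * y := by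
    rw [← Real.rpow_add_one hy.ne']
    congr 1
    ring
  have e3 : y ^ (-5 : ℝ) = y ^ (-6 : ℝ) * y := by
    rw [← Real.rpow_add_one hy.ne']
    congr 1
    ring
  have hp2' : p - 2 ≠ 0 := sub_ne_zero.2 hp2
  have h1 : 0 < y ^ (p + 2) := by positivity
  have h2 : 0 < y ^ (-6 : ℝ) := by positivity
  have h3 : (p - 1) * nonlin d p δ Λ y / y -
      (-(d / (p - 2) * (Λ * ((p - 1) * y ^ (p - 2)) - 1)) +
        δ / 2 * ((p + 4) * ((p + 3) * y ^ (p + 2)) + 20 * y ^ (-6 : ℝ))) =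
      d - (δ / 2 * (4 * (p + 4) * y ^ (p + 2)) + δ / 2 * (4 * (p + 4) * y ^ (-6 : ℝ))) := by
    unfold nonlin
    rw [e1, e2, e3]
    field_simp
    ring
  rw [h3]
  have : 0 < p + 4 := by linarith
  have : 0 < δ / 2 * (4 * (p + 4) * y ^ (p + 2)) := by positivity
  have : 0 < δ / 2 * (4 * (p + 4) * y ^ (-6 : ℝ)) := by positivity
  linarith

section Penalized

variable {w b : ℝ → ℝ} {l r d p δ : ℝ}

/-- The interpolation part is `O(√(1 + S))` with `S` the integral of `f^(p+4)`, so Young's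
inequality absorbs it in half of that penalty. -/
lemma le_penalized (hlr : l ≤ r) (hw : ContinuousOn w (Icc l r))
    (hw0 : ∀ x ∈ Icc l r, 0 ≤ w x) (hw1 : ∫ x in l..r, w x = 1) (hp : 1 ≤ p) (hδ : 0 < δ) :
    ∃ C, ∀ f : ℝ → ℝ, ContinuousOn f (Icc l r) → (∀ x ∈ Icc l r, 0 < f x) →
      δ / 2 * powInt w l r (p + 4) f + δ * powInt w l r (-4) f - C ≤ penalized w l r d p δ f := by
  set C₁ : ℝ := 4 * |d / (p - 2)| with hC₁
  refine ⟨δ / 2 + C₁ ^ 2 / (2 * δ), fun f hf hpos => ?_⟩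
  set S := powInt w l r (p + 4) f with hS
  have hS0 : 0 ≤ S := powInt_nonneg hlr hw0 hpos _
  have h1 : powInt w l r p f ^ (2 / p) ≤ 4 * √(1 + S) :=
    powInt_rpow_le hlr hw hw0 hw1 hf hpos hp (by linarith) (by linarith)
  have h2 : powInt w l r 2 f ≤ 4 * √(1 + S) := by
    have := powInt_rpow_le hlr hw hw0 hw1 hf hpos (s := 2) (N := p + 4) (by norm_num)
      (by linarith) (by linarith)
    simpa using this
  have h3 : 0 ≤ powInt w l r p f ^ (2 / p) :=
    Real.rpow_nonneg (powInt_nonneg hlr hw0 hpos _) _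
  have h4 : 0 ≤ powInt w l r 2 f := powInt_nonneg hlr hw0 hpos _
  have h5 : |powInt w l r p f ^ (2 / p) - powInt w l r 2 f| ≤ 4 * √(1 + S) :=
    abs_sub_le_of_nonneg_of_le h3 h1 h4 h2
  have h6 : d / (p - 2) * (powInt w l r p f ^ (2 / p) - powInt w l r 2 f) ≤ C₁ * √(1 + S) := by
    refine (le_abs_self _).trans ?_
    rw [abs_mul, hC₁]
    calc |d / (p - 2)| * |powInt w l r p f ^ (2 / p) - powInt w l r 2 f|
        ≤ |d / (p - 2)| * (4 * √(1 + S)) := by gcongr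
      _ = _ := by ring
  have h7 : C₁ * √(1 + S) ≤ δ / 2 * (1 + S) + C₁ ^ 2 / (2 * δ) := by
    have h8 : √(1 + S) ^ 2 = 1 + S := Real.sq_sqrt (by linarith)
    have h9 : δ / 2 * (1 + S) + C₁ ^ 2 / (2 * δ) - C₁ * √(1 + S) =
        (δ * √(1 + S) - C₁) ^ 2 / (2 * δ) := by
      generalize √(1 + S) = u at h8 ⊢
      rw [← h8]
      field_simp
      ring
    have : 0 ≤ (δ * √(1 + S) - C₁) ^ 2 / (2 * δ) := by positivity
    linarith
  unfold penalized
  rw [← hS]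
  linarith

/-- On a sublevel set the energy bounds the oscillation, the integral of `f^(p+4)` bounds `f` from
above and that of `f^(-4)` bounds it from below. -/
lemma exists_minimizer_penalized (hlr : l < r) (hb : ContinuousOn b (Icc l r))
    (hw : ContinuousOn w (Icc l r)) (hw0 : ∀ x ∈ Icc l r, 0 < w x)
    (hw1 : ∫ x in l..r, w x = 1) (hp : 1 ≤ p) (hδ : 0 < δ) :
    ∃ c, ∃ γ : Lp ℝ 2 (volume.restrict (Ioc l r)), (∀ x ∈ Icc l r, 0 < prim b l c γ x) ∧
      ∀ c' (γ' : Lp ℝ 2 (volume.restrict (Ioc l r))), (∀ x ∈ Icc l r, 0 < prim b l c' γ' x) →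
        ‖γ‖ ^ 2 + penalized w l r d p δ (prim b l c γ) ≤
          ‖γ'‖ ^ 2 + penalized w l r d p δ (prim b l c' γ') := by
  have hw0' : ∀ x ∈ Icc l r, 0 ≤ w x := fun x hx => (hw0 x hx).le
  obtain ⟨C, hC⟩ := le_penalized (d := d) hlr.le hw hw0' hw1 hp hδ
  obtain ⟨B, hB⟩ := isCompact_Icc.exists_bound_of_continuousOn hb
  have hB' : ∀ x ∈ Icc l r, |b x| ≤ |B| := fun x hx => (hB x hx).trans (le_abs_self B)
  obtain ⟨x₀, hx₀, hmin⟩ := isCompact_Icc.exists_isMinOn (nonempty_Icc.2 hlr.le) hw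
  have hcont : ∀ c (γ : Lp ℝ 2 (volume.restrict (Ioc l r))),
      ContinuousOn (prim b l c γ) (Icc l r) := fun c γ =>
    (isPrimitiveOn_prim hlr.le hb c γ).continuousOn hlr.le
  refine exists_minimizer hlr.le hb ?_ ?_ ?_ ?_
  · intro K
    set K' : ℝ := |K| + |C| with hK'
    obtain ⟨ε, hε, hlow⟩ := exists_le_of_powInt_le hlr hw (hw0 x₀ hx₀) (fun x hx => hmin hx)
      (|B| * (K' + 1)) (K' / δ)
    refine ⟨ε, hε, K' + 1 + |B| * (K' + 1) * √(r - l) + 1 + K' / (δ / 2), fun c γ hpos hK => ?_⟩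
    have hf := hcont c γ
    have h1 := hC _ hf hpos
    have hS0 := powInt_nonneg hlr.le hw0' hpos (p + 4)
    have hT0 := powInt_nonneg hlr.le hw0' hpos (-4)
    have hK1 : K + C ≤ K' := add_le_add (le_abs_self K) (le_abs_self C)
    have hK'0 : 0 ≤ K' := by positivity
    have hδS : 0 ≤ δ / 2 * powInt w l r (p + 4) (prim b l c γ) := by positivity
    have hδT : 0 ≤ δ * powInt w l r (-4) (prim b l c γ) := by positivity
    have hγ2 : 0 ≤ ‖γ‖ ^ 2 := by positivity
    have hγ : ‖γ‖ ≤ K' + 1 := by nlinarith [norm_nonneg γ]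
    have hS : powInt w l r (p + 4) (prim b l c γ) ≤ K' / (δ / 2) := by
      rw [le_div_iff₀ (by positivity)]
      linarith
    have hT : powInt w l r (-4) (prim b l c γ) ≤ K' / δ := by
      rw [le_div_iff₀ hδ]
      linarith
    have hosc : ∀ x ∈ Icc l r, ∀ y ∈ Icc l r,
        |prim b l c γ y - prim b l c γ x| ≤ |B| * (K' + 1) * √|y - x| := by
      intro x hx y hy
      refine (abs_prim_sub_le hlr.le hb (abs_nonneg B) hB' c γ hx hy).trans ?_
      gcongr
    have hosc' : ∀ x ∈ Icc l r, ∀ y ∈ Icc l r,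
        |prim b l c γ y - prim b l c γ x| ≤ |B| * (K' + 1) * √(r - l) := by
      intro x hx y hy
      refine (hosc x hx y hy).trans ?_
      gcongr
      rw [abs_le]
      constructor <;> linarith [hx.1, hx.2, hy.1, hy.2]
    have h2 : 0 ≤ |B| * (K' + 1) * √(r - l) := by positivity
    have h3 : 0 ≤ K' / (δ / 2) := by positivity
    refine ⟨by linarith, fun x hx => ⟨hlow _ hf hpos hosc hT x hx, ?_⟩⟩
    have := le_of_powInt_le hlr.le hw hw0' hw1 hf hpos (by linarith) hosc' hS x hx
    linarith
  · refine ⟨-C, fun c γ hpos => ?_⟩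
    have h1 := hC _ (hcont c γ) hpos
    have hS0 := powInt_nonneg hlr.le hw0' hpos (p + 4)
    have hT0 := powInt_nonneg hlr.le hw0' hpos (-4)
    have : 0 ≤ δ / 2 * powInt w l r (p + 4) (prim b l c γ) := by positivity
    have : 0 ≤ δ * powInt w l r (-4) (prim b l c γ) := by positivity
    have : 0 ≤ ‖γ‖ ^ 2 := by positivity
    linarith
  · intro f g ε M hε hfc hbd hlim
    have ht := fun s => tendsto_powInt hlr.le hw hε hfc hbd hlim s
    unfold penalized
    refine ((((ht p).rpow_const (Or.inr (by positivity))).sub (ht 2)).const_mul _).neg.add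
      (((ht (p + 4)).add (ht (-4))).const_mul δ)
  · refine ⟨1, 0, fun x hx => ?_⟩
    rw [prim_eq_inner hb _ _ hx, inner_zero_right]
    norm_num

lemma continuousOn_nonlin_comp {f : ℝ → ℝ} (Λ : ℝ) (hf : ContinuousOn f (Icc l r))
    (hpos : ∀ x ∈ Icc l r, 0 < f x) : ContinuousOn (fun x => nonlin d p δ Λ (f x)) (Icc l r) := by
  have h1 : ContinuousOn (nonlin d p δ Λ) (Ioi 0) := fun y hy =>
    (hasDerivAt_nonlin hy).continuousAt.continuousWithinAt
  exact h1.comp hf fun x hx => hpos x hx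

/-- The coefficient `powInt w l r p f ^ (2 / p - 1)` comes from differentiating the outer power `2 /
p`; it is a number depending on `f` only, so the Euler–Lagrange equation becomes a local one with a
frozen parameter. -/
lemma hasDerivAt_penalized (hlr : l < r) (hw : ContinuousOn w (Icc l r))
    (hw0 : ∀ x ∈ Icc l r, 0 < w x) (hp : 1 ≤ p) {f φ : ℝ → ℝ} {ε : ℝ} (hε : 0 < ε)
    (hf : ContinuousOn f (Icc l r)) (hφ : ContinuousOn φ (Icc l r))
    (hfε : ∀ x ∈ Icc l r, ε ≤ f x) :
    HasDerivAt (fun τ => penalized w l r d p δ (fun x => f x + τ * φ x))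
      (2 * ∫ x in l..r, φ x * (w x * nonlin d p δ (powInt w l r p f ^ (2 / p - 1)) (f x))) 0 := by
  have hpos : ∀ x ∈ Icc l r, 0 < f x := fun x hx => hε.trans_le (hfε x hx)
  have hd := fun s => hasDerivAt_powInt hlr.le hw hε hf hφ hfε s
  have hX := powInt_pos hlr hw hw0 hf hpos p
  have hX0 : powInt w l r p (fun x => f x + 0 * φ x) = powInt w l r p f := by simp
  have h1 := (hd p).rpow_const (p := 2 / p) (Or.inl (by rw [hX0]; exact hX.ne'))
  have h2 := ((h1.sub (hd 2)).const_mul (d / (p - 2))).neg.add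
    (((hd (p + 4)).add (hd (-4))).const_mul δ)
  refine h2.congr_deriv ?_
  rw [hX0]
  set Λ := powInt w l r p f ^ (2 / p - 1) with hΛ
  have hi : ∀ s, IntervalIntegrable (fun x => w x * (s * f x ^ (s - 1)) * φ x) volume l r := by
    intro s
    refine ContinuousOn.intervalIntegrable ?_
    rw [uIcc_of_le hlr.le]
    exact (hw.mul (continuousOn_const.mul
      (hf.rpow_const fun x hx => Or.inl (hpos x hx).ne'))).mul hφ
  have hint : ∀ x, 2 * (φ x * (w x * nonlin d p δ Λ (f x))) =
      ((-(d / (p - 2) * (2 / p) * Λ)) * (w x * (p * f x ^ (p - 1)) * φ x)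
      + d / (p - 2) * (w x * (2 * f x ^ ((2 : ℝ) - 1)) * φ x))
      + (δ * (w x * ((p + 4) * f x ^ (p + 4 - 1)) * φ x)
      + δ * (w x * (-4 * f x ^ ((-4 : ℝ) - 1)) * φ x)) := by
    intro x
    unfold nonlin
    rw [show p + 4 - 1 = p + 3 by ring, show (-4 : ℝ) - 1 = -5 by ring,
      show (2 : ℝ) - 1 = 1 by ring, Real.rpow_one]
    have : p ≠ 0 := by linarith
    field_simp
    ring
  rw [← intervalIntegral.integral_const_mul]
  simp only [hint]
  rw [intervalIntegral.integral_add (((hi p).const_mul _).add ((hi 2).const_mul _))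
      (((hi (p + 4)).const_mul _).add ((hi (-4)).const_mul _)),
    intervalIntegral.integral_add ((hi p).const_mul _) ((hi 2).const_mul _),
    intervalIntegral.integral_add ((hi (p + 4)).const_mul _) ((hi (-4)).const_mul _)]
  simp only [intervalIntegral.integral_const_mul]
  ring

end Penalized

/-! ### The Euler–Lagrange equation -/

lemma isPrimitiveOn_of_continuousOn {h : ℝ → ℝ} {l r : ℝ} (hlr : l ≤ r)
    (hh : ContinuousOn h (Icc l r)) (c : ℝ) :
    IsPrimitiveOn (fun x => c + ∫ y in l..x, h y) h l r where
  integrable := by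
    refine ContinuousOn.intervalIntegrable ?_
    rwa [uIcc_of_le hlr]
  eq x _ := by simp

section EulerLagrange

variable {w b : ℝ → ℝ} {l r d p δ : ℝ}

/-- The weak form of the Euler-Lagrange equation. -/
lemma euler_lagrange_weak (hlr : l < r) (hb : ContinuousOn b (Icc l r))
    (hw : ContinuousOn w (Icc l r)) (hw0 : ∀ x ∈ Icc l r, 0 < w x) (hp : 1 ≤ p)
    {c : ℝ} {γ : Lp ℝ 2 (volume.restrict (Ioc l r))}
    (hpos : ∀ x ∈ Icc l r, 0 < prim b l c γ x)
    (hmin : ∀ c' (γ' : Lp ℝ 2 (volume.restrict (Ioc l r))),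
      (∀ x ∈ Icc l r, 0 < prim b l c' γ' x) →
        ‖γ‖ ^ 2 + penalized w l r d p δ (prim b l c γ) ≤
          ‖γ'‖ ^ 2 + penalized w l r d p δ (prim b l c' γ'))
    (c₁ : ℝ) (η : Lp ℝ 2 (volume.restrict (Ioc l r))) :
    inner ℝ γ η + ∫ x in l..r, prim b l c₁ η x *
      (w x * nonlin d p δ (powInt w l r p (prim b l c γ) ^ (2 / p - 1)) (prim b l c γ x)) = 0 := by
  set f := prim b l c γ with hf
  set φ := prim b l c₁ η with hφ
  have hfc : ContinuousOn f (Icc l r) := (isPrimitiveOn_prim hlr.le hb c γ).continuousOn hlr.le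
  have hφc : ContinuousOn φ (Icc l r) := (isPrimitiveOn_prim hlr.le hb c₁ η).continuousOn hlr.le
  obtain ⟨x₀, hx₀, hx₀min⟩ := isCompact_Icc.exists_isMinOn (nonempty_Icc.2 hlr.le) hfc
  have hε := hpos x₀ hx₀
  obtain ⟨A, hA⟩ := isCompact_Icc.exists_bound_of_continuousOn hφc
  have hder := hasDerivAt_penalized (d := d) (δ := δ) hlr hw hw0 hp hε hfc hφc
    (fun x hx => hx₀min hx)
  have hcongr : ∀ τ, penalized w l r d p δ (prim b l (c + τ * c₁) ↑↑(γ + τ • η)) =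
      penalized w l r d p δ (fun x => f x + τ * φ x) := by
    intro τ
    have h : ∀ x ∈ Icc l r, prim b l (c + τ * c₁) ↑↑(γ + τ • η) x = f x + τ * φ x :=
      fun x hx => prim_add_smul hb c c₁ τ γ η hx
    simp only [penalized, powInt_congr hlr.le h]
  have hsq : HasDerivAt (fun τ : ℝ => ‖γ + τ • η‖ ^ 2) (2 * inner ℝ γ η) 0 := by
    have h1 : HasDerivAt (fun τ : ℝ => ‖γ‖ ^ 2 + τ * (2 * inner ℝ γ η) + τ ^ 2 * ‖η‖ ^ 2)
        (2 * inner ℝ γ η) 0 := by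
      refine ((((hasDerivAt_mul_const (2 * inner ℝ γ η)).const_add (‖γ‖ ^ 2))).add
        ((hasDerivAt_pow 2 (0 : ℝ)).mul_const (‖η‖ ^ 2))).congr_deriv ?_
      simp
    refine h1.congr_of_eventuallyEq (Eventually.of_forall fun τ => ?_)
    simp only
    rw [norm_add_sq_real, inner_smul_right, norm_smul, mul_pow, Real.norm_eq_abs, sq_abs]
    ring
  have hJ := hsq.add hder
  have hlocmin : IsLocalMin ((fun τ : ℝ => ‖γ + τ • η‖ ^ 2) +
      fun τ => penalized w l r d p δ (fun x => f x + τ * φ x)) 0 := by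
    -- For such `τ` the variation stays below the minimum `f x₀` in absolute value, so the perturbed
    -- function is an admissible positive competitor.
    have hρ : 0 < f x₀ / (|A| + 1) := by positivity
    filter_upwards [Metric.ball_mem_nhds (0 : ℝ) hρ] with τ hτ
    have hτ' : |τ| < f x₀ / (|A| + 1) := by simpa using hτ
    have hposτ : ∀ x ∈ Icc l r, 0 < prim b l (c + τ * c₁) ↑↑(γ + τ • η) x := by
      intro x hx
      rw [prim_add_smul hb c c₁ τ γ η hx]
      have h1 : |τ * φ x| < f x₀ := by
        rw [abs_mul]
        have h2 : |φ x| < |A| + 1 := by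
          have := hA x hx
          rw [Real.norm_eq_abs] at this
          linarith [le_abs_self A]
        calc |τ| * |φ x| ≤ |τ| * (|A| + 1) := by gcongr
          _ < f x₀ / (|A| + 1) * (|A| + 1) := by gcongr
          _ = f x₀ := by field_simp
      have h3 : f x₀ ≤ f x := hx₀min hx
      have := (abs_lt.1 h1).1
      change 0 < f x + τ * φ x
      linarith
    have h1 := hmin _ _ hposτ
    rw [hcongr] at h1
    simpa using h1
  have h0 := hlocmin.hasDerivAt_eq_zero hJ
  linarith

/-- The strong form of the Euler-Lagrange equation. -/
lemma euler_lagrange_strong (hlr : l < r) (hb : ContinuousOn b (Icc l r)) {h : ℝ → ℝ}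
    (hh : ContinuousOn h (Icc l r)) {c : ℝ} {γ : Lp ℝ 2 (volume.restrict (Ioc l r))}
    (hweak : ∀ c₁ (η : Lp ℝ 2 (volume.restrict (Ioc l r))),
      inner ℝ γ η + ∫ x in l..r, prim b l c₁ η x * h x = 0) :
    (∫ x in l..r, h x) = 0 ∧
      IsPrimitiveOn (prim b l c γ) (fun x => b x ^ 2 * ∫ y in l..x, h y) l r := by
  have hzero : (∫ x in l..r, h x) = 0 := by
    -- Constant variations give the solvability condition, which makes `P` below vanish at both
    -- ends.
    have h1 := hweak 1 0
    rw [inner_zero_right, zero_add] at h1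
    rw [← h1]
    refine intervalIntegral.integral_congr fun x hx => ?_
    rw [uIcc_of_le hlr.le] at hx
    rw [prim_eq_inner hb _ _ hx, inner_zero_right]
    ring
  refine ⟨hzero, ?_⟩
  set P : ℝ → ℝ := fun x => 0 + ∫ y in l..x, h y with hP
  have hPp : IsPrimitiveOn P h l r := isPrimitiveOn_of_continuousOn hlr.le hh 0
  have hPc := hPp.continuousOn hlr.le
  have hbP : ContinuousOn (fun x => b x * P x) (Icc l r) := hb.mul hPc
  -- Variations with `c₁ = 0`, integrated by parts, say that `γ` and `b P`, up to sign conventions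
  -- absorbed in `P`, have the same inner product with every `η`.
  have hγ : γ = (memLp_indicator hbP l r).toLp _ := by
    refine ext_inner_right ℝ fun η => ?_
    rw [inner_indicator hbP le_rfl hlr.le le_rfl]
    have h1 := hweak 0 η
    rw [(isPrimitiveOn_prim hlr.le hb 0 η).integral_mul_eq hPp hlr.le] at h1
    have h2 : P r = 0 := by simp [hP, hzero]
    have h3 : P l = 0 := by simp [hP]
    rw [h2, h3] at h1
    have h4 : ∫ z in l..r, b z * P z * η z = ∫ z in l..r, b z * η z * P z := by
      congr 1
      ext z
      ring
    rw [h4]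
    linarith
  have hae : ∀ᵐ x, x ∈ Ioc l r → γ x = b x * P x := by
    have h1 := (memLp_indicator hbP l r).coeFn_toLp
    rw [← hγ] at h1
    have h2 := (ae_restrict_iff' measurableSet_Ioc).1 h1
    filter_upwards [h2] with x hx hxm
    rw [hx hxm, indicator_of_mem hxm]
  have hb2 : ContinuousOn (fun x => b x ^ 2 * ∫ y in l..x, h y) (Icc l r) := by
    have : ContinuousOn (fun x => b x ^ 2 * P x) (Icc l r) := (hb.pow 2).mul hPc
    simpa [hP] using this
  refine ⟨(isPrimitiveOn_of_continuousOn hlr.le hb2 0).integrable, fun x hx => ?_⟩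
  rw [(isPrimitiveOn_prim hlr.le hb c γ).eq x hx]
  congr 1
  refine intervalIntegral.integral_congr_ae ?_
  rw [uIoc_of_le hx.1]
  filter_upwards [hae] with y hy hym
  rw [hy ⟨hym.1, hym.2.trans hx.2⟩]
  simp only [hP]
  ring

end EulerLagrange

/-! ### The sharp inequality on symmetric intervals, for positive functions -/

/-- The sharp inequality on `[-r, r]` for the penalized functional. -/
lemma penalized_nonneg {d : ℕ} {p : ℝ} (hp1 : 1 ≤ p)
    (hp : 3 ≤ d → p ≤ 2 * (d : ℝ) / ((d : ℝ) - 2)) (hp2 : p ≠ 2) {r κ δ : ℝ} (hr0 : 0 < r)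
    (hr1 : r < 1) (hκ : 0 < κ) (hδ : 0 < δ)
    (hw1 : ∫ x in (-r)..r, κ * nu x ^ ((d : ℝ) / 2 - 1) = 1) {c : ℝ}
    {γ : Lp ℝ 2 (volume.restrict (Ioc (-r) r))}
    (hpos : ∀ x ∈ Icc (-r) r, 0 < prim (fun x => (√(κ * nu x ^ ((d : ℝ) / 2)))⁻¹) (-r) c γ x) :
    0 ≤ ‖γ‖ ^ 2 + penalized (fun x => κ * nu x ^ ((d : ℝ) / 2 - 1)) (-r) r d p δ
      (prim (fun x => (√(κ * nu x ^ ((d : ℝ) / 2)))⁻¹) (-r) c γ) := by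
  have hlr : -r < r := by linarith
  have hsub : Icc (-r) r ⊆ Ioo (-1) 1 := Icc_subset_Ioo (by linarith) hr1
  set w : ℝ → ℝ := fun x => κ * nu x ^ ((d : ℝ) / 2 - 1) with hw
  set a : ℝ → ℝ := fun x => κ * nu x ^ ((d : ℝ) / 2) with ha
  set b : ℝ → ℝ := fun x => (√(a x))⁻¹ with hb
  have hapos : ∀ x ∈ Icc (-r) r, 0 < a x := fun x hx =>
    mul_pos hκ (Real.rpow_pos_of_pos (nu_pos (hsub hx)) _)
  have hwpos : ∀ x ∈ Icc (-r) r, 0 < w x := fun x hx =>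
    mul_pos hκ (Real.rpow_pos_of_pos (nu_pos (hsub hx)) _)
  have hac : ContinuousOn a (Icc (-r) r) :=
    continuousOn_const.mul ((continuousOn_nu_rpow _).mono hsub)
  have hwc : ContinuousOn w (Icc (-r) r) :=
    continuousOn_const.mul ((continuousOn_nu_rpow _).mono hsub)
  have hbc : ContinuousOn b (Icc (-r) r) :=
    hac.sqrt.inv₀ fun x hx => (Real.sqrt_pos.2 (hapos x hx)).ne'
  have hb2 : ∀ x ∈ Icc (-r) r, b x ^ 2 = (a x)⁻¹ := fun x hx => by
    simp only [hb]
    rw [inv_pow, Real.sq_sqrt (hapos x hx).le]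
  obtain ⟨c₀, γ₀, hpos₀, hmin⟩ :=
    exists_minimizer_penalized (d := d) hlr hbc hwc hwpos hw1 hp1 hδ
  -- It suffices to evaluate the functional at the minimizer.
  refine le_trans ?_ (hmin c γ hpos)
  set f := prim b (-r) c₀ γ₀ with hf
  set Λ := powInt w (-r) r p f ^ (2 / p - 1) with hΛ
  have hfc : ContinuousOn f (Icc (-r) r) :=
    (isPrimitiveOn_prim hlr.le hbc c₀ γ₀).continuousOn hlr.le
  set h : ℝ → ℝ := fun x => w x * nonlin d p δ Λ (f x) with hh
  have hhc : ContinuousOn h (Icc (-r) r) := hwc.mul (continuousOn_nonlin_comp Λ hfc hpos₀)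
  obtain ⟨hz, hfp⟩ : (∫ x in (-r)..r, h x) = 0 ∧
      IsPrimitiveOn f (fun x => b x ^ 2 * ∫ y in (-r)..x, h y) (-r) r := euler_lagrange_strong (c := c₀) hlr hbc hhc
    (euler_lagrange_weak hlr hbc hwc hwpos hp1 hpos₀ hmin)
  set P : ℝ → ℝ := fun x => 0 + ∫ y in (-r)..x, h y with hP
  have hPp : IsPrimitiveOn P h (-r) r := isPrimitiveOn_of_continuousOn hlr.le hhc 0
  have hPc := hPp.continuousOn hlr.le
  -- The continuous version of the derivative of the minimizer. It vanishes at `±r` because `P`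
  -- does: these are the Neumann conditions.
  set k : ℝ → ℝ := fun x => P x / a x with hk
  have hkc : ContinuousOn k (Icc (-r) r) := hPc.div hac fun x hx => (hapos x hx).ne'
  have hfk : IsPrimitiveOn f k (-r) r := by
    have heq : ∀ x ∈ Icc (-r) r, b x ^ 2 * ∫ y in (-r)..x, h y = k x := fun x hx => by
      rw [hb2 x hx]
      simp only [hk, hP, zero_add]
      rw [div_eq_inv_mul]
    refine ⟨(isPrimitiveOn_of_continuousOn hlr.le hkc 0).integrable, fun x hx => ?_⟩
    rw [hfp.eq x hx]
    congr 1
    refine intervalIntegral.integral_congr fun y hy => ?_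
    rw [uIcc_of_le hx.1] at hy
    exact heq y ⟨hy.1, hy.2.trans hx.2⟩
  have hk0 := rigidity hp1 hp (e := nonlin d p δ Λ) (fun y hy => hasDerivAt_nonlin hy)
    (fun y hy => nonlin_lt hp1 hp2 hδ hy) hr0 hr1 hpos₀ hfc hkc
    (k' := fun x => (h x * a x - P x * (-(d * x * w x))) / a x ^ 2)
    (fun x hx => hfk.hasDerivAt hkc hx)
    (fun x hx => by
      have hxI := hsub (Ioo_subset_Icc_self hx)
      have h1 := hPp.hasDerivAt hhc hx
      have h2 : HasDerivAt a (-(d * x * w x)) x := by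
        refine ((hasDerivAt_nu_rpow hxI ((d : ℝ) / 2)).const_mul κ).congr_deriv ?_
        simp only [hw]
        ring
      exact h1.div h2 (hapos x (Ioo_subset_Icc_self hx)).ne')
    (fun x hx => by
      have hxI := Ioo_subset_Icc_self hx
      have hw0 := hwpos x hxI
      have hν := nu_pos (hsub hxI)
      have haw : a x = w x * nu x := by
        simp only [ha, hw]
        rw [nu_rpow_eq_mul (hsub hxI)]
        ring
      simp only [hk, hh]
      rw [haw]
      field_simp
      ring)
    (by simp [hk, hP]) (by simp [hk, hP, hz])
  have hconst : ∀ x ∈ Icc (-r) r, f x = f (-r) := by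
    intro x hx
    rw [hfk.eq x hx, add_eq_left]
    refine (intervalIntegral.integral_congr_ae (g := fun _ => 0) ?_).trans (by simp)
    have hne : ∀ᵐ y : ℝ, y ≠ r := by simp [ae_iff]
    filter_upwards [hne] with y hyne hy
    rw [uIoc_of_le hx.1] at hy
    exact hk0 y ⟨hy.1, lt_of_le_of_ne (hy.2.trans hx.2) hyne⟩
  have hs : 0 < f (-r) := hpos₀ _ (left_mem_Icc.2 hlr.le)
  have hpow : ∀ s, powInt w (-r) r s f = f (-r) ^ s := fun s => by
    rw [powInt_congr hlr.le hconst, powInt_const hw1]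
  have h1 : (f (-r) ^ p) ^ (2 / p) = f (-r) ^ (2 : ℝ) := by
    rw [← Real.rpow_mul hs.le, mul_div_cancel₀ _ (by linarith : p ≠ 0)]
  -- The weight has mass one, so on constants the interpolation terms cancel and only the positive
  -- penalty is left.
  have h2 : penalized w (-r) r d p δ f = δ * (f (-r) ^ (p + 4) + f (-r) ^ (-4 : ℝ)) := by
    unfold penalized
    rw [hpow, hpow, hpow, hpow, h1]
    ring
  rw [h2]
  positivity

/-- The sharp interpolation inequality on `[-r, r]` for positive functions. -/
theorem interpolation_on_Icc_of_pos {d : ℕ} {p : ℝ} (hp1 : 1 ≤ p)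
    (hp : 3 ≤ d → p ≤ 2 * (d : ℝ) / ((d : ℝ) - 2)) (hp2 : p ≠ 2) {r κ : ℝ} (hr0 : 0 < r)
    (hr1 : r < 1) (hκ : 0 < κ)
    (hw1 : ∫ x in (-r)..r, κ * nu x ^ ((d : ℝ) / 2 - 1) = 1) {f g : ℝ → ℝ}
    (hfg : IsPrimitiveOn f g (-r) r) (hpos : ∀ x ∈ Icc (-r) r, 0 < f x)
    (hg : IntervalIntegrable (fun x => κ * nu x ^ ((d : ℝ) / 2) * g x ^ 2) volume (-r) r) :
    d / (p - 2) * (powInt (fun x => κ * nu x ^ ((d : ℝ) / 2 - 1)) (-r) r p f ^ (2 / p) -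
      powInt (fun x => κ * nu x ^ ((d : ℝ) / 2 - 1)) (-r) r 2 f) ≤
      ∫ x in (-r)..r, κ * nu x ^ ((d : ℝ) / 2) * g x ^ 2 := by
  have hlr : -r < r := by linarith
  have hsub : Icc (-r) r ⊆ Ioo (-1) 1 := Icc_subset_Ioo (by linarith) hr1
  set w : ℝ → ℝ := fun x => κ * nu x ^ ((d : ℝ) / 2 - 1) with hw
  set a : ℝ → ℝ := fun x => κ * nu x ^ ((d : ℝ) / 2) with ha
  set b : ℝ → ℝ := fun x => (√(a x))⁻¹ with hb
  have hapos : ∀ x ∈ Icc (-r) r, 0 < a x := fun x hx =>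
    mul_pos hκ (Real.rpow_pos_of_pos (nu_pos (hsub hx)) _)
  have hac : ContinuousOn a (Icc (-r) r) :=
    continuousOn_const.mul ((continuousOn_nu_rpow _).mono hsub)
  have hgi := (intervalIntegrable_iff_integrableOn_Ioc_of_le hlr.le).1 hfg.integrable
  have hmeas : AEStronglyMeasurable (fun x => √(a x) * g x) (volume.restrict (Ioc (-r) r)) :=
    ((hac.sqrt.mono Ioc_subset_Icc_self).aestronglyMeasurable measurableSet_Ioc).mul
      hgi.aestronglyMeasurable
  have hsq : ∀ x ∈ Icc (-r) r, (√(a x) * g x) ^ 2 = a x * g x ^ 2 := fun x hx => by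
    rw [mul_pow, Real.sq_sqrt (hapos x hx).le]
  have hmem : MemLp (fun x => √(a x) * g x) 2 (volume.restrict (Ioc (-r) r)) := by
    rw [memLp_two_iff_integrable_sq hmeas]
    refine ((intervalIntegrable_iff_integrableOn_Ioc_of_le hlr.le).1 hg).congr ?_
    filter_upwards [ae_restrict_mem measurableSet_Ioc] with x hx
    exact (hsq x (Ioc_subset_Icc_self hx)).symm
  -- In the Hilbert variable `γ = √a g` the primitive `prim b (-r) (f (-r)) γ` gives back `f`, and
  -- `‖γ‖²` is the energy.
  set γ := hmem.toLp _ with hγ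
  have hγae : ∀ᵐ x, x ∈ Ioc (-r) r → γ x = √(a x) * g x :=
    (ae_restrict_iff' measurableSet_Ioc).1 hmem.coeFn_toLp
  have hprim : ∀ x ∈ Icc (-r) r, prim b (-r) (f (-r)) γ x = f x := by
    intro x hx
    rw [hfg.eq x hx, prim]
    congr 1
    refine intervalIntegral.integral_congr_ae ?_
    filter_upwards [hγae] with y hy hym
    rw [uIoc_of_le hx.1] at hym
    have hyI : y ∈ Ioc (-r) r := ⟨hym.1, hym.2.trans hx.2⟩
    have := (Real.sqrt_pos.2 (hapos y (Ioc_subset_Icc_self hyI))).ne'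
    rw [hy hyI]
    simp only [hb]
    field_simp
  have hnorm : ‖γ‖ ^ 2 = ∫ x in (-r)..r, a x * g x ^ 2 := by
    rw [← real_inner_self_eq_norm_sq, L2.inner_def, intervalIntegral.integral_of_le hlr.le]
    refine integral_congr_ae ?_
    filter_upwards [hmem.coeFn_toLp, ae_restrict_mem measurableSet_Ioc] with x hx hxm
    rw [← hγ] at hx
    rw [hx, real_inner_self_eq_norm_sq, Real.norm_eq_abs, sq_abs,
      hsq x (Ioc_subset_Icc_self hxm)]
  have hpos' : ∀ x ∈ Icc (-r) r, 0 < prim b (-r) (f (-r)) γ x := fun x hx => by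
    rw [hprim x hx]
    exact hpos x hx
  set T := powInt w (-r) r (p + 4) f + powInt w (-r) r (-4) f with hT
  have key : ∀ δ > 0, d / (p - 2) * (powInt w (-r) r p f ^ (2 / p) - powInt w (-r) r 2 f) ≤
      (∫ x in (-r)..r, a x * g x ^ 2) + δ * T := by
    intro δ hδ
    have h1 := penalized_nonneg hp1 hp hp2 hr0 hr1 hκ hδ hw1 hpos'
    rw [hnorm, penalized, powInt_congr hlr.le hprim, powInt_congr hlr.le hprim,
      powInt_congr hlr.le hprim, powInt_congr hlr.le hprim] at h1
    rw [hT]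
    linarith
  -- The penalty `T` of the fixed function `f` does not depend on `δ`, so it disappears as `δ → 0`.
  have hlim : Tendsto (fun δ : ℝ => (∫ x in (-r)..r, a x * g x ^ 2) + δ * T) (𝓝[>] 0)
      (𝓝 ((∫ x in (-r)..r, a x * g x ^ 2) + 0 * T)) := by
    refine Tendsto.mono_left ?_ nhdsWithin_le_nhds
    exact (continuous_const.add (continuous_id.mul continuous_const)).tendsto 0
  rw [zero_mul, add_zero] at hlim
  refine ge_of_tendsto hlim ?_
  filter_upwards [self_mem_nhdsWithin] with δ hδ
  exact key δ hδ

/-! ### The measure `dν_d` and its normalization -/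

/-- The density of `dν_d`. -/
def density (d : ℕ) (x : ℝ) : ℝ := (Z d)⁻¹ * nu x ^ ((d : ℝ) / 2 - 1)

lemma Z_pos {d : ℕ} (hd : 1 ≤ d) : 0 < Z d := by
  have hd' : (1 : ℝ) ≤ d := by exact_mod_cast hd
  have h1 : 0 < Real.Gamma ((d : ℝ) / 2) := Real.Gamma_pos_of_pos (by linarith)
  have h2 : 0 < Real.Gamma (((d : ℝ) + 1) / 2) := Real.Gamma_pos_of_pos (by linarith)
  have h3 : 0 < √Real.pi := Real.sqrt_pos.2 Real.pi_pos
  unfold Z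
  positivity

lemma density_pos {d : ℕ} (hd : 1 ≤ d) {x : ℝ} (hx : x ∈ Ioo (-1 : ℝ) 1) : 0 < density d x :=
  mul_pos (inv_pos.2 (Z_pos hd)) (Real.rpow_pos_of_pos (nu_pos hx) _)

lemma measurable_density (d : ℕ) : Measurable (density d) :=
  (continuous_nu.measurable.pow_const _).const_mul _

lemma continuousOn_density (d : ℕ) : ContinuousOn (density d) (Ioo (-1) 1) :=
  continuousOn_const.mul (continuousOn_nu_rpow _)

lemma nuMeasure_eq (d : ℕ) : nuMeasure d =
    (volume.restrict (Ioo (-1) 1)).withDensity (fun x => ENNReal.ofReal (density d x)) := rfl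

lemma ae_nuMeasure_of_ae {d : ℕ} {P : ℝ → Prop} (h : ∀ᵐ x, x ∈ Ioo (-1 : ℝ) 1 → P x) :
    ∀ᵐ x ∂(nuMeasure d), P x :=
  (withDensity_absolutelyContinuous _ _).ae_le ((ae_restrict_iff' measurableSet_Ioo).2 h)

lemma nuMeasure_restrict {d : ℕ} {s : Set ℝ} (hs : MeasurableSet s) (hsub : s ⊆ Ioo (-1) 1) :
    (nuMeasure d).restrict s =
      (volume.restrict s).withDensity (fun x => ENNReal.ofReal (density d x)) := by
  rw [nuMeasure_eq, restrict_withDensity hs, Measure.restrict_restrict hs, inter_eq_left.2 hsub]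

lemma setIntegral_nuMeasure {d : ℕ} (hd : 1 ≤ d) {s : Set ℝ} (hs : MeasurableSet s)
    (hsub : s ⊆ Ioo (-1) 1) (φ : ℝ → ℝ) :
    ∫ x in s, φ x ∂(nuMeasure d) = ∫ x in s, density d x * φ x := by
  rw [nuMeasure_restrict hs hsub, integral_withDensity_eq_integral_toReal_smul
    (measurable_density d).ennreal_ofReal (by simp)]
  refine setIntegral_congr_fun hs fun x hx => ?_
  simp only [smul_eq_mul]
  rw [ENNReal.toReal_ofReal (density_pos hd (hsub hx)).le]

lemma integrableOn_nuMeasure_iff {d : ℕ} (hd : 1 ≤ d) {s : Set ℝ} (hs : MeasurableSet s)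
    (hsub : s ⊆ Ioo (-1) 1) (φ : ℝ → ℝ) :
    IntegrableOn φ s (nuMeasure d) ↔ IntegrableOn (fun x => density d x * φ x) s := by
  rw [IntegrableOn, nuMeasure_restrict hs hsub, integrable_withDensity_iff_integrable_smul'
    (measurable_density d).ennreal_ofReal (by simp)]
  refine integrable_congr ?_
  filter_upwards [ae_restrict_mem hs] with x hx
  rw [smul_eq_mul, ENNReal.toReal_ofReal (density_pos hd (hsub hx)).le]

lemma nuMeasure_restrict_Ioo (d : ℕ) :
    (nuMeasure d).restrict (Ioo (-1) 1) = nuMeasure d := by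
  rw [nuMeasure_restrict measurableSet_Ioo subset_rfl, nuMeasure_eq]

lemma integral_nuMeasure {d : ℕ} (hd : 1 ≤ d) (φ : ℝ → ℝ) :
    ∫ x, φ x ∂(nuMeasure d) = ∫ x in Ioo (-1) 1, density d x * φ x := by
  rw [← setIntegral_nuMeasure hd measurableSet_Ioo subset_rfl, nuMeasure_restrict_Ioo]

lemma integrable_nuMeasure_iff {d : ℕ} (hd : 1 ≤ d) (φ : ℝ → ℝ) :
    Integrable φ (nuMeasure d) ↔ IntegrableOn (fun x => density d x * φ x) (Ioo (-1) 1) := by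
  rw [← integrableOn_nuMeasure_iff hd measurableSet_Ioo subset_rfl, IntegrableOn,
    nuMeasure_restrict_Ioo]

/-- Legendre's duplication formula for the Gamma function. It identifies `Z d` with the constant of
the symmetric beta law. -/
lemma beta_half_half {d : ℕ} (hd : 1 ≤ d) :
    ProbabilityTheory.beta ((d : ℝ) / 2) ((d : ℝ) / 2) = 2 * Z d * (1 / 4) ^ ((d : ℝ) / 2) := by
  have hd' : (1 : ℝ) ≤ d := by exact_mod_cast hd
  have h1 := Real.Gamma_mul_Gamma_add_half ((d : ℝ) / 2)
  have h2 : 0 < Real.Gamma ((d : ℝ) / 2 + 1 / 2) := Real.Gamma_pos_of_pos (by linarith)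
  have h3 : 0 < Real.Gamma (d : ℝ) := Real.Gamma_pos_of_pos (by linarith)
  rw [mul_div_cancel₀ _ (two_ne_zero)] at h1
  rw [← add_div] at h1 h2
  have h4 : ((1 : ℝ) / 4) ^ ((d : ℝ) / 2) = 2 ^ (1 - (d : ℝ)) / 2 := by
    rw [show (1 : ℝ) / 4 = 2 ^ (-2 : ℝ) by
      rw [Real.rpow_neg (by norm_num)]; norm_num, ← Real.rpow_mul (by norm_num),
      Real.rpow_sub (by norm_num), Real.rpow_one, show -2 * ((d : ℝ) / 2) = -d by ring,
      Real.rpow_neg (by norm_num)]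
    field_simp
  unfold ProbabilityTheory.beta Z
  rw [h4, add_halves]
  field_simp
  linarith

instance isProbabilityMeasure_nuMeasure {d : ℕ} [hd : Fact (1 ≤ d)] :
    IsProbabilityMeasure (nuMeasure d) where
  measure_univ := by
    have hd1 := hd.out
    have hd' : (1 : ℝ) ≤ d := by exact_mod_cast hd1
    have hα : 0 < (d : ℝ) / 2 := by linarith
    have h1 := ProbabilityTheory.lintegral_betaPDF_eq_one hα hα
    rw [ProbabilityTheory.lintegral_betaPDF] at h1
    -- The affine map from `(-1, 1)` to `(0, 1)` carries `dν_d` to the beta law with both parameters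
    -- `d / 2`, whose total mass is known.
    have himg : (fun y : ℝ => (1 + y) / 2) '' Ioo (-1) 1 = Ioo 0 1 := by
      ext x
      constructor
      · rintro ⟨y, hy, rfl⟩
        exact ⟨by linarith [hy.1], by linarith [hy.2]⟩
      · intro hx
        exact ⟨2 * x - 1, ⟨by linarith [hx.1], by linarith [hx.2]⟩, by ring⟩
    rw [← himg, lintegral_image_eq_lintegral_abs_deriv_mul (f' := fun _ => 1 / 2)
      measurableSet_Ioo (fun y _ => by
        have := ((hasDerivAt_id y).const_add 1).div_const 2
        exact this.hasDerivWithinAt) (fun y _ z _ h => by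
        have h' : (1 + y) / 2 = (1 + z) / 2 := h
        linarith)] at h1
    rw [nuMeasure_eq, withDensity_apply _ MeasurableSet.univ, Measure.restrict_univ, ← h1]
    refine setLIntegral_congr_fun measurableSet_Ioo fun y hy => ?_
    rw [← ENNReal.ofReal_mul (abs_nonneg _)]
    congr 1
    have hν := nu_pos hy
    have e1 : (1 + y) / 2 = (1 + y) * (1 / 2) := by ring
    have h2 : ((1 + y) / 2) ^ ((d : ℝ) / 2 - 1) * (1 - (1 + y) / 2) ^ ((d : ℝ) / 2 - 1) =
        (1 / 4) ^ ((d : ℝ) / 2 - 1) * nu y ^ ((d : ℝ) / 2 - 1) := by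
      rw [← Real.mul_rpow (by linarith [hy.1]) (by linarith [hy.2]),
        ← Real.mul_rpow (by norm_num) hν.le]
      congr 1
      unfold nu
      ring
    have h3 : ((1 : ℝ) / 4) ^ ((d : ℝ) / 2) = (1 / 4) ^ ((d : ℝ) / 2 - 1) * (1 / 4) := by
      rw [← Real.rpow_add_one (by norm_num), sub_add_cancel]
    rw [mul_assoc (1 / _), h2, beta_half_half hd1, h3, density, abs_of_pos (by norm_num)]
    have := Z_pos hd1
    field_simp
    norm_num

/-! ### Removal of the positivity assumption -/

lemma tendsto_powInt_of_nonneg {w : ℝ → ℝ} {l r : ℝ} (hlr : l ≤ r)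
    (hw : ContinuousOn w (Icc l r)) {f : ℕ → ℝ → ℝ} {g : ℝ → ℝ} {M s : ℝ} (hs : 0 < s)
    (hfc : ∀ n, ContinuousOn (f n) (Icc l r)) (hb : ∀ n, ∀ x ∈ Icc l r, 0 ≤ f n x ∧ f n x ≤ M)
    (hlim : ∀ x ∈ Icc l r, Tendsto (fun n => f n x) atTop (𝓝 (g x))) :
    Tendsto (fun n => powInt w l r s (f n)) atTop (𝓝 (powInt w l r s g)) := by
  refine intervalIntegral.tendsto_integral_filter_of_dominated_convergence
    (fun x => |w x| * M ^ s) ?_ ?_ ?_ ?_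
  · refine Eventually.of_forall fun n => ?_
    rw [uIoc_of_le hlr]
    refine (ContinuousOn.mono ?_ Ioc_subset_Icc_self).aestronglyMeasurable measurableSet_Ioc
    exact hw.mul ((hfc n).rpow_const fun x hx => Or.inr hs.le)
  · refine Eventually.of_forall fun n => Eventually.of_forall fun x hx => ?_
    rw [uIoc_of_le hlr] at hx
    have h := hb n x (Ioc_subset_Icc_self hx)
    rw [norm_mul, Real.norm_eq_abs, Real.norm_eq_abs, abs_of_nonneg (Real.rpow_nonneg h.1 s)]
    have := Real.rpow_le_rpow h.1 h.2 hs.le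
    gcongr
  · refine ContinuousOn.intervalIntegrable ?_
    rw [uIcc_of_le hlr]
    exact hw.abs.mul continuousOn_const
  · refine Eventually.of_forall fun x hx => ?_
    rw [uIoc_of_le hlr] at hx
    exact ((hlim x (Ioc_subset_Icc_self hx)).rpow_const (Or.inr hs.le)).const_mul _

/-- The sharp interpolation inequality on `[-r, r]`. -/
theorem interpolation_on_Icc {d : ℕ} {p : ℝ} (hp1 : 1 ≤ p)
    (hp : 3 ≤ d → p ≤ 2 * (d : ℝ) / ((d : ℝ) - 2)) (hp2 : p ≠ 2) {r κ : ℝ} (hr0 : 0 < r)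
    (hr1 : r < 1) (hκ : 0 < κ)
    (hw1 : ∫ x in (-r)..r, κ * nu x ^ ((d : ℝ) / 2 - 1) = 1) {f g : ℝ → ℝ}
    (hfg : IsPrimitiveOn f g (-r) r)
    (hg : IntervalIntegrable (fun x => κ * nu x ^ ((d : ℝ) / 2) * g x ^ 2) volume (-r) r) :
    d / (p - 2) *
      (powInt (fun x => κ * nu x ^ ((d : ℝ) / 2 - 1)) (-r) r p (fun x => |f x|) ^ (2 / p) -
      powInt (fun x => κ * nu x ^ ((d : ℝ) / 2 - 1)) (-r) r 2 (fun x => |f x|)) ≤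
      ∫ x in (-r)..r, κ * nu x ^ ((d : ℝ) / 2) * g x ^ 2 := by
  have hlr : -r ≤ r := by linarith
  have hsub : Icc (-r) r ⊆ Ioo (-1) 1 := Icc_subset_Ioo (by linarith) hr1
  have hfc := hfg.continuousOn hlr
  have hwc : ContinuousOn (fun x => κ * nu x ^ ((d : ℝ) / 2 - 1)) (Icc (-r) r) :=
    continuousOn_const.mul ((continuousOn_nu_rpow _).mono hsub)
  have hac : ContinuousOn (fun x => κ * nu x ^ ((d : ℝ) / 2)) (Icc (-r) r) :=
    continuousOn_const.mul ((continuousOn_nu_rpow _).mono hsub)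
  obtain ⟨M, hM⟩ := isCompact_Icc.exists_bound_of_continuousOn hfc
  -- Positive approximations of `|f|` whose energy does not exceed that of `f`.
  set F : ℕ → ℝ → ℝ := fun n x => |f x| + 1 / ((n : ℝ) + 1) with hF
  have hFpos : ∀ n x, 0 < F n x := fun n x => by positivity
  have hFc : ∀ n, ContinuousOn (F n) (Icc (-r) r) := fun n => hfc.abs.add continuousOn_const
  have hFb : ∀ n, ∀ x ∈ Icc (-r) r, 0 ≤ F n x ∧ F n x ≤ M + 1 := by
    intro n x hx
    have h1 := hM x hx
    rw [Real.norm_eq_abs] at h1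
    have h2 : 1 / ((n : ℝ) + 1) ≤ 1 := by
      rw [div_le_one (by positivity)]
      linarith [(Nat.cast_nonneg n : (0 : ℝ) ≤ n)]
    exact ⟨(hFpos n x).le, by simp only [hF]; linarith⟩
  have hFl : ∀ x ∈ Icc (-r) r, Tendsto (fun n => F n x) atTop (𝓝 |f x|) := fun x _ => by
    have := (tendsto_one_div_add_atTop_nhds_zero_nat (𝕜 := ℝ)).const_add |f x|
    rw [add_zero] at this
    exact this
  have hlim := ((((tendsto_powInt_of_nonneg hlr hwc (s := p) (by linarith) hFc hFb hFl).rpow_const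
    (p := 2 / p) (Or.inr (by positivity))).sub
    (tendsto_powInt_of_nonneg hlr hwc (s := 2) (by norm_num) hFc hFb hFl)).const_mul
      ((d : ℝ) / (p - 2)))
  refine le_of_tendsto hlim (Eventually.of_forall fun n => ?_)
  obtain ⟨k, hkm, hk, hkle⟩ := hfg.abs_add hlr (1 / ((n : ℝ) + 1))
  have hkle' : ∀ᵐ x, x ∈ Ioc (-r) r → |k x| ≤ |g x| := by
    have hb : ∀ᵐ x : ℝ, x ≠ r := by simp [ae_iff]
    filter_upwards [hkle, hb] with x hx hxb hxm
    exact hx ⟨hxm.1, lt_of_le_of_ne hxm.2 hxb⟩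
  have hle : ∀ᵐ x ∂(volume.restrict (Ioc (-r) r)), κ * nu x ^ ((d : ℝ) / 2) * k x ^ 2 ≤
      κ * nu x ^ ((d : ℝ) / 2) * g x ^ 2 := by
    rw [ae_restrict_iff' measurableSet_Ioc]
    filter_upwards [hkle'] with x hx hxm
    have h1 := nu_pos (hsub (Ioc_subset_Icc_self hxm))
    have h2 := sq_le_sq.2 (hx hxm)
    gcongr
  have hgI := (intervalIntegrable_iff_integrableOn_Ioc_of_le hlr).1 hg
  have hki : IntervalIntegrable (fun x => κ * nu x ^ ((d : ℝ) / 2) * k x ^ 2) volume (-r) r := by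
    rw [intervalIntegrable_iff_integrableOn_Ioc_of_le hlr]
    refine hgI.mono' ?_ ?_
    · exact ((hac.mono Ioc_subset_Icc_self).aestronglyMeasurable measurableSet_Ioc).mul
        (hkm.pow_const 2).aestronglyMeasurable
    · filter_upwards [hle, ae_restrict_mem measurableSet_Ioc] with x hx hxm
      have h1 := nu_pos (hsub (Ioc_subset_Icc_self hxm))
      rw [Real.norm_of_nonneg (by positivity)]
      exact hx
  refine (interpolation_on_Icc_of_pos hp1 hp hp2 hr0 hr1 hκ hw1 hk
    (fun x _ => hFpos n x) hki).trans ?_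
  rw [intervalIntegral.integral_of_le hlr, intervalIntegral.integral_of_le hlr]
  exact integral_mono_ae ((intervalIntegrable_iff_integrableOn_Ioc_of_le hlr).1 hki) hgI hle

/-! ### Exhaustion of `(-1, 1)` and the interpolation inequalities -/

section Interpolation

variable {d : ℕ} {p : ℝ} {f f' : ℝ → ℝ}

lemma Ioc_neg_subset {r : ℝ} (hr1 : r < 1) : Ioc (-r) r ⊆ Ioo (-1) 1 :=
  Ioc_subset_Icc_self.trans (Icc_subset_Ioo (by linarith) hr1)

lemma setIntegral_one_pos (hd : 1 ≤ d) {r : ℝ} (hr0 : 0 < r) (hr1 : r < 1) :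
    0 < ∫ _ in Ioc (-r) r, (1 : ℝ) ∂(nuMeasure d) := by
  have hlr : -r < r := by linarith
  have hsub : Icc (-r) r ⊆ Ioo (-1) 1 := Icc_subset_Ioo (by linarith) hr1
  rw [setIntegral_nuMeasure hd measurableSet_Ioc (Ioc_neg_subset hr1)]
  simp only [mul_one]
  rw [← intervalIntegral.integral_of_le hlr.le]
  refine intervalIntegral.intervalIntegral_pos_of_pos_on ?_
    (fun x hx => density_pos hd (hsub (Ioo_subset_Icc_self hx))) hlr
  refine ContinuousOn.intervalIntegrable ?_
  rw [uIcc_of_le hlr.le]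
  exact (continuousOn_density d).mono hsub

lemma MemH1.integrableOn_rpow (hd : 1 ≤ d) (h : MemH1 d f f') (hp : 0 ≤ p) {r : ℝ}
    (hr0 : 0 < r) (hr1 : r < 1) :
    IntegrableOn (fun x => |f x| ^ p) (Ioc (-r) r) (nuMeasure d) := by
  have hlr : -r ≤ r := by linarith
  have hsub : Icc (-r) r ⊆ Ioo (-1) 1 := Icc_subset_Ioo (by linarith) hr1
  obtain ⟨F, hFae, hF⟩ := h.weakDeriv.exists_isPrimitiveOn
  have hFc := (hF (-r) r (by linarith) hlr hr1).continuousOn hlr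
  rw [integrableOn_nuMeasure_iff hd measurableSet_Ioc (Ioc_neg_subset hr1)]
  have h1 : ContinuousOn (fun x => density d x * |F x| ^ p) (Icc (-r) r) :=
    ((continuousOn_density d).mono hsub).mul (hFc.abs.rpow_const fun x _ => Or.inr hp)
  refine ((h1.integrableOn_Icc).mono_set Ioc_subset_Icc_self).congr ?_
  rw [EventuallyEq, ae_restrict_iff' measurableSet_Ioc]
  filter_upwards [hFae] with x hx hxm
  rw [hx (hsub (Ioc_subset_Icc_self hxm))]

/-- The interpolation inequality for the normalized restriction of `dν_d` to `(-r, r]`. -/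
lemma MemH1.interpolation_restrict (hd : 1 ≤ d) (hp1 : 1 ≤ p)
    (hp : 3 ≤ d → p ≤ 2 * (d : ℝ) / ((d : ℝ) - 2)) (hp2 : p ≠ 2) (h : MemH1 d f f')
    {r m : ℝ} (hr0 : 0 < r) (hr1 : r < 1)
    (hm : m = ∫ _ in Ioc (-r) r, (1 : ℝ) ∂(nuMeasure d)) :
    d / (p - 2) * (((∫ x in Ioc (-r) r, |f x| ^ p ∂(nuMeasure d)) / m) ^ (2 / p) -
      (∫ x in Ioc (-r) r, |f x| ^ (2 : ℝ) ∂(nuMeasure d)) / m) ≤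
      (∫ x in Ioc (-r) r, |f' x| ^ 2 * nu x ∂(nuMeasure d)) / m := by
  have hlr : -r ≤ r := by linarith
  have hsub : Ioc (-r) r ⊆ Ioo (-1) 1 := Ioc_neg_subset hr1
  have hm0 : 0 < m := hm ▸ setIntegral_one_pos hd hr0 hr1
  have hZ := Z_pos hd
  obtain ⟨F, hFae, hF⟩ := h.weakDeriv.exists_isPrimitiveOn
  set κ : ℝ := (Z d)⁻¹ / m with hκ
  have hκ0 : 0 < κ := by positivity
  have hκρ : ∀ x, κ * nu x ^ ((d : ℝ) / 2 - 1) = density d x / m := fun x => by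
    rw [hκ, density]
    ring
  have hconv : ∀ φ ψ : ℝ → ℝ, (∀ᵐ x, x ∈ Ioo (-1 : ℝ) 1 → φ x = ψ x) →
      ∫ x in (-r)..r, κ * nu x ^ ((d : ℝ) / 2 - 1) * φ x =
        (∫ x in Ioc (-r) r, ψ x ∂(nuMeasure d)) / m := by
    intro φ ψ hφψ
    rw [setIntegral_nuMeasure hd measurableSet_Ioc hsub, intervalIntegral.integral_of_le hlr,
      ← integral_div]
    refine integral_congr_ae ?_
    rw [EventuallyEq, ae_restrict_iff' measurableSet_Ioc]
    filter_upwards [hφψ] with x hx hxm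
    rw [hκρ, hx (hsub hxm)]
    ring
  have hw1 : ∫ x in (-r)..r, κ * nu x ^ ((d : ℝ) / 2 - 1) = 1 := by
    have := hconv (fun _ => 1) (fun _ => 1) (Eventually.of_forall fun _ _ => rfl)
    simp only [mul_one] at this
    rw [this, ← hm, div_self hm0.ne']
  have hpow : ∀ s, powInt (fun x => κ * nu x ^ ((d : ℝ) / 2 - 1)) (-r) r s (fun x => |F x|) =
      (∫ x in Ioc (-r) r, |f x| ^ s ∂(nuMeasure d)) / m := fun s => by
    refine hconv _ _ ?_
    filter_upwards [hFae] with x hx hxm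
    rw [hx hxm]
  have hen : ∀ x ∈ Ioc (-r) r, density d x * (|f' x| ^ 2 * nu x) / m =
      κ * nu x ^ ((d : ℝ) / 2) * f' x ^ 2 := fun x hx => by
    rw [nu_rpow_eq_mul (hsub hx), ← mul_assoc κ, hκρ, sq_abs]
    ring
  have hEI : IntervalIntegrable (fun x => κ * nu x ^ ((d : ℝ) / 2) * f' x ^ 2) volume (-r) r := by
    rw [intervalIntegrable_iff_integrableOn_Ioc_of_le hlr]
    have h1 := (integrableOn_nuMeasure_iff hd measurableSet_Ioc hsub _).1
      h.energy.integrableOn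
    exact IntegrableOn.congr_fun (h1.div_const m) hen measurableSet_Ioc
  have hE : ∫ x in (-r)..r, κ * nu x ^ ((d : ℝ) / 2) * f' x ^ 2 =
      (∫ x in Ioc (-r) r, |f' x| ^ 2 * nu x ∂(nuMeasure d)) / m := by
    rw [setIntegral_nuMeasure hd measurableSet_Ioc hsub, intervalIntegral.integral_of_le hlr,
      ← integral_div]
    exact (setIntegral_congr_fun measurableSet_Ioc hen).symm
  have key := interpolation_on_Icc hp1 hp hp2 hr0 hr1 hκ0 hw1
    (hF (-r) r (by linarith) hlr hr1) hEI
  rwa [hpow, hpow, hE] at key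

/-- An exhausting sequence of radii. -/
def radius (n : ℕ) : ℝ := 1 - 1 / (n + 2)

lemma radius_lt_one (n : ℕ) : radius n < 1 := by
  have : (0 : ℝ) < 1 / (n + 2) := by positivity
  unfold radius
  linarith

lemma half_le_radius (n : ℕ) : 1 / 2 ≤ radius n := by
  have : (1 : ℝ) / (n + 2) ≤ 1 / 2 := by
    gcongr
    linarith [(Nat.cast_nonneg n : (0 : ℝ) ≤ n)]
  unfold radius
  linarith

lemma radius_pos (n : ℕ) : 0 < radius n := by linarith [half_le_radius n]

lemma tendsto_radius : Tendsto radius atTop (𝓝 1) := by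
  have h1 : Tendsto (fun n : ℕ => (n : ℝ) + 2) atTop atTop :=
    tendsto_atTop_add_const_right _ _ tendsto_natCast_atTop_atTop
  have h2 := (h1.const_div_atTop 1).const_sub 1
  rwa [sub_zero] at h2

lemma aecover_radius (d : ℕ) :
    AECover (nuMeasure d) atTop (fun n => Ioc (-radius n) (radius n)) where
  ae_eventually_mem := by
    refine ae_nuMeasure_of_ae (Eventually.of_forall fun x hx => ?_)
    have h1 : |x| < 1 := abs_lt.2 hx
    filter_upwards [tendsto_radius.eventually_const_lt h1] with n hn
    exact ⟨(abs_lt.1 hn).1, (abs_lt.1 hn).2.le⟩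
  measurableSet _ := measurableSet_Ioc

lemma MemH1.integrable_sq (h : MemH1 d f f') :
    Integrable (fun x => |f x| ^ (2 : ℝ)) (nuMeasure d) := by
  have := h.memLp.integrable_norm_rpow (by simp) (by simp)
  simpa using this

/-- For `p < 2` the measure is finite and `f` is in `L²`. For `p > 2` the inequality on `[-r, r]`,
whose constant is positive, bounds the `p`-th power integrals uniformly in `r`. -/
lemma MemH1.integrable_rpow (hd : 1 ≤ d) (hp1 : 1 ≤ p)
    (hp : 3 ≤ d → p ≤ 2 * (d : ℝ) / ((d : ℝ) - 2)) (hp2 : p ≠ 2) (h : MemH1 d f f') :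
    Integrable (fun x => |f x| ^ p) (nuMeasure d) := by
  have : Fact (1 ≤ d) := ⟨hd⟩
  rcases lt_or_gt_of_ne hp2 with hlt | hgt
  · have h1 : MemLp f (ENNReal.ofReal p) (nuMeasure d) := by
      refine h.memLp.mono_exponent ?_
      rw [show (2 : ENNReal) = ENNReal.ofReal 2 by simp]
      exact ENNReal.ofReal_le_ofReal hlt.le
    have h2 := h1.integrable_norm_rpow (by simp; linarith) (by simp)
    rw [ENNReal.toReal_ofReal (by linarith)] at h2
    exact h2
  set m : ℕ → ℝ := fun n => ∫ _ in Ioc (-radius n) (radius n), (1 : ℝ) ∂(nuMeasure d) with hm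
  -- All radii are at least `1 / 2`, so the normalizing masses `m n` are bounded below by `m₀`.
  set m₀ : ℝ := ∫ _ in Ioc (-(1 / 2 : ℝ)) (1 / 2), (1 : ℝ) ∂(nuMeasure d) with hm₀
  have hm₀0 : 0 < m₀ := setIntegral_one_pos hd (by norm_num) (by norm_num)
  have hmm : ∀ n, m₀ ≤ m n := fun n => by
    refine setIntegral_mono_set (integrable_const _).integrableOn
      (Eventually.of_forall fun _ => zero_le_one) (Eventually.of_forall ?_)
    exact Ioc_subset_Ioc (neg_le_neg (half_le_radius n)) (half_le_radius n)
  have hm1 : ∀ n, m n ≤ 1 := fun n => by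
    refine (setIntegral_le_integral (integrable_const (μ := nuMeasure d) (1 : ℝ))
      (Eventually.of_forall fun _ => zero_le_one)).trans ?_
    simp
  set E := ∫ x, |f' x| ^ 2 * nu x ∂(nuMeasure d) with hE
  set B := ∫ x, |f x| ^ (2 : ℝ) ∂(nuMeasure d) with hB
  set c : ℝ := d / (p - 2) with hc
  have hd' : (1 : ℝ) ≤ d := by exact_mod_cast hd
  have hc0 : 0 < c := div_pos (by linarith) (by linarith)
  set Q : ℝ := (E / c + B) / m₀ with hQ
  have hen0 : 0 ≤ᵐ[nuMeasure d] fun x => |f' x| ^ 2 * nu x :=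
    ae_nuMeasure_of_ae (Eventually.of_forall fun x hx =>
      mul_nonneg (by positivity) (nu_pos hx).le)
  refine (aecover_radius d).integrable_of_integral_norm_bounded (Q ^ (p / 2))
    (fun n => h.integrableOn_rpow hd (by linarith) (radius_pos n) (radius_lt_one n))
    (Eventually.of_forall fun n => ?_)
  have hnorm : ∀ x, ‖|f x| ^ p‖ = |f x| ^ p := fun x =>
    Real.norm_of_nonneg (Real.rpow_nonneg (abs_nonneg _) _)
  simp only [hnorm]
  have key := h.interpolation_restrict hd hp1 hp hp2 (radius_pos n) (radius_lt_one n)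
    (m := m n) rfl
  set A := ∫ x in Ioc (-radius n) (radius n), |f x| ^ p ∂(nuMeasure d) with hA
  have hA0 : 0 ≤ A := integral_nonneg fun x => Real.rpow_nonneg (abs_nonneg _) _
  have hmn : 0 < m n := hm₀0.trans_le (hmm n)
  have hEn : ∫ x in Ioc (-radius n) (radius n), |f' x| ^ 2 * nu x ∂(nuMeasure d) ≤ E :=
    setIntegral_le_integral h.energy hen0
  have hBn : ∫ x in Ioc (-radius n) (radius n), |f x| ^ (2 : ℝ) ∂(nuMeasure d) ≤ B :=
    setIntegral_le_integral h.integrable_sq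
      (Eventually.of_forall fun x => Real.rpow_nonneg (abs_nonneg _) _)
  have hE0 : 0 ≤ E := integral_nonneg_of_ae hen0
  have hB0 : 0 ≤ B := integral_nonneg fun x => Real.rpow_nonneg (abs_nonneg _) _
  have h1 : (A / m n) ^ (2 / p) ≤ Q := by
    have h2 : (∫ x in Ioc (-radius n) (radius n), |f' x| ^ 2 * nu x ∂(nuMeasure d)) / m n ≤
        E / m n := by gcongr
    have h3 : (∫ x in Ioc (-radius n) (radius n), |f x| ^ (2 : ℝ) ∂(nuMeasure d)) / m n ≤
        B / m n := by gcongr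
    have h4 : (A / m n) ^ (2 / p) ≤ E / m n / c + B / m n := by
      have h5 := key.trans h2
      rw [mul_comm, ← le_div_iff₀ hc0] at h5
      linarith
    refine h4.trans ?_
    calc E / m n / c + B / m n = (E / c + B) / m n := by ring
      _ ≤ Q := by
        rw [hQ]
        have := hmm n
        gcongr
  have h2 : A / m n ≤ Q ^ (p / 2) := by
    have h3 : ((A / m n) ^ (2 / p)) ^ (p / 2) = A / m n := by
      rw [← Real.rpow_mul (by positivity)]
      have : 2 / p * (p / 2) = 1 := by
        have : p ≠ 0 := by linarith
        field_simp
      rw [this, Real.rpow_one]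
    rw [← h3]
    gcongr
  calc A = A / m n * m n := by field_simp
    _ ≤ A / m n * 1 := by
      have := hm1 n
      gcongr
    _ = A / m n := mul_one _
    _ ≤ _ := h2

lemma normLp_sq (p : ℝ) :
    normLp d p f ^ 2 = (∫ x, |f x| ^ p ∂(nuMeasure d)) ^ (2 / p) := by
  have h0 : 0 ≤ ∫ x, |f x| ^ p ∂(nuMeasure d) :=
    integral_nonneg fun x => Real.rpow_nonneg (abs_nonneg _) _
  unfold normLp
  rw [← Real.rpow_natCast, ← Real.rpow_mul h0]
  congr 1
  push_cast
  ring

lemma normLp_two_sq : normLp d 2 f ^ 2 = ∫ x, |f x| ^ (2 : ℝ) ∂(nuMeasure d) := by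
  rw [normLp_sq]
  simp

/-- The sharp interpolation inequalities. -/
theorem MemH1.interpolation (hd : 1 ≤ d) (hp1 : 1 ≤ p)
    (hp : 3 ≤ d → p ≤ 2 * (d : ℝ) / ((d : ℝ) - 2)) (hp2 : p ≠ 2) (h : MemH1 d f f') :
    d / (p - 2) * ((∫ x, |f x| ^ p ∂(nuMeasure d)) ^ (2 / p) -
      ∫ x, |f x| ^ (2 : ℝ) ∂(nuMeasure d)) ≤ ∫ x, |f' x| ^ 2 * nu x ∂(nuMeasure d) := by
  have : Fact (1 ≤ d) := ⟨hd⟩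
  have hcov := aecover_radius d
  have hm := hcov.integral_tendsto_of_countably_generated
    (integrable_const (μ := nuMeasure d) (1 : ℝ))
  rw [show ∫ _, (1 : ℝ) ∂(nuMeasure d) = 1 by simp] at hm
  have hA := (hcov.integral_tendsto_of_countably_generated
    (h.integrable_rpow hd hp1 hp hp2)).div hm one_ne_zero
  have hB := (hcov.integral_tendsto_of_countably_generated h.integrable_sq).div hm one_ne_zero
  have hE := (hcov.integral_tendsto_of_countably_generated h.energy).div hm one_ne_zero
  rw [div_one] at hA hB hE
  exact le_of_tendsto_of_tendsto
    (((hA.rpow_const (Or.inr (by positivity))).sub hB).const_mul _) hE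
    (Eventually.of_forall fun n => h.interpolation_restrict hd hp1 hp hp2 (radius_pos n)
      (radius_lt_one n) rfl)

end Interpolation

/-! ### The logarithmic Sobolev inequality -/

section LogSobolev

variable {d : ℕ} {f f' : ℝ → ℝ}

lemma sub_one_le_mul_log {y : ℝ} (hy : 0 ≤ y) : y - 1 ≤ y * Real.log y := by
  rcases hy.eq_or_lt with rfl | hy
  · simp
  · have := mul_le_mul_of_nonneg_left (Real.one_sub_inv_le_log_of_pos hy) hy.le
    rwa [mul_sub, mul_one, mul_inv_cancel₀ hy.ne'] at this

/-- This is `1 + u ≤ exp u` at `u = s log y`. It bounds `y log y` by an integrable power, and bounds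
the `L^p` norm below by the entropy. -/
lemma mul_one_add_log_le {y s : ℝ} (hy : 0 ≤ y) :
    y + s * (y * Real.log y) ≤ y * y ^ s := by
  rcases hy.eq_or_lt with rfl | hy
  · simp
  · rw [Real.rpow_def_of_pos hy]
    have := mul_le_mul_of_nonneg_left (Real.add_one_le_exp (Real.log y * s)) hy.le
    linarith

/-- There is room above `p = 2` below the critical exponent in every dimension. -/
lemma exists_exponent (d : ℕ) : ∃ s₀ : ℝ, 0 < s₀ ∧ ∀ s, s ≤ s₀ →
    (3 ≤ d → 2 + 2 * s ≤ 2 * (d : ℝ) / ((d : ℝ) - 2)) := by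
  rcases le_or_gt 3 d with h | h
  · have hd : (3 : ℝ) ≤ d := by exact_mod_cast h
    refine ⟨2 / (d - 2), div_pos (by norm_num) (by linarith), fun s hs _ => ?_⟩
    have h1 : (d : ℝ) - 2 ≠ 0 := by linarith
    have h2 : 2 * (d : ℝ) / (d - 2) = 2 + 2 * (2 / (d - 2)) := by
      field_simp
      ring
    rw [h2]
    linarith
  · exact ⟨1, one_pos, fun s _ h3 => absurd h3 (by omega)⟩

/-- The sharp logarithmic Sobolev inequality. -/
theorem MemH1.log_sobolev (hd : 1 ≤ d) (h : MemH1 d f f') :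
    Integrable (fun x => |f x| ^ 2 * Real.log (|f x| ^ 2 / normLp d 2 f ^ 2)) (nuMeasure d) ∧
      (d : ℝ) / 2 * ∫ x, |f x| ^ 2 * Real.log (|f x| ^ 2 / normLp d 2 f ^ 2) ∂(nuMeasure d) ≤
        ∫ x, |f' x| ^ 2 * nu x ∂(nuMeasure d) := by
  have : Fact (1 ≤ d) := ⟨hd⟩
  set E := ∫ x, |f' x| ^ 2 * nu x ∂(nuMeasure d) with hE
  have hE0 : 0 ≤ E := integral_nonneg_of_ae (ae_nuMeasure_of_ae
    (Eventually.of_forall fun x hx => mul_nonneg (by positivity) (nu_pos hx).le))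
  set B := normLp d 2 f ^ 2 with hB
  have hBeq : B = ∫ x, |f x| ^ (2 : ℝ) ∂(nuMeasure d) := normLp_two_sq
  have hB0 : 0 ≤ B := by positivity
  -- If `B = 0`, division by zero and `Real.log 0` both return `0`, so the integrand vanishes
  -- identically.
  rcases hB0.eq_or_lt with hB' | hBpos
  · rw [← hB']
    simpa using hE0
  set y : ℝ → ℝ := fun x => |f x| ^ 2 / B with hy
  have hy0 : ∀ x, 0 ≤ y x := fun x => by positivity
  have hG : ∀ x, |f x| ^ 2 * Real.log (|f x| ^ 2 / B) = B * (y x * Real.log (y x)) := fun x => by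
    simp only [hy]
    field_simp
  simp only [hG]
  have hsq : ∀ x, |f x| ^ (2 : ℝ) = |f x| ^ 2 := fun x => by
    rw [← Real.rpow_natCast]; norm_num
  have hyI : Integrable y (nuMeasure d) := by
    have := h.integrable_sq.div_const B
    simpa only [hsq] using this
  have hy1 : ∫ x, y x ∂(nuMeasure d) = 1 := by
    simp only [hy]
    rw [integral_div]
    simp only [← hsq]
    rw [← hBeq, div_self hBpos.ne']
  obtain ⟨s₀, hs₀, hexp⟩ := exists_exponent d
  have hyp : ∀ s : ℝ, 0 < s → ∀ x, y x * y x ^ s = |f x| ^ (2 + 2 * s) / B ^ (1 + s) := by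
    intro s hs x
    have h1 : y x * y x ^ s = y x ^ (1 + s) := by
      rw [Real.rpow_add_of_nonneg (hy0 x) zero_le_one hs.le, Real.rpow_one]
    rw [h1]
    simp only [hy]
    rw [Real.div_rpow (by positivity) hB0, ← hsq, ← Real.rpow_mul (abs_nonneg _)]
    congr 2
    ring
  have hpI : ∀ s : ℝ, 0 < s → s ≤ s₀ → Integrable (fun x => y x * y x ^ s) (nuMeasure d) := by
    intro s hs hs1
    simp only [hyp s hs]
    exact (h.integrable_rpow hd (by linarith) (hexp s hs1) (by linarith)).div_const _
  have hmeas : AEStronglyMeasurable (fun x => y x * Real.log (y x)) (nuMeasure d) :=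
    (hyI.aemeasurable.mul hyI.aemeasurable.log).aestronglyMeasurable
  have hI : Integrable (fun x => y x * Real.log (y x)) (nuMeasure d) := by
    refine ((integrable_const (1 : ℝ)).add ((hpI s₀ hs₀ le_rfl).div_const s₀)).mono' hmeas
      (Eventually.of_forall fun x => ?_)
    have h1 := sub_one_le_mul_log (hy0 x)
    have h2 := mul_one_add_log_le (s := s₀) (hy0 x)
    have h3 : y x * Real.log (y x) ≤ y x * y x ^ s₀ / s₀ := by
      rw [le_div_iff₀ hs₀]
      linarith [hy0 x]
    have h4 : 0 ≤ y x * y x ^ s₀ / s₀ :=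
      div_nonneg (mul_nonneg (hy0 x) (Real.rpow_nonneg (hy0 x) _)) hs₀.le
    rw [Real.norm_eq_abs, abs_le]
    simp only [Pi.add_apply]
    constructor <;> linarith [hy0 x]
  refine ⟨hI.const_mul B, ?_⟩
  rw [integral_const_mul]
  set e := ∫ x, y x * Real.log (y x) ∂(nuMeasure d) with he
  -- Nonnegativity of the entropy: `y log y ≥ y - 1` and `y` has mean one.
  have he0 : 0 ≤ e := by
    have h1 : ∫ x, (y x - 1) ∂(nuMeasure d) = 0 := by
      rw [integral_sub hyI (integrable_const _), hy1]
      simp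
    rw [← h1]
    exact integral_mono (hyI.sub (integrable_const _)) hI fun x => sub_one_le_mul_log (hy0 x)
  -- The inequality with `p = 2 + 2s`, in a form rational in `s` whose limit as `s → 0` is the
  -- entropy bound.
  have key : ∀ s, 0 < s → s ≤ s₀ → s ≤ 1 → d / 2 * (B * (e * (1 - s) / (1 + s ^ 2 * e))) ≤ E := by
    intro s hs hs1 hs2
    have h1 := h.interpolation hd (p := 2 + 2 * s) (by linarith) (hexp s hs1) (by linarith)
    rw [← hBeq] at h1
    set A := ∫ x, |f x| ^ (2 + 2 * s) ∂(nuMeasure d) with hA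
    have h2 : B ^ (1 + s) * (1 + s * e) ≤ A := by
      have h3 : ∫ x, (y x + s * (y x * Real.log (y x))) ∂(nuMeasure d) ≤
          ∫ x, y x * y x ^ s ∂(nuMeasure d) :=
        integral_mono (hyI.add (hI.const_mul s)) (hpI s hs hs1) fun x => mul_one_add_log_le (hy0 x)
      rw [integral_add hyI (hI.const_mul s), hy1, integral_const_mul, ← he] at h3
      simp only [hyp s hs] at h3
      rw [integral_div, ← hA, le_div_iff₀ (by positivity)] at h3
      linarith
    have hse : 0 ≤ s * e := by positivity
    have h4 : B * (1 + s * e) ^ (1 / (1 + s)) ≤ A ^ (2 / (2 + 2 * s)) := by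
      have h5 : (B ^ (1 + s) * (1 + s * e)) ^ (1 / (1 + s)) = B * (1 + s * e) ^ (1 / (1 + s)) := by
        rw [Real.mul_rpow (by positivity) (by positivity), ← Real.rpow_mul hB0,
          mul_one_div_cancel (by linarith), Real.rpow_one]
      have h6 : 2 / (2 + 2 * s) = 1 / (1 + s) := by
        rw [div_eq_div_iff (by linarith) (by linarith)]
        ring
      rw [← h5, h6]
      gcongr
    have h5 : (1 + s * e) / (1 + s ^ 2 * e) ≤ (1 + s * e) ^ (1 / (1 + s)) := by
      rw [div_le_iff₀ (by positivity)]
      -- Bernoulli's inequality for an exponent in `[0, 1]`.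
      have h6 : (1 + s * e) ^ (s / (1 + s)) ≤ 1 + s ^ 2 * e := by
        refine (rpow_one_add_le_one_add_mul_self (by linarith) (by positivity)
          ((div_le_one (by linarith)).2 (by linarith))).trans ?_
        have h7 : s / (1 + s) ≤ s := div_le_self hs.le (by linarith)
        have h8 := mul_le_mul_of_nonneg_right h7 hse
        have h9 : s * (s * e) = s ^ 2 * e := by ring
        linarith
      have h7 : 1 + s * e = (1 + s * e) ^ (1 / (1 + s)) * (1 + s * e) ^ (s / (1 + s)) := by
        rw [← Real.rpow_add (by positivity)]
        have : 1 / (1 + s) + s / (1 + s) = 1 := by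
          rw [← add_div, div_self (by linarith)]
        rw [this, Real.rpow_one]
      calc 1 + s * e = (1 + s * e) ^ (1 / (1 + s)) * (1 + s * e) ^ (s / (1 + s)) := h7
        _ ≤ _ := by gcongr
    have h6 : d / 2 * (B * (e * (1 - s) / (1 + s ^ 2 * e))) =
        d / (2 + 2 * s - 2) * (B * ((1 + s * e) / (1 + s ^ 2 * e)) - B) := by
      have : 1 + s ^ 2 * e ≠ 0 := by positivity
      rw [show 2 + 2 * s - 2 = 2 * s by ring]
      field_simp
      ring
    rw [h6]
    refine le_trans ?_ h1
    have h7 : 0 ≤ (d : ℝ) / (2 + 2 * s - 2) := div_nonneg (by positivity) (by linarith)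
    refine mul_le_mul_of_nonneg_left ?_ h7
    have h8 := mul_le_mul_of_nonneg_left h5 hB0
    linarith
  have hlim : Tendsto (fun s : ℝ => d / 2 * (B * (e * (1 - s) / (1 + s ^ 2 * e)))) (𝓝[>] 0)
      (𝓝 (d / 2 * (B * (e * (1 - 0) / (1 + 0 ^ 2 * e))))) := by
    refine Tendsto.mono_left ?_ nhdsWithin_le_nhds
    have : ContinuousAt (fun s : ℝ => d / 2 * (B * (e * (1 - s) / (1 + s ^ 2 * e)))) 0 := by
      refine ContinuousAt.const_mul (ContinuousAt.const_mul (ContinuousAt.div ?_ ?_ ?_) _) _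
      · fun_prop
      · fun_prop
      · norm_num
    exact this.tendsto
  have hlim' : d / 2 * (B * (e * (1 - 0) / (1 + 0 ^ 2 * e))) = d / 2 * (B * e) := by norm_num
  rw [hlim'] at hlim
  refine le_of_tendsto hlim ?_
  filter_upwards [Ioo_mem_nhdsGT (lt_min hs₀ one_pos)] with s hs
  exact key s hs.1 (hs.2.le.trans (min_le_left _ _)) (hs.2.le.trans (min_le_right _ _))

end LogSobolev

/-! ### Integration by parts up to the endpoints -/

lemma IsPrimitiveOn.mul {f g u v : ℝ → ℝ} {a b : ℝ} (hf : IsPrimitiveOn f g a b)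
    (hu : IsPrimitiveOn u v a b) (hab : a ≤ b) :
    IsPrimitiveOn (fun x => f x * u x) (fun x => g x * u x + f x * v x) a b := by
  have h := IsPrimitiveOn.of_absolutelyContinuous
    ((hf.absolutelyContinuous hab).fun_mul (hu.absolutelyContinuous hab)) hab
  have hae : ∀ᵐ x, x ∈ uIoc a b → deriv (fun x => f x * u x) x = g x * u x + f x * v x := by
    have hb : ∀ᵐ x : ℝ, x ≠ b := by simp [ae_iff]
    filter_upwards [hf.ae_hasDerivAt hab, hu.ae_hasDerivAt hab, hb] with x h1 h2 hxb hxm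
    rw [uIoc_of_le hab] at hxm
    have hx : x ∈ Ioo a b := ⟨hxm.1, lt_of_le_of_ne hxm.2 hxb⟩
    exact ((h1 hx).mul (h2 hx)).deriv
  refine ⟨h.integrable.congr_ae ((ae_restrict_iff' measurableSet_uIoc).2 hae), fun x hx => ?_⟩
  rw [h.eq x hx]
  congr 1
  refine intervalIntegral.integral_congr_ae ?_
  filter_upwards [hae] with y hy hym
  refine hy ?_
  rw [uIoc_of_le hx.1] at hym
  rw [uIoc_of_le hab]
  exact ⟨hym.1, hym.2.trans hx.2⟩

lemma IsPrimitiveOn.congr_ae {f g g' : ℝ → ℝ} {a b : ℝ} (hf : IsPrimitiveOn f g a b)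
    (hab : a ≤ b) (h : ∀ᵐ x, x ∈ Ioc a b → g x = g' x) : IsPrimitiveOn f g' a b := by
  refine ⟨hf.integrable.congr_ae ?_, fun x hx => ?_⟩
  · rw [uIoc_of_le hab]
    exact (ae_restrict_iff' measurableSet_Ioc).2 h
  · rw [hf.eq x hx]
    congr 1
    refine intervalIntegral.integral_congr_ae ?_
    filter_upwards [h] with y hy hym
    rw [uIoc_of_le hx.1] at hym
    exact hy ⟨hym.1, hym.2.trans hx.2⟩

lemma IsPrimitiveOn.comp_neg {f g : ℝ → ℝ} {b : ℝ} (hb : 0 ≤ b)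
    (hf : IsPrimitiveOn f g (-b) 0) :
    IsPrimitiveOn (fun x => f (-x)) (fun x => -g (-x)) 0 b := by
  refine ⟨?_, fun x hx => ?_⟩
  · have := ((IntervalIntegrable.iff_comp_neg (by simp)).1 hf.integrable).symm
    rw [neg_neg, neg_zero] at this
    exact this.neg
  · have h := hf.sub_eq (x := -x) (y := 0) ⟨by linarith [hx.2], by linarith [hx.1]⟩
      ⟨by linarith, le_rfl⟩
    rw [intervalIntegral.integral_neg, intervalIntegral.integral_comp_neg]
    simp only [neg_zero]
    linarith

/-- A left neighbourhood has positive measure, so it meets every set of full measure. Essential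
limits are therefore unique and preserve inequalities. -/
instance neBot_nhdsLT_inf_ae (x : ℝ) : (𝓝[<] x ⊓ ae (volume : Measure ℝ)).NeBot := by
  rw [inf_neBot_iff]
  intro s hs t ht
  obtain ⟨a, ha, hsub⟩ := (mem_nhdsLT_iff_exists_Ioo_subset).1 hs
  by_contra hne
  rw [not_nonempty_iff_eq_empty] at hne
  have h1 : Ioo a x ⊆ tᶜ := fun y hy hyt => by
    have : y ∈ s ∩ t := ⟨hsub hy, hyt⟩
    rw [hne] at this
    exact this
  have h2 : volume (Ioo a x) = 0 := measure_mono_null h1 ht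
  rw [Real.volume_Ioo, ENNReal.ofReal_eq_zero] at h2
  have : a < x := ha
  linarith

/-- The flux of a function with `ℒ h ∈ L²` is controlled near the endpoint. -/
lemma flux_sq_le {d : ℕ} (hd : 1 ≤ d) {J v L : ℝ → ℝ}
    (hJ : ∀ b, 0 ≤ b → b < 1 → IsPrimitiveOn J v 0 b)
    (hv : ∀ x ∈ Ioo (-1 : ℝ) 1, v x = nu x ^ ((d : ℝ) / 2 - 1) * L x)
    (hL : IntervalIntegrable (fun x => nu x ^ ((d : ℝ) / 2 - 1) * L x ^ 2) volume 0 1)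
    (hlim : Tendsto J (𝓝[<] 1 ⊓ ae volume) (𝓝 0)) :
    ∃ C, 0 ≤ C ∧ ∀ x, 1 / 2 ≤ x → x < 1 → J x ^ 2 ≤ C * nu x ^ ((d : ℝ) / 2) := by
  have hd' : (1 : ℝ) ≤ d := by exact_mod_cast hd
  set V : ℝ → ℝ := fun x => nu x ^ ((d : ℝ) / 2 - 1) with hV
  set S := ∫ x in (0 : ℝ)..1, V x * L x ^ 2 with hS
  have hVpos : ∀ x ∈ Ioo (-1 : ℝ) 1, 0 < V x := fun x hx => Real.rpow_pos_of_pos (nu_pos hx) _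
  have hS0 : 0 ≤ S := by
    rw [hS, intervalIntegral.integral_of_le zero_le_one, integral_Ioc_eq_integral_Ioo]
    exact setIntegral_nonneg measurableSet_Ioo fun x hx =>
      mul_nonneg (hVpos x ⟨by linarith [hx.1], hx.2⟩).le (sq_nonneg _)
  refine ⟨2 / d * ((S + 1) / 2) ^ 2, by positivity, fun x hx hx1 => ?_⟩
  have hxm : x ∈ Ioo (-1 : ℝ) 1 := ⟨by linarith, hx1⟩
  have hν := nu_pos hxm
  set M : ℝ := 2 / d * nu x ^ ((d : ℝ) / 2) with hM
  have hM0 : 0 < M := by positivity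
  -- For `y ≥ 1 / 2` one has `V ≤ 2 y V`, and `2 y V` has the antiderivative `-(2 / d) ν^(d/2)`.
  have hVle : ∀ b, x ≤ b → b < 1 → ∫ y in x..b, V y ≤ M := by
    intro b hxb hb
    have hsub : Icc x b ⊆ Ioo (-1) 1 := Icc_subset_Ioo hxm.1 hb
    have hVc : ContinuousOn V (Icc x b) := (continuousOn_nu_rpow _).mono hsub
    have hder : ∫ y in x..b, 2 * y * V y =
        -(2 / d * nu b ^ ((d : ℝ) / 2)) - -(2 / d * nu x ^ ((d : ℝ) / 2)) := by
      refine intervalIntegral.integral_eq_sub_of_hasDerivAt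
        (f := fun y => -(2 / d * nu y ^ ((d : ℝ) / 2))) ?_ ?_
      · intro y hy
        rw [uIcc_of_le hxb] at hy
        refine (((hasDerivAt_nu_rpow (hsub hy) ((d : ℝ) / 2)).const_mul
          (2 / (d : ℝ))).neg).congr_deriv ?_
        simp only [hV]
        field_simp
      · refine ContinuousOn.intervalIntegrable ?_
        rw [uIcc_of_le hxb]
        exact (continuousOn_const.mul continuousOn_id).mul hVc
    have hmono : ∫ y in x..b, V y ≤ ∫ y in x..b, 2 * y * V y := by
      refine intervalIntegral.integral_mono_on hxb ?_ ?_ fun y hy => ?_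
      · refine ContinuousOn.intervalIntegrable ?_
        rwa [uIcc_of_le hxb]
      · refine ContinuousOn.intervalIntegrable ?_
        rw [uIcc_of_le hxb]
        exact (continuousOn_const.mul continuousOn_id).mul hVc
      · have h1 := hVpos y (hsub hy)
        have h2 : 1 ≤ 2 * y := by linarith [hy.1]
        nlinarith
    have hb0 : 0 < nu b := nu_pos (hsub (right_mem_Icc.2 hxb))
    have : 0 ≤ 2 / d * nu b ^ ((d : ℝ) / 2) := by positivity
    rw [hM]
    linarith
  have hdiff : ∀ b, x ≤ b → b < 1 → |J b - J x| ≤ √M * ((S + 1) / 2) := by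
    intro b hxb hb
    have hsub : Icc x b ⊆ Ioo (-1) 1 := Icc_subset_Ioo hxm.1 hb
    have hJb := hJ b (by linarith) hb
    rw [hJb.sub_eq (x := x) (y := b) ⟨by linarith, hxb⟩ ⟨by linarith, le_rfl⟩]
    have hVi : IntervalIntegrable V volume x b := by
      refine ContinuousOn.intervalIntegrable ?_
      rw [uIcc_of_le hxb]
      exact (continuousOn_nu_rpow _).mono hsub
    have hLi : IntervalIntegrable (fun y => V y * L y ^ 2) volume x b := by
      refine hL.mono_set ?_
      rw [uIcc_of_le hxb, uIcc_of_le zero_le_one]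
      exact Icc_subset_Icc (by linarith) hb.le
    have hLS : ∫ y in x..b, V y * L y ^ 2 ≤ S := by
      refine intervalIntegral.integral_mono_interval (by linarith) hxb hb.le ?_ hL
      have hne : ∀ᵐ y : ℝ, y ≠ 1 := by simp [ae_iff]
      refine (ae_restrict_iff' measurableSet_Ioc).2 ?_
      filter_upwards [hne] with y hy hym
      exact mul_nonneg (hVpos y ⟨by linarith [hym.1], lt_of_le_of_ne hym.2 hy⟩).le (sq_nonneg _)
    have hs : 0 < √M := Real.sqrt_pos.2 hM0
    have hsq : √M * √M = M := Real.mul_self_sqrt hM0.le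
    -- Young's inequality with weight `√M`, in place of Cauchy–Schwarz: both terms then integrate to
    -- `O(√M)`.
    have hpt : ∀ y ∈ Icc x b, |v y| ≤ √M / 2 * (V y * L y ^ 2) + 1 / (2 * √M) * V y := by
      intro y hy
      have h1 := hVpos y (hsub hy)
      rw [hv y (hsub hy), abs_mul, abs_of_pos h1]
      have h2 : √M / 2 * (V y * L y ^ 2) + 1 / (2 * √M) * V y - V y * |L y| =
          V y * (√M * |L y| - 1) ^ 2 / (2 * √M) := by
        rw [← sq_abs (L y)]
        field_simp
        ring
      have : 0 ≤ V y * (√M * |L y| - 1) ^ 2 / (2 * √M) := by positivity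
      linarith
    calc |∫ y in x..b, v y| ≤ ∫ y in x..b, |v y| := intervalIntegral.abs_integral_le_integral_abs hxb
      _ ≤ ∫ y in x..b, (√M / 2 * (V y * L y ^ 2) + 1 / (2 * √M) * V y) := by
        refine intervalIntegral.integral_mono_on hxb ?_
          ((hLi.const_mul _).add (hVi.const_mul _)) hpt
        exact (hJb.mono (by linarith) hxb le_rfl).integrable.abs
      _ = √M / 2 * (∫ y in x..b, V y * L y ^ 2) + 1 / (2 * √M) * ∫ y in x..b, V y := by
        rw [intervalIntegral.integral_add (hLi.const_mul _) (hVi.const_mul _),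
          intervalIntegral.integral_const_mul, intervalIntegral.integral_const_mul]
      _ ≤ √M / 2 * S + 1 / (2 * √M) * M := by
        have := hVle b hxb hb
        gcongr
      _ = √M * ((S + 1) / 2) := by
        nth_rewrite 3 [← hsq]
        field_simp
  have habs : |J x| ≤ √M * ((S + 1) / 2) := by
    have h1 : Tendsto (fun b => |J b - J x|) (𝓝[<] 1 ⊓ ae volume) (𝓝 |0 - J x|) :=
      (hlim.sub_const (J x)).abs
    rw [zero_sub, abs_neg] at h1
    refine le_of_tendsto h1 (Eventually.filter_mono inf_le_left ?_)
    filter_upwards [Ioo_mem_nhdsLT hx1] with b hb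
    exact hdiff b hb.1.le hb.2
  calc J x ^ 2 = |J x| ^ 2 := (sq_abs _).symm
    _ ≤ (√M * ((S + 1) / 2)) ^ 2 := by gcongr
    _ = 2 / d * ((S + 1) / 2) ^ 2 * nu x ^ ((d : ℝ) / 2) := by
      rw [mul_pow, Real.sq_sqrt hM0.le, hM]
      ring

/-- Integration by parts up to the endpoint `1`: the boundary term vanishes there. -/
lemma integral_eq_neg_of_flux {d : ℕ} (hd : 1 ≤ d) {F u J v L : ℝ → ℝ}
    (hF : ∀ b, 0 ≤ b → b < 1 → IsPrimitiveOn F u 0 b)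
    (hJ : ∀ b, 0 ≤ b → b < 1 → IsPrimitiveOn J v 0 b)
    (hv : ∀ x ∈ Ioo (-1 : ℝ) 1, v x = nu x ^ ((d : ℝ) / 2 - 1) * L x)
    (hL : IntervalIntegrable (fun x => nu x ^ ((d : ℝ) / 2 - 1) * L x ^ 2) volume 0 1)
    (hFi : IntervalIntegrable (fun x => nu x ^ ((d : ℝ) / 2 - 1) * F x ^ 2) volume 0 1)
    (hint : IntervalIntegrable (fun x => u x * J x + F x * v x) volume 0 1)
    (hlim : Tendsto J (𝓝[<] 1 ⊓ ae volume) (𝓝 0)) :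
    ∫ x in (0 : ℝ)..1, (u x * J x + F x * v x) = -(F 0 * J 0) := by
  obtain ⟨C, hC0, hC⟩ := flux_sq_le hd hJ hv hL hlim
  -- The limit of `F J` at `1`, which exists because the derivative of `F J` is integrable up to the
  -- endpoint.
  set ℓ : ℝ := F 0 * J 0 + ∫ x in (0 : ℝ)..1, (u x * J x + F x * v x) with hℓ
  suffices ℓ = 0 by linarith
  by_contra hne
  have hprod : ∀ b, 0 ≤ b → b < 1 →
      F b * J b = F 0 * J 0 + ∫ x in (0 : ℝ)..b, (u x * J x + F x * v x) := fun b hb0 hb1 =>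
    ((hF b hb0 hb1).mul (hJ b hb0 hb1) hb0).eq b ⟨hb0, le_rfl⟩
  have htend : Tendsto (fun b => F b * J b) (𝓝[<] 1) (𝓝 ℓ) := by
    have h1 : ContinuousOn (fun b => ∫ x in (0 : ℝ)..b, (u x * J x + F x * v x))
        (uIcc 0 1) := intervalIntegral.continuousOn_primitive_interval
          ((intervalIntegrable_iff').1 hint)
    rw [uIcc_of_le zero_le_one] at h1
    have h2 := (h1 1 (right_mem_Icc.2 zero_le_one)).tendsto.mono_left
      (nhdsWithin_le_of_mem (mem_of_superset (Ioo_mem_nhdsLT zero_lt_one) Ioo_subset_Icc_self))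
    refine (h2.const_add (F 0 * J 0)).congr' ?_
    filter_upwards [Ioo_mem_nhdsLT zero_lt_one] with b hb
    exact (hprod b hb.1.le hb.2).symm
  have hev : ∀ᶠ b in 𝓝[<] (1 : ℝ), ℓ ^ 2 / 4 < (F b * J b) ^ 2 := by
    refine (htend.pow 2).eventually_const_lt ?_
    have : 0 < ℓ ^ 2 := by positivity
    linarith
  obtain ⟨a, ha, hsub⟩ := (mem_nhdsLT_iff_exists_Ioo_subset).1
    (hev.and (Ioo_mem_nhdsLT (show (1 / 2 : ℝ) < 1 by norm_num)))
  have ha1 : a < 1 := ha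
  -- Near `1`, `ℓ² / 4 < (F J)²` while `J² ≤ C V ν` and `ν ≤ 2 (1 - x)`. A nonzero `ℓ` would make `1
  -- / (1 - x)` integrable.
  have hbad : ∀ x ∈ Ioo a 1, |(x - 1)⁻¹| ≤
      8 * C / ℓ ^ 2 * (nu x ^ ((d : ℝ) / 2 - 1) * F x ^ 2) := by
    intro x hx
    obtain ⟨h1, h2⟩ := hsub hx
    have hxm : x ∈ Ioo (-1 : ℝ) 1 := ⟨by linarith [h2.1], hx.2⟩
    have h3 := hC x h2.1.le hx.2
    rw [nu_rpow_eq_mul hxm] at h3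
    have hV := Real.rpow_pos_of_pos (nu_pos hxm) ((d : ℝ) / 2 - 1)
    set V := nu x ^ ((d : ℝ) / 2 - 1)
    have hx1 : 0 < 1 - x := by linarith [hx.2]
    have h4 : nu x ≤ 2 * (1 - x) := by
      unfold nu
      nlinarith
    have h5 : (F x * J x) ^ 2 ≤ 2 * C * (1 - x) * (V * F x ^ 2) := by
      calc (F x * J x) ^ 2 = F x ^ 2 * J x ^ 2 := by ring
        _ ≤ F x ^ 2 * (C * (V * nu x)) := by gcongr
        _ ≤ F x ^ 2 * (C * (V * (2 * (1 - x)))) := by gcongr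
        _ = _ := by ring
    have hℓ2 : 0 < ℓ ^ 2 := by positivity
    have h1' : ℓ ^ 2 / 4 < (F x * J x) ^ 2 := h1
    rw [abs_inv, abs_sub_comm, abs_of_pos hx1, inv_eq_one_div, div_le_iff₀ hx1, div_mul_eq_mul_div,
      div_mul_eq_mul_div, le_div_iff₀ hℓ2]
    linarith
  have hni : ¬ IntervalIntegrable (fun x : ℝ => (x - 1)⁻¹) volume a 1 := by
    rw [intervalIntegrable_sub_inv_iff]
    push Not
    exact ⟨ha1.ne, right_mem_uIcc⟩
  refine hni ?_
  have h12 : 1 / 2 ≤ a := by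
    by_contra! hlt
    obtain ⟨y, hy1, hy2⟩ := exists_between (lt_min hlt ha1)
    have := (hsub ⟨hy1, hy2.trans_le (min_le_right _ _)⟩).2.1
    linarith [hy2.trans_le (min_le_left (1 / 2 : ℝ) 1)]
  have hFi' : IntervalIntegrable (fun x => 8 * C / ℓ ^ 2 *
      (nu x ^ ((d : ℝ) / 2 - 1) * F x ^ 2)) volume a 1 := by
    refine (hFi.mono_set ?_).const_mul _
    rw [uIcc_of_le ha1.le, uIcc_of_le zero_le_one]
    exact Icc_subset_Icc_left (by linarith)
  rw [intervalIntegrable_iff_integrableOn_Ioo_of_le ha1.le] at hFi' ⊢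
  refine Integrable.mono' hFi' (by fun_prop) ?_
  filter_upwards [ae_restrict_mem measurableSet_Ioo] with x hx
  exact hbad x hx

lemma intervalIntegrable_comp_neg {φ : ℝ → ℝ} (h : IntervalIntegrable φ volume (-1) 0) :
    IntervalIntegrable (fun x => φ (-x)) volume 0 1 := by
  have := ((IntervalIntegrable.iff_comp_neg (by simp)).1 h).symm
  rwa [neg_neg, neg_zero] at this

lemma tendsto_neg_nhdsLT_inf_ae :
    Tendsto (fun x : ℝ => -x) (𝓝[<] 1 ⊓ ae volume) (𝓝[>] (-1) ⊓ ae volume) :=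
  (tendsto_neg_nhdsLT (a := (1 : ℝ))).inf
    (Measure.measurePreserving_neg (volume : Measure ℝ)).quasiMeasurePreserving.tendsto_ae

/-- The interval is cut at `0` and the left half is reflected; the two boundary terms at `0` cancel.
-/
lemma integral_eq_zero_of_flux {d : ℕ} (hd : 1 ≤ d) {F u J v L : ℝ → ℝ}
    (hF : ∀ a b, -1 < a → a ≤ b → b < 1 → IsPrimitiveOn F u a b)
    (hJ : ∀ a b, -1 < a → a ≤ b → b < 1 → IsPrimitiveOn J v a b)
    (hv : ∀ x ∈ Ioo (-1 : ℝ) 1, v x = nu x ^ ((d : ℝ) / 2 - 1) * L x)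
    (hL : IntervalIntegrable (fun x => nu x ^ ((d : ℝ) / 2 - 1) * L x ^ 2) volume (-1) 1)
    (hFi : IntervalIntegrable (fun x => nu x ^ ((d : ℝ) / 2 - 1) * F x ^ 2) volume (-1) 1)
    (hint : IntervalIntegrable (fun x => u x * J x + F x * v x) volume (-1) 1)
    (hleft : Tendsto J (𝓝[>] (-1) ⊓ ae volume) (𝓝 0))
    (hright : Tendsto J (𝓝[<] 1 ⊓ ae volume) (𝓝 0)) :
    ∫ x in (-1 : ℝ)..1, (u x * J x + F x * v x) = 0 := by
  have hsubr : uIcc (0 : ℝ) 1 ⊆ uIcc (-1) 1 := by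
    rw [uIcc_of_le zero_le_one, uIcc_of_le (by norm_num)]
    exact Icc_subset_Icc_left (by norm_num)
  have hsubl : uIcc (-1 : ℝ) 0 ⊆ uIcc (-1) 1 := by
    rw [uIcc_of_le (by norm_num), uIcc_of_le (by norm_num)]
    exact Icc_subset_Icc_right (by norm_num)
  have hr := integral_eq_neg_of_flux hd (fun b h0 h1 => hF 0 b (by norm_num) h0 h1)
    (fun b h0 h1 => hJ 0 b (by norm_num) h0 h1) hv (hL.mono_set hsubr) (hFi.mono_set hsubr)
    (hint.mono_set hsubr) hright
  have hnu : ∀ x, nu (-x) = nu x := fun x => by simp [nu]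
  have hl := integral_eq_neg_of_flux (d := d) hd (F := fun x => F (-x)) (u := fun x => -u (-x))
    (J := fun x => J (-x)) (v := fun x => -v (-x)) (L := fun x => -L (-x))
    (fun b h0 h1 => (hF (-b) 0 (by linarith) (by linarith) one_pos).comp_neg h0)
    (fun b h0 h1 => (hJ (-b) 0 (by linarith) (by linarith) one_pos).comp_neg h0)
    (fun x hx => by
      rw [hv (-x) ⟨by linarith [hx.2], by linarith [hx.1]⟩, hnu]
      ring)
    (by simpa only [hnu, neg_sq] using intervalIntegrable_comp_neg (hL.mono_set hsubl))
    (by simpa only [hnu] using intervalIntegrable_comp_neg (hFi.mono_set hsubl))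
    (by
      refine (intervalIntegrable_comp_neg (hint.mono_set hsubl)).neg.congr
        (fun x _ => ?_)
      simp only [Pi.neg_apply]
      ring)
    (hleft.comp tendsto_neg_nhdsLT_inf_ae)
  have hl' : ∫ x in (0 : ℝ)..1, (-u (-x) * J (-x) + F (-x) * -v (-x)) =
      -∫ x in (-1 : ℝ)..0, (u x * J x + F x * v x) := by
    have h := intervalIntegral.integral_comp_neg (a := (0 : ℝ)) (b := 1)
      (fun x => u x * J x + F x * v x)
    rw [neg_zero] at h
    rw [← h, ← intervalIntegral.integral_neg]
    congr 1
    ext x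
    ring
  rw [hl', neg_zero] at hl
  rw [← intervalIntegral.integral_add_adjacent_intervals (hint.mono_set hsubl)
    (hint.mono_set hsubr), hr]
  linarith

lemma isPrimitiveOn_nu_rpow (s : ℝ) {a b : ℝ} (ha : -1 < a) (hab : a ≤ b) (hb : b < 1) :
    IsPrimitiveOn (fun x => nu x ^ s) (fun x => -2 * x * s * nu x ^ (s - 1)) a b := by
  have hsub : Icc a b ⊆ Ioo (-1) 1 := Icc_subset_Ioo ha hb
  have hc : ContinuousOn (fun x => -2 * x * s * nu x ^ (s - 1)) (Icc a b) :=
    ((by fun_prop : Continuous fun x : ℝ => -2 * x * s).continuousOn).mul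
      ((continuousOn_nu_rpow _).mono hsub)
  have hi : ∀ x ∈ Icc a b,
      IntervalIntegrable (fun x => -2 * x * s * nu x ^ (s - 1)) volume a x := fun x hx => by
    refine ContinuousOn.intervalIntegrable ?_
    rw [uIcc_of_le hx.1]
    exact hc.mono (Icc_subset_Icc_right hx.2)
  refine ⟨hi b (right_mem_Icc.2 hab), fun x hx => ?_⟩
  rw [intervalIntegral.integral_eq_sub_of_hasDerivAt (f := fun x => nu x ^ s) (fun y hy => ?_)
    (hi x hx)]
  · ring
  · rw [uIcc_of_le hx.1] at hy
    exact hasDerivAt_nu_rpow (hsub ⟨hy.1, hy.2.trans hx.2⟩) s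

lemma tendsto_congr_ae_inf {l : Filter ℝ} {φ ψ : ℝ → ℝ} {c : ℝ}
    (h : Tendsto φ (l ⊓ ae volume) (𝓝 c)) (hl : Ioo (-1 : ℝ) 1 ∈ l)
    (hae : ∀ᵐ x, x ∈ Ioo (-1 : ℝ) 1 → φ x = ψ x) : Tendsto ψ (l ⊓ ae volume) (𝓝 c) := by
  refine h.congr' ?_
  filter_upwards [mem_inf_of_left hl, mem_inf_of_right hae] with x hx h1
  exact h1 hx

/-- The ultraspherical operator represents the energy form. -/
theorem MemDomain.neg_scal_eq {d : ℕ} (hd : 1 ≤ d) {f f' h h' h'' : ℝ → ℝ} (hf : MemH1 d f f')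
    (hh : MemDomain d h h' h'') :
    -scal d f (ultraOp d h' h'') = ∫ x, f' x * h' x * nu x ∂(nuMeasure d) := by
  have hZ := inv_pos.2 (Z_pos hd)
  obtain ⟨F, hFae, hF⟩ := hf.weakDeriv.exists_isPrimitiveOn
  obtain ⟨K, hKae, hK⟩ := hh.weakDeriv₂.exists_isPrimitiveOn
  set L := ultraOp d h' h'' with hLdef
  set V : ℝ → ℝ := fun x => nu x ^ ((d : ℝ) / 2 - 1) with hV
  have hVmul : ∀ x ∈ Ioo (-1 : ℝ) 1, nu x ^ ((d : ℝ) / 2) = V x * nu x := fun x hx =>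
    nu_rpow_eq_mul hx _
  -- The self-adjoint form of the operator: `(ν^(d/2) h')' = ν^(d/2-1) ℒh`.
  have hJ : ∀ a b, -1 < a → a ≤ b → b < 1 →
      IsPrimitiveOn (fun x => nu x ^ ((d : ℝ) / 2) * K x) (fun x => V x * L x) a b := by
    intro a b ha hab hb
    refine ((isPrimitiveOn_nu_rpow _ ha hab hb).mul (hK a b ha hab hb) hab).congr_ae hab ?_
    filter_upwards [hKae] with x hx hxm
    have hxI : x ∈ Ioo (-1 : ℝ) 1 := ⟨ha.trans hxm.1, hxm.2.trans_lt hb⟩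
    rw [hx hxI, hVmul x hxI, hLdef]
    simp only [hV, ultraOp, nu]
    ring
  have hdens : ∀ φ : ℝ → ℝ, Integrable φ (nuMeasure d) →
      IntegrableOn (fun x => V x * φ x) (Ioo (-1) 1) := fun φ hφ => by
    refine ((integrable_nuMeasure_iff hd φ).1 hφ |>.const_mul (Z d)).congr
      (Eventually.of_forall fun x => ?_)
    have := (Z_pos hd).ne'
    simp only [density, hV]
    field_simp
  have hii : ∀ φ : ℝ → ℝ, IntegrableOn φ (Ioo (-1) 1) → IntervalIntegrable φ volume (-1) 1 :=
    fun φ hφ => (intervalIntegrable_iff_integrableOn_Ioo_of_le (by norm_num)).2 hφ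
  have hFae' : ∀ᵐ x ∂(volume.restrict (Ioo (-1 : ℝ) 1)), F x = f x :=
    (ae_restrict_iff' measurableSet_Ioo).2 hFae
  have hKae' : ∀ᵐ x ∂(volume.restrict (Ioo (-1 : ℝ) 1)), K x = h' x :=
    (ae_restrict_iff' measurableSet_Ioo).2 hKae
  have hm1 : AEStronglyMeasurable f' (nuMeasure d) :=
    (hf.weakDeriv.locInt_deriv.aestronglyMeasurable).mono_ac (withDensity_absolutelyContinuous _ _)
  have hm2 : AEStronglyMeasurable h' (nuMeasure d) :=
    (hh.memH1.weakDeriv.locInt_deriv.aestronglyMeasurable).mono_ac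
      (withDensity_absolutelyContinuous _ _)
  -- The cross term is dominated by the sum of the two energy densities.
  have hE : Integrable (fun x => f' x * h' x * nu x) (nuMeasure d) := by
    refine (hf.energy.add hh.memH1.energy).mono'
      ((hm1.mul hm2).mul continuous_nu.aestronglyMeasurable) ?_
    refine ae_nuMeasure_of_ae (Eventually.of_forall fun x hx => ?_)
    have h0 := nu_pos hx
    simp only [Real.norm_eq_abs, abs_mul, abs_of_pos h0, Pi.add_apply]
    nlinarith [sq_nonneg (|f' x| - |h' x|), sq_nonneg (|f' x| + |h' x|), sq_nonneg (|f' x|),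
      mul_nonneg h0.le (sq_nonneg (|f' x| - |h' x|)), mul_nonneg h0.le (sq_nonneg (|f' x|)),
      mul_nonneg h0.le (sq_nonneg (|h' x|))]
  have hP : Integrable (fun x => f x * L x) (nuMeasure d) := hf.memLp.integrable_mul hh.memLp_op
  have hsum : ∀ᵐ x ∂(volume.restrict (Ioo (-1 : ℝ) 1)),
      V x * (f' x * h' x * nu x + f x * L x) =
        f' x * (nu x ^ ((d : ℝ) / 2) * K x) + F x * (V x * L x) := by
    filter_upwards [hFae', hKae', ae_restrict_mem measurableSet_Ioo] with x h1 h2 hx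
    rw [h1, h2, hVmul x hx]
    ring
  have hzero := integral_eq_zero_of_flux hd hF hJ (fun x _ => rfl)
    (hii _ (hdens _ hh.memLp_op.integrable_sq))
    (hii _ ((hdens _ hf.memLp.integrable_sq).congr (by
      filter_upwards [hFae'] with x hx
      rw [hx])))
    (hii _ ((hdens _ (hE.add hP)).congr hsum))
    (tendsto_congr_ae_inf hh.flux_left (Ioo_mem_nhdsGT (by norm_num)) (by
      filter_upwards [hKae] with x hx hxm
      rw [hx hxm]))
    (tendsto_congr_ae_inf hh.flux_right (Ioo_mem_nhdsLT (by norm_num)) (by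
      filter_upwards [hKae] with x hx hxm
      rw [hx hxm]))
  have hfull : ∫ x, (f' x * h' x * nu x + f x * L x) ∂(nuMeasure d) = 0 := by
    rw [integral_nuMeasure hd]
    simp only [density, mul_assoc (Z d)⁻¹]
    rw [integral_const_mul, integral_congr_ae hsum, ← integral_Ioc_eq_integral_Ioo,
      ← intervalIntegral.integral_of_le (by norm_num), hzero, mul_zero]
  rw [integral_add hE hP] at hfull
  rw [scal]
  linarith

/-! ### The embedding into `L^p` and the main theorem -/

lemma MemH1.memLp_rpow {d : ℕ} (hd : 1 ≤ d) {p : ℝ} (hp1 : 1 ≤ p)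
    (hp : 3 ≤ d → p ≤ 2 * (d : ℝ) / ((d : ℝ) - 2)) (hp2 : p ≠ 2) {f f' : ℝ → ℝ}
    (h : MemH1 d f f') : MemLp f (ENNReal.ofReal p) (nuMeasure d) := by
  have hp0 : 0 < p := by linarith
  rw [← integrable_norm_rpow_iff h.memLp.aestronglyMeasurable (by simpa using hp0) (by simp),
    ENNReal.toReal_ofReal hp0.le]
  exact h.integrable_rpow hd hp1 hp hp2

end Ultraspherical

end

theorem mainTheorem5 (d : ℕ) (hd : 1 ≤ d) :
    (∀ f f' h h' h'' : ℝ → ℝ,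
      Ultraspherical.MemH1 d f f' → Ultraspherical.MemDomain d h h' h'' →
        -Ultraspherical.scal d f (Ultraspherical.ultraOp d h' h'') =
          ∫ x, f' x * h' x * Ultraspherical.nu x ∂(Ultraspherical.nuMeasure d)) ∧
    (∀ p : ℝ, 1 ≤ p → (3 ≤ d → p ≤ 2 * (d : ℝ) / ((d : ℝ) - 2)) → p ≠ 2 →
      ∀ f f' : ℝ → ℝ, Ultraspherical.MemH1 d f f' →
        MemLp f (ENNReal.ofReal p) (Ultraspherical.nuMeasure d) ∧
        ∫ x, |f' x| ^ 2 * Ultraspherical.nu x ∂(Ultraspherical.nuMeasure d) ≥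
          (d : ℝ) * ((Ultraspherical.normLp d p f ^ 2 - Ultraspherical.normLp d 2 f ^ 2)
            / (p - 2))) ∧
    (∀ f f' : ℝ → ℝ, Ultraspherical.MemH1 d f f' →
      Integrable (fun x => |f x| ^ 2 * Real.log (|f x| ^ 2 / Ultraspherical.normLp d 2 f ^ 2))
        (Ultraspherical.nuMeasure d) ∧
      ∫ x, |f' x| ^ 2 * Ultraspherical.nu x ∂(Ultraspherical.nuMeasure d) ≥
        (d : ℝ) / 2 * ∫ x, |f x| ^ 2 *
          Real.log (|f x| ^ 2 / Ultraspherical.normLp d 2 f ^ 2)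
            ∂(Ultraspherical.nuMeasure d)) := by
  refine ⟨fun f f' h h' h'' hf hh => hh.neg_scal_eq hd hf,
    fun p hp1 hp hp2 f f' hf => ⟨hf.memLp_rpow hd hp1 hp hp2, ?_⟩, fun f f' hf => hf.log_sobolev hd⟩
  rw [Ultraspherical.normLp_sq, Ultraspherical.normLp_two_sq, ge_iff_le, mul_div_assoc',
    mul_div_right_comm]
  exact hf.interpolation hd hp1 hp hp2
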